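/- Let $(\varepsilon_k)_{k\in\mathbb Z}$ be a strictly stationary sequence of real random variables on a probability space $(\Omega,\mathcal F,\mathbb P)$. Its $\beta$-mixing coefficients are $\beta_0=1$ and $$\beta_n=\sup_{k\in\mathbb Z}\beta\big(\sigma(\varepsilon_\ell:\ell\le k),\,\sigma(\varepsilon_{\ell+n}:\ell\ge k)\big)\quad(n\ge1),\qquad \beta(\mathcal A,\mathcal B)=\tfrac12\sup\sum_{i}\sum_{j}\big|\mathbb P(A_i\cap B_j)-\mathbb P(A_i)\mathbb P(B_j)\big|,$$ where the last supremum is over all finite partitions $(A_i)$, $(B_j)$ of $\Omega$ that are $\mathcal A$-measurable and $\mathcal B$-measurable respectively. Let $g:\mathbb R^{\mathbb Z}\to\mathbb R$ be measurable, set $X_k=g\big((\varepsilon_{k+i})_{i\in\mathbb Z}\big)$ for $k\in\mathbb Z$, and assume $\mathbb E X_k^2<\infty$ and $\mathbb E X_k=0$. Let $(Z^{(i)}_k)_{k\in\mathbb Z}$, $i=1,2,\dots$, be independent copies of a real Gaussian process $(Z_k)_{k\in\mathbb Z}$ with $\mathrm{Cov}(Z_k,Z_\ell)=\mathrm{Cov}(X_k,X_\ell)$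 for all $k,\ell\in\mathbb Z$. Let $N=N(n)$ be a sequence of positive integers. Define the $N\times n$ matrices $\mathcal X_n=(X_{(j-1)N+i})_{1\le i\le N,\,1\le j\le n}$ and $\mathcal Z_n=(Z^{(j)}_i)_{1\le i\le N,\,1\le j\le n}$, and put $\mathbf B_n=\frac1n\mathcal X_n\mathcal X_n^T$ and $\mathbf G_n=\frac1n\mathcal Z_n\mathcal Z_n^T$. For a symmetric real $N\times N$ matrix $A$ with eigenvalues $\lambda_1,\dots,\lambda_N$, counted with multiplicity, and $z\in\mathbb C$ with $\operatorname{Im}z>0$, let $$S_A(z)=\int\frac{1}{x-z}\,d\mu_A(x),\qquad \mu_A=\frac1N\sum_{k=1}^N\delta_{\lambda_k}.$$ If $\lim_{n\to\infty}N/n=c\in(0,\infty)$ and $\lim_{n\to\infty}\beta_n=0$, then for every $z\in\mathbb C$ with $\operatorname{Im}z>0$ the random variables $S_{\mathbf B_n}(z)$ and $S_{\mathbf G_n}(z)$ are integrable and $$\lim_{n\to\infty}\big|\mathbb E\,S_{\mathbf B_n}(z)-\mathbb E\,S_{\mathbf G_n}(z)\big|=0.$$ -/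

import Mathlib

open MeasureTheory ProbabilityTheory Filter Topology
open scoped ENNReal

namespace GramBetaMixing

noncomputable section

/-- A finite family `A` of sets is an `m`-measurable partition of `Ω` (empty cells are allowed; they
do not contribute to the sums below). -/
structure IsMeasurablePartition {Ω : Type*} (m : MeasurableSpace Ω) {p : ℕ}
    (A : Fin p → Set Ω) : Prop where
  measurableSet : ∀ i, MeasurableSet[m] (A i)
  disjoint : Pairwise fun i j => Disjoint (A i) (A j)
  iUnion_eq : ⋃ i, A i = Set.univ

/-- The absolute regularity coefficient
`β(𝒜, ℬ) = (1/2) sup ∑ i, ∑ j, |P(A i ∩ B j) - P(A i) P(B j)|`, the supremum being over all finite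
partitions `A`, `B` that are respectively `𝒜`- and `ℬ`-measurable. It is valued in `ℝ≥0∞`, so the
supremum is always a genuine one. -/
def betaCoeff {Ω : Type*} [MeasurableSpace Ω] (P : Measure Ω) (𝒜 ℬ : MeasurableSpace Ω) : ℝ≥0∞ :=
  (1 / 2) * ⨆ (p : ℕ) (q : ℕ) (A : Fin p → Set Ω) (B : Fin q → Set Ω)
    (_ : IsMeasurablePartition 𝒜 A) (_ : IsMeasurablePartition ℬ B),
      ENNReal.ofReal (∑ i, ∑ j, |P.real (A i ∩ B j) - P.real (A i) * P.real (B j)|)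

/-- The σ-algebra `σ(ε ℓ : ℓ ∈ S)` generated by the variables with index in `S`. -/
abbrev sigmaOf {Ω : Type*} (ε : ℤ → Ω → ℝ) (S : Set ℤ) : MeasurableSpace Ω :=
  ⨆ ℓ ∈ S, MeasurableSpace.comap (ε ℓ) inferInstance

/-- The β-mixing coefficients of a sequence: `β 0 = 1` and, for `n ≥ 1`,
`β n = sup over k of β(σ(ε ℓ : ℓ ≤ k), σ(ε (ℓ + n) : ℓ ≥ k))`. -/
def betaMixing {Ω : Type*} [MeasurableSpace Ω] (P : Measure Ω) (ε : ℤ → Ω → ℝ) (n : ℕ) : ℝ≥0∞ :=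
  if n = 0 then 1
  else ⨆ k : ℤ, betaCoeff P (sigmaOf ε (Set.Iic k)) (sigmaOf ε (Set.Ici (k + n)))

/-- Strict stationarity: every time shift of the sequence has the law of the sequence. -/
def IsStrictlyStationary {Ω : Type*} [MeasurableSpace Ω] (P : Measure Ω) (ε : ℤ → Ω → ℝ) : Prop :=
  ∀ k : ℤ, IdentDistrib (fun ω (i : ℤ) => ε (k + i) ω) (fun ω (i : ℤ) => ε i ω) P P

/-- The functional `X k = g (ξ k)` with `ξ k = (…, ε (k-1), ε k, ε (k+1), …)`, where `ε k` sits at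
coordinate `0`. -/
def functionalProcess {Ω : Type*} (g : (ℤ → ℝ) → ℝ) (ε : ℤ → Ω → ℝ) (k : ℤ) (ω : Ω) : ℝ :=
  g fun i => ε (k + i) ω

/-- The `N × n` matrix obtained by cutting `x 1, …, x (N n)` into `n` successive columns of length
`N`. With rows and columns numbered from `0`, the entry `(i, j)` is `x (j N + i + 1)`. -/
def dataMatrix (x : ℤ → ℝ) (N n : ℕ) : Matrix (Fin N) (Fin n) ℝ :=
  Matrix.of fun i j => x ((j : ℕ) * N + (i : ℕ) + 1)

/-- The `N × n` matrix whose columns are `(z j 1, …, z j N)`, `j = 0, …, n - 1`. -/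
def copiesMatrix (z : ℕ → ℤ → ℝ) (N n : ℕ) : Matrix (Fin N) (Fin n) ℝ :=
  Matrix.of fun i j => z j ((i : ℕ) + 1)

/-- The Gram matrix `(1/n) M Mᵀ` of an `N × n` matrix `M`. -/
def gramMatrix {N n : ℕ} (M : Matrix (Fin N) (Fin n) ℝ) : Matrix (Fin N) (Fin N) ℝ :=
  (n : ℝ)⁻¹ • (M * M.transpose)

/-- The empirical spectral measure `(1/N) ∑ δ_{λ k}`, with `λ 1, …, λ N` the eigenvalues counted
with multiplicity, of a real matrix all of whose eigenvalues are real. -/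
def empiricalSpectralMeasure {N : ℕ} (A : Matrix (Fin N) (Fin N) ℝ) : Measure ℝ :=
  (N : ℝ≥0∞)⁻¹ • (A.charpoly.roots.map fun t => Measure.dirac t).sum

/-- The Stieltjes transform `∫ 1 / (x - z) dμ(x)`. -/
def stieltjes (μ : Measure ℝ) (z : ℂ) : ℂ := resolventTransform μ z

theorem stieltjes_eq (μ : Measure ℝ) (z : ℂ) : stieltjes μ z = ∫ x : ℝ, 1 / ((x : ℂ) - z) ∂μ := by
  simp [stieltjes, resolventTransform_def, resolvent, Ring.inverse_eq_inv']

/-- The Stieltjes transform `S_A(z)` of the empirical spectral measure of `A`. -/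
def spectralStieltjes {N : ℕ} (A : Matrix (Fin N) (Fin N) ℝ) (z : ℂ) : ℂ :=
  stieltjes (empiricalSpectralMeasure A) z

end

end GramBetaMixing

/-! Each column `y` enters the Gram matrix as a rank-one term of weight `1/n`. If `W` is the
positive semidefinite contribution of the other columns, Sherman–Morrison writes the trace of the
resolvent of `W + y yᵀ/n` as that of `W` minus a quotient in which `y` occurs only through the
quadratic forms of `(W - z)⁻¹` and `(W - z)⁻²`. Hence changing one column moves the Stieltjes
transform by `O(1/N)` (`norm_columnStieltjes_update_sub_le`), and the change is at most `O(1/(N n))`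
times the differences of four quadratic forms of symmetric contractions
(`exists_quadForms_columnStieltjes`). In a Lindeberg scheme over the `n` columns, a data column may
therefore be exchanged for a Gaussian one as soon as all such forms concentrate, up to `o(N)` in
`L¹`, at the same number.

To use mixing with only second moments, `g` is replaced by a bounded centered function of finitely
many coordinates (`exists_window_approximation`), and short gaps are cut into every column by
setting entries to zero. Both changes are small in mean square, hence harmless
(`norm_columnStieltjes_sub_le`). The gaps separate successive columns, and the blocks inside one
column. A small β-coefficient means that a joint law is uniformly close to the product of its
marginals (`abs_map_prod_sub_le`), so bounded functions decouple (`abs_integral_decouple_le`). This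
serves twice. Across columns, in `abs_integral_sub_integral_le_of_replacement`, the error per column
is only `O(β/N)`, because one column moves the functional by `O(1/N)`; the sum is `O(β n/N)`. Across
the `K` blocks of a column, in `exists_integral_quadForm_sq_le`, the variance of a quadratic form
nearly adds up, which leaves `O(N²/K)` plus terms that are small for small β and large `N`.

On the Gaussian side, the covariances decay (`exists_covariance_decay`), so the covariance matrix
has norm `o(N)`, and quadratic forms concentrate by rotating two independent copies
(`integral_abs_quadForm_gaussian_le`). The two centres agree because the covariances do. The
Gaussian process need not be centered: its mean is common to all columns and contributes `O(1/N)`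
(`norm_columnStieltjes_add_const_sub_le`). Everything is bounded by `C t` for large `n`, with `C`
independent of the precision `t`. -/

namespace GramBetaMixing

open Matrix

/-! ### Quadratic forms of symmetric contractions -/

/-- A real symmetric matrix of operator norm at most one. -/
structure IsSymmContraction {N : ℕ} (A : Matrix (Fin N) (Fin N) ℝ) : Prop where
  symm : A.IsSymm
  contract : ∀ v : Fin N → ℝ, (A *ᵥ v) ⬝ᵥ (A *ᵥ v) ≤ v ⬝ᵥ v

/-- The quadratic form of a matrix. -/
def quadForm {N : ℕ} (A : Matrix (Fin N) (Fin N) ℝ) (v : Fin N → ℝ) : ℝ := v ⬝ᵥ (A *ᵥ v)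

/-- The trace of the resolvent `(W - z)⁻¹` of a real matrix. -/
noncomputable def resolventTrace {N : ℕ} (z : ℂ) (W : Matrix (Fin N) (Fin N) ℝ) : ℂ :=
  ((W.map ((↑) : ℝ → ℂ) - z • (1 : Matrix (Fin N) (Fin N) ℂ))⁻¹).trace

/-- Young's inequality with weight `t`, summed over coordinates. The free weight later makes the
large vector pay a small factor. -/
theorem dotProduct_le_half {N : ℕ} (t : ℝ) (ht : 0 < t) (u v : Fin N → ℝ) :
    |2 * (u ⬝ᵥ v)| ≤ t * (u ⬝ᵥ u) + t⁻¹ * (v ⬝ᵥ v) := by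
  simp only [dotProduct, Finset.mul_sum, ← Finset.sum_add_distrib]
  refine (Finset.abs_sum_le_sum_abs _ _).trans (Finset.sum_le_sum fun i _ => ?_)
  have h1 : 0 ≤ t⁻¹ * (t * u i - v i) ^ 2 := by positivity
  have h2 : 0 ≤ t⁻¹ * (t * u i + v i) ^ 2 := by positivity
  have e1 : t⁻¹ * (t * u i - v i) ^ 2 = t * (u i * u i) + t⁻¹ * (v i * v i) - 2 * (u i * v i) := by
    field_simp
    ring
  have e2 : t⁻¹ * (t * u i + v i) ^ 2 = t * (u i * u i) + t⁻¹ * (v i * v i) + 2 * (u i * v i) := by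
    field_simp
    ring
  exact abs_le.2 ⟨by linarith, by linarith⟩

theorem IsSymmContraction.dotProduct_mulVec_comm {N : ℕ} {A : Matrix (Fin N) (Fin N) ℝ}
    (hA : IsSymmContraction A) (u v : Fin N → ℝ) : u ⬝ᵥ (A *ᵥ v) = v ⬝ᵥ (A *ᵥ u) := by
  rw [dotProduct_mulVec, ← mulVec_transpose, hA.symm.eq, dotProduct_comm]

theorem IsSymmContraction.quadForm_add {N : ℕ} {A : Matrix (Fin N) (Fin N) ℝ}
    (hA : IsSymmContraction A) (u v : Fin N → ℝ) :
    quadForm A (u + v) = quadForm A u + 2 * (v ⬝ᵥ (A *ᵥ u)) + quadForm A v := by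
  simp only [quadForm, mulVec_add, add_dotProduct, dotProduct_add]
  rw [hA.dotProduct_mulVec_comm u v]
  ring

theorem dotProduct_self_nonneg' {N : ℕ} (v : Fin N → ℝ) : 0 ≤ v ⬝ᵥ v :=
  Finset.sum_nonneg fun i _ => mul_self_nonneg (v i)

theorem IsSymmContraction.abs_quadForm_le {N : ℕ} {A : Matrix (Fin N) (Fin N) ℝ}
    (hA : IsSymmContraction A) (v : Fin N → ℝ) : |quadForm A v| ≤ v ⬝ᵥ v := by
  have h := dotProduct_le_half 1 one_pos v (A *ᵥ v)
  have h2 := hA.contract v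
  rw [abs_mul, abs_two] at h
  unfold quadForm
  linarith

/-- Expansion around `x`: the cross term is split by Young's inequality so that the small vector `x
- y` carries the large factor `t⁻¹` and the large vector `x` the small factor `t`. -/
theorem IsSymmContraction.abs_quadForm_sub_le {N : ℕ} {A : Matrix (Fin N) (Fin N) ℝ}
    (hA : IsSymmContraction A) {t : ℝ} (ht : 0 < t) (x y : Fin N → ℝ) :
    |quadForm A x - quadForm A y| ≤ (t⁻¹ + 1) * ((x - y) ⬝ᵥ (x - y)) + t * (x ⬝ᵥ x) := by
  have e : y = x + (y - x) := by abel
  have e2 : (y - x) ⬝ᵥ (y - x) = (x - y) ⬝ᵥ (x - y) := by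
    rw [← neg_sub x y, neg_dotProduct_neg]
  have h1 := hA.quadForm_add x (y - x)
  rw [← e] at h1
  have h2 := dotProduct_le_half t⁻¹ (inv_pos.2 ht) (y - x) (A *ᵥ x)
  have h3 := hA.abs_quadForm_le (y - x)
  have h4 := mul_le_mul_of_nonneg_left (hA.contract x) ht.le
  rw [inv_inv] at h2
  rw [e2] at h2 h3
  rw [abs_le] at h2 h3 ⊢
  constructor <;> linarith [h2.1, h2.2, h3.1, h3.2]

/-! ### Resolvent traces of rank-one perturbations -/

section Resolvent

/-- Sherman–Morrison in the eigenbasis: the inverse is again a diagonal matrix plus a rank-one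
matrix, and it is verified by multiplication. -/
theorem trace_inv_diagonal_add_rankOne {N : ℕ} (d u : Fin N → ℂ) (α : ℂ) (hd : ∀ i, d i ≠ 0)
    (h : 1 + α * ∑ i, u i ^ 2 / d i ≠ 0) :
    ((diagonal d + α • vecMulVec u u)⁻¹).trace =
      ∑ i, (d i)⁻¹ - α * (∑ i, u i ^ 2 / d i ^ 2) / (1 + α * ∑ i, u i ^ 2 / d i) := by
  set a := ∑ i, u i ^ 2 / d i with ha
  set r : Fin N → ℂ := fun i => u i / d i with hr
  have hinv : (diagonal d + α • vecMulVec u u)⁻¹ =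
      diagonal (fun i => (d i)⁻¹) - (α / (1 + α * a)) • vecMulVec r r := by
    refine Matrix.inv_eq_right_inv ?_
    ext i j
    have e1 : ((diagonal d + α • vecMulVec u u) *
        (diagonal (fun i => (d i)⁻¹) - (α / (1 + α * a)) • vecMulVec r r)) i j =
        (1 : Matrix (Fin N) (Fin N) ℂ) i j + α * (u i * r j) - (α / (1 + α * a)) * (u i * r j)
          - α * (α / (1 + α * a)) * (u i * (∑ k, u k * r k) * r j) := by
      rw [Matrix.mul_sub, Matrix.add_mul, Matrix.add_mul]
      have f1 : diagonal d * diagonal (fun i => (d i)⁻¹) = (1 : Matrix (Fin N) (Fin N) ℂ) := by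
        rw [diagonal_mul_diagonal, ← diagonal_one]
        congr 1
        funext i
        exact mul_inv_cancel₀ (hd i)
      rw [f1]
      simp only [Matrix.mul_smul, Matrix.smul_mul, vecMulVec_mul_vecMulVec, Matrix.sub_apply,
        Matrix.add_apply, Matrix.smul_apply, smul_eq_mul, Matrix.diagonal_mul, Matrix.mul_diagonal,
        vecMulVec_apply, Pi.smul_apply, dotProduct, hr]
      have := hd i
      field_simp
      ring
    have e2 : ∑ k, u k * r k = a := by
      simp only [ha, hr]
      exact Finset.sum_congr rfl fun i _ => by ring
    rw [e1, e2]
    field_simp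
    ring
  rw [hinv, trace_sub, trace_smul, trace_diagonal, trace_vecMulVec]
  have e3 : r ⬝ᵥ r = ∑ i, u i ^ 2 / d i ^ 2 := by
    simp only [dotProduct, hr]
    exact Finset.sum_congr rfl fun i _ => by ring
  rw [e3, smul_eq_mul]
  ring

/-- Orthogonal diagonalization of a real symmetric matrix. -/
theorem exists_orthogonal_diagonalization {N : ℕ} {W : Matrix (Fin N) (Fin N) ℝ}
    (hW : W.IsHermitian) : ∃ (U : Matrix (Fin N) (Fin N) ℝ), U * Uᵀ = 1 ∧ Uᵀ * U = 1 ∧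
      W = U * diagonal hW.eigenvalues * Uᵀ := by
  refine ⟨hW.eigenvectorUnitary, ?_, ?_, ?_⟩
  · have := Unitary.coe_mul_star_self hW.eigenvectorUnitary
    rwa [Unitary.coe_star, star_eq_conjTranspose, conjTranspose_eq_transpose_of_trivial] at this
  · have := Unitary.coe_star_mul_self hW.eigenvectorUnitary
    rwa [star_eq_conjTranspose, conjTranspose_eq_transpose_of_trivial] at this
  · have := hW.spectral_theorem
    rw [Unitary.conjStarAlgAut_apply, star_eq_conjTranspose,
      conjTranspose_eq_transpose_of_trivial] at this
    exact this

theorem resolventTrace_conj {N : ℕ} (z : ℂ) {U : Matrix (Fin N) (Fin N) ℝ} (h1 : U * Uᵀ = 1)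
    (D : Matrix (Fin N) (Fin N) ℝ) : resolventTrace z (U * D * Uᵀ) = resolventTrace z D := by
  have h2 : Uᵀ * U = 1 := mul_eq_one_comm.1 h1
  set V : Matrix (Fin N) (Fin N) ℂ := U.map ((↑) : ℝ → ℂ) with hV
  have hmul : ∀ A B : Matrix (Fin N) (Fin N) ℝ,
      (A * B).map ((↑) : ℝ → ℂ) = A.map ((↑) : ℝ → ℂ) * B.map ((↑) : ℝ → ℂ) :=
    fun A B => Matrix.map_mul (f := Complex.ofRealHom)
  have hone : (1 : Matrix (Fin N) (Fin N) ℝ).map ((↑) : ℝ → ℂ) = 1 :=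
    Matrix.map_one _ Complex.ofReal_zero Complex.ofReal_one
  have h1' : V * Uᵀ.map ((↑) : ℝ → ℂ) = 1 := by rw [hV, ← hmul, h1, hone]
  have h2' : Uᵀ.map ((↑) : ℝ → ℂ) * V = 1 := by rw [hV, ← hmul, h2, hone]
  have i1 : V⁻¹ = Uᵀ.map ((↑) : ℝ → ℂ) := Matrix.inv_eq_right_inv h1'
  have i2 : (Uᵀ.map ((↑) : ℝ → ℂ))⁻¹ = V := Matrix.inv_eq_right_inv h2'
  have e : (U * D * Uᵀ).map ((↑) : ℝ → ℂ) - z • (1 : Matrix (Fin N) (Fin N) ℂ) =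
      V * (D.map ((↑) : ℝ → ℂ) - z • (1 : Matrix (Fin N) (Fin N) ℂ)) * Uᵀ.map ((↑) : ℝ → ℂ) := by
    rw [Matrix.mul_sub, Matrix.sub_mul, hmul, hmul, Matrix.mul_smul, Matrix.smul_mul,
      Matrix.mul_one, h1']
  unfold resolventTrace
  rw [e, Matrix.mul_inv_rev, Matrix.mul_inv_rev, i1, i2, trace_mul_comm, Matrix.mul_assoc, h2',
    Matrix.mul_one]

theorem vecMulVec_conj {N : ℕ} {U : Matrix (Fin N) (Fin N) ℝ} (h1 : U * Uᵀ = 1)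
    (d : Fin N → ℝ) (α : ℝ) (y : Fin N → ℝ) :
    U * diagonal d * Uᵀ + α • vecMulVec y y =
      U * (diagonal d + α • vecMulVec (Uᵀ *ᵥ y) (Uᵀ *ᵥ y)) * Uᵀ := by
  rw [Matrix.mul_add, Matrix.add_mul, Matrix.mul_smul, Matrix.smul_mul, mul_vecMulVec,
    vecMulVec_mul, mulVec_mulVec, h1, one_mulVec, ← mulVec_transpose, transpose_transpose,
    mulVec_mulVec, h1, one_mulVec]

theorem resolventTrace_diagonal_add {N : ℕ} {z : ℂ} (d c : Fin N → ℝ) (α : ℝ)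
    (hd : ∀ i, (d i : ℂ) - z ≠ 0)
    (h : 1 + (α : ℂ) * ∑ i, (c i : ℂ) ^ 2 / ((d i : ℂ) - z) ≠ 0) :
    resolventTrace z (diagonal d + α • vecMulVec c c) =
      ∑ i, ((d i : ℂ) - z)⁻¹ - α * (∑ i, (c i : ℂ) ^ 2 / ((d i : ℂ) - z) ^ 2) /
        (1 + α * ∑ i, (c i : ℂ) ^ 2 / ((d i : ℂ) - z)) := by
  rw [← trace_inv_diagonal_add_rankOne _ _ _ hd h]
  unfold resolventTrace
  congr 2
  ext i j
  by_cases hij : i = j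
  · subst hij
    simp [vecMulVec_apply]
    ring
  · simp [vecMulVec_apply, hij]

end Resolvent

/-! ### Stability of the resolvent trace under a change of the rank-one term -/

section RankOne

theorem isSymmContraction_conj {N : ℕ} {U : Matrix (Fin N) (Fin N) ℝ} (h1 : U * Uᵀ = 1)
    (h : Fin N → ℝ) (hh : ∀ i, |h i| ≤ 1) : IsSymmContraction (U * diagonal h * Uᵀ) := by
  have h2 : Uᵀ * U = 1 := mul_eq_one_comm.1 h1
  have key : ∀ w : Fin N → ℝ, (U *ᵥ w) ⬝ᵥ (U *ᵥ w) = w ⬝ᵥ w := fun w => by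
    rw [dotProduct_mulVec, ← mulVec_transpose, mulVec_mulVec, h2, one_mulVec]
  have key' : ∀ w : Fin N → ℝ, (Uᵀ *ᵥ w) ⬝ᵥ (Uᵀ *ᵥ w) = w ⬝ᵥ w := fun w => by
    rw [dotProduct_mulVec, ← mulVec_transpose, mulVec_mulVec, transpose_transpose, h1, one_mulVec]
  refine ⟨?_, fun v => ?_⟩
  · simp [Matrix.IsSymm, Matrix.mul_assoc]
  · rw [Matrix.mul_assoc, ← mulVec_mulVec, key, ← mulVec_mulVec, ← key' v]
    refine Finset.sum_le_sum fun i _ => ?_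
    rw [mulVec_diagonal]
    have : h i ^ 2 ≤ 1 := (sq_le_one_iff_abs_le_one _).2 (hh i)
    nlinarith [mul_self_nonneg ((Uᵀ *ᵥ v) i)]

theorem quadForm_conj {N : ℕ} (U : Matrix (Fin N) (Fin N) ℝ) (h y : Fin N → ℝ) :
    quadForm (U * diagonal h * Uᵀ) y = ∑ i, h i * (Uᵀ *ᵥ y) i ^ 2 := by
  unfold quadForm
  rw [Matrix.mul_assoc, ← mulVec_mulVec, dotProduct_mulVec, ← mulVec_transpose,
    ← mulVec_mulVec, dotProduct]
  refine Finset.sum_congr rfl fun i _ => ?_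
  rw [mulVec_diagonal]
  ring

variable {N : ℕ} {z : ℂ} {d : Fin N → ℝ} {α : ℝ}

theorem ofReal_sub_ne_zero (hz : 0 < z.im) (x : ℝ) : (x : ℂ) - z ≠ 0 := by
  intro h
  have := congrArg Complex.im h
  simp at this
  linarith

theorem im_le_norm_ofReal_sub (hz : 0 < z.im) (x : ℝ) : z.im ≤ ‖(x : ℂ) - z‖ := by
  have h := Complex.abs_im_le_norm ((x : ℂ) - z)
  simp only [Complex.sub_im, Complex.ofReal_im, zero_sub, abs_neg] at h
  rwa [abs_of_pos hz] at h

theorem norm_inv_ofReal_sub_le (hz : 0 < z.im) (x : ℝ) : ‖((x : ℂ) - z)⁻¹‖ ≤ z.im⁻¹ := by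
  rw [norm_inv]
  exact inv_anti₀ hz (im_le_norm_ofReal_sub hz x)

/-- `Im (1/(d - z)) = Im z / |d - z|²`. This ties the denominator of Sherman–Morrison to the
absolute sum that dominates its numerator. -/
theorem im_sum_sq_div (c : Fin N → ℝ) :
    ((α : ℂ) * ∑ i, (c i : ℂ) ^ 2 / ((d i : ℂ) - z)).im =
      z.im * (α * ∑ i, c i ^ 2 / ‖(d i : ℂ) - z‖ ^ 2) := by
  rw [Complex.im_ofReal_mul, Complex.im_sum, mul_left_comm, Finset.mul_sum (a := z.im)]
  congr 1
  refine Finset.sum_congr rfl fun i _ => ?_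
  rw [div_eq_mul_inv, ← Complex.ofReal_pow, Complex.im_ofReal_mul, Complex.inv_im,
    Complex.normSq_eq_norm_sq]
  simp
  ring

/-- After multiplication by `z`, each summand has imaginary part `Im z · d / |d - z|² ≥ 0` times a
nonnegative weight, so the imaginary part of the product is at least `Im z`. Nonnegative eigenvalues
enter here; the bound does not depend on `c`. -/
theorem one_add_lower_bound (hz : 0 < z.im) (hd : ∀ i, 0 ≤ d i) (hα : 0 ≤ α) (c : Fin N → ℝ) :
    z.im ≤ ‖z‖ * ‖1 + (α : ℂ) * ∑ i, (c i : ℂ) ^ 2 / ((d i : ℂ) - z)‖ := by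
  rw [← norm_mul]
  refine le_trans ?_ ((le_abs_self _).trans (Complex.abs_im_le_norm _))
  have e : z * (1 + (α : ℂ) * ∑ i, (c i : ℂ) ^ 2 / ((d i : ℂ) - z)) =
      z + (α : ℂ) * ∑ i, ((c i ^ 2 : ℝ) : ℂ) * (z * ((d i : ℂ) - z)⁻¹) := by
    simp only [mul_add, mul_one, Finset.mul_sum]
    congr 1
    refine Finset.sum_congr rfl fun i _ => ?_
    push_cast
    ring
  rw [e, Complex.add_im, Complex.im_ofReal_mul, Complex.im_sum]
  refine le_add_of_nonneg_right (mul_nonneg hα (Finset.sum_nonneg fun i _ => ?_))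
  rw [Complex.im_ofReal_mul]
  refine mul_nonneg (sq_nonneg _) ?_
  rw [Complex.mul_im, Complex.inv_im, Complex.inv_re]
  have : z.re * (-((d i : ℂ) - z).im / Complex.normSq ((d i : ℂ) - z)) +
      z.im * (((d i : ℂ) - z).re / Complex.normSq ((d i : ℂ) - z)) =
      z.im * d i / Complex.normSq ((d i : ℂ) - z) := by
    simp
    ring
  rw [this]
  exact div_nonneg (mul_nonneg hz.le (hd i)) (Complex.normSq_nonneg _)

theorem one_add_ne_zero (hz : 0 < z.im) (hd : ∀ i, 0 ≤ d i) (hα : 0 ≤ α) (c : Fin N → ℝ) :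
    1 + (α : ℂ) * ∑ i, (c i : ℂ) ^ 2 / ((d i : ℂ) - z) ≠ 0 := by
  intro h
  have := one_add_lower_bound hz hd hα c
  rw [h, norm_zero, mul_zero] at this
  linarith

/-- The left side is at most `α ∑ c²/|d - z|²`, which by `im_sum_sq_div` is the imaginary part of
the denominator divided by `Im z`. So the Sherman–Morrison quotient is bounded whatever the size of
`c`. -/
theorem norm_second_le (hz : 0 < z.im) (hα : 0 ≤ α) (c : Fin N → ℝ) :
    ‖(α : ℂ) * ∑ i, (c i : ℂ) ^ 2 / ((d i : ℂ) - z) ^ 2‖ ≤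
      z.im⁻¹ * ‖1 + (α : ℂ) * ∑ i, (c i : ℂ) ^ 2 / ((d i : ℂ) - z)‖ := by
  have h1 : ‖(α : ℂ) * ∑ i, (c i : ℂ) ^ 2 / ((d i : ℂ) - z) ^ 2‖ ≤
      α * ∑ i, c i ^ 2 / ‖(d i : ℂ) - z‖ ^ 2 := by
    rw [norm_mul, Complex.norm_real, Real.norm_of_nonneg hα]
    refine mul_le_mul_of_nonneg_left ((norm_sum_le _ _).trans_eq ?_) hα
    refine Finset.sum_congr rfl fun i _ => ?_
    rw [norm_div, norm_pow, norm_pow, Complex.norm_real, Real.norm_eq_abs, sq_abs]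
  have h2 : z.im * (α * ∑ i, c i ^ 2 / ‖(d i : ℂ) - z‖ ^ 2) ≤
      ‖1 + (α : ℂ) * ∑ i, (c i : ℂ) ^ 2 / ((d i : ℂ) - z)‖ := by
    rw [← im_sum_sq_div]
    refine le_trans ?_ ((le_abs_self _).trans (Complex.abs_im_le_norm _))
    simp
  refine h1.trans ?_
  rw [inv_mul_eq_div, le_div_iff₀ hz]
  linarith

/-- The quotient is Lipschitz with a constant free of the sizes of the numerators: only a lower
bound for `a` and a bound for the single quotient `b'/a'` are used. -/
theorem norm_div_sub_div_le {a b a' b' : ℂ} {v r : ℝ} (hv : 0 < v)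
    (h1 : v ≤ r * ‖a‖) (h2 : ‖b'‖ ≤ v⁻¹ * ‖a'‖) (ha' : a' ≠ 0) :
    ‖b / a - b' / a'‖ ≤ r / v * (‖b - b'‖ + v⁻¹ * ‖a - a'‖) := by
  have ha0 : 0 < ‖a‖ := by
    rcases (norm_nonneg a).eq_or_lt with h | h
    · rw [← h, mul_zero] at h1
      linarith
    · exact h
  have ha : a ≠ 0 := norm_pos_iff.1 ha0
  -- Placing everything over `a` keeps `b'` inside the bounded quotient `b'/a'`.
  have e : b / a - b' / a' = ((b - b') + b' / a' * (a' - a)) / a := by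
    field_simp
    ring
  have h3 : ‖b' / a'‖ ≤ v⁻¹ := by
    rw [norm_div]
    exact div_le_of_le_mul₀ (norm_nonneg _) (inv_nonneg.2 hv.le) h2
  have h4 : ‖(b - b') + b' / a' * (a' - a)‖ ≤ ‖b - b'‖ + v⁻¹ * ‖a - a'‖ := by
    refine (norm_add_le _ _).trans ?_
    rw [norm_mul, norm_sub_rev a' a]
    gcongr
  have h5 : 1 / ‖a‖ ≤ r / v := by
    rw [div_le_div_iff₀ ha0 hv]
    linarith
  rw [e, norm_div, div_eq_mul_one_div, mul_comm]
  exact mul_le_mul h5 h4 (norm_nonneg _) (le_trans (by positivity) h5)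

/-- A rank one perturbation of a positive semidefinite matrix moves the trace of the resolvent by a
bounded amount. -/
theorem norm_resolventTrace_sub_le (hz : 0 < z.im) (hα : 0 ≤ α) {W : Matrix (Fin N) (Fin N) ℝ}
    (hW : W.PosSemidef) (y y' : Fin N → ℝ) :
    ‖resolventTrace z (W + α • vecMulVec y y) - resolventTrace z (W + α • vecMulVec y' y')‖ ≤
      2 * z.im⁻¹ := by
  obtain ⟨U, hU, -, hWU⟩ := exists_orthogonal_diagonalization hW.1
  set d := hW.1.eigenvalues with hd_def
  have hd : ∀ i, 0 ≤ d i := fun i => hW.eigenvalues_nonneg i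
  have hn := fun c => one_add_ne_zero (z := z) hz hd hα c
  have hb : ∀ c : Fin N → ℝ, ‖(α : ℂ) * (∑ i, (c i : ℂ) ^ 2 / ((d i : ℂ) - z) ^ 2) /
      (1 + α * ∑ i, (c i : ℂ) ^ 2 / ((d i : ℂ) - z))‖ ≤ z.im⁻¹ := fun c => by
    rw [norm_div]
    exact div_le_of_le_mul₀ (norm_nonneg _) (inv_nonneg.2 hz.le) (norm_second_le hz hα c)
  -- In the eigenbasis of `W` the unperturbed traces cancel, leaving a difference of two quotients,
  -- each bounded by `1 / Im z`.
  rw [hWU, vecMulVec_conj hU, vecMulVec_conj hU, resolventTrace_conj _ hU, resolventTrace_conj _ hU,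
    resolventTrace_diagonal_add _ _ _ (fun i => ofReal_sub_ne_zero hz _) (hn _),
    resolventTrace_diagonal_add _ _ _ (fun i => ofReal_sub_ne_zero hz _) (hn _),
    sub_sub_sub_cancel_left]
  refine (norm_sub_le _ _).trans ?_
  linarith [hb (Uᵀ *ᵥ y), hb (Uᵀ *ᵥ y')]

/-- A weighted sum of squared eigencoordinates is a quadratic form with complex spectrum `w`. Its
real and imaginary parts are real quadratic forms; dividing the weights by `r` is meant to make them
contractions. -/
theorem norm_sum_le_quadForms {U : Matrix (Fin N) (Fin N) ℝ} (w : Fin N → ℂ) {r : ℝ} (hr : 0 < r)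
    (hα : 0 ≤ α) (y y' : Fin N → ℝ) :
    ‖(α : ℂ) * ∑ i, ((Uᵀ *ᵥ y) i : ℂ) ^ 2 * w i - (α : ℂ) * ∑ i, ((Uᵀ *ᵥ y') i : ℂ) ^ 2 * w i‖ ≤
      α * r *
        (|quadForm (U * diagonal (fun i => r⁻¹ * (w i).re) * Uᵀ) y -
            quadForm (U * diagonal (fun i => r⁻¹ * (w i).re) * Uᵀ) y'| +
          |quadForm (U * diagonal (fun i => r⁻¹ * (w i).im) * Uᵀ) y -
            quadForm (U * diagonal (fun i => r⁻¹ * (w i).im) * Uᵀ) y'|) := by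
  rw [← mul_sub, norm_mul, Complex.norm_real, Real.norm_of_nonneg hα, mul_assoc]
  refine mul_le_mul_of_nonneg_left ((Complex.norm_le_abs_re_add_abs_im _).trans_eq ?_) hα
  have hre : ∀ c : Fin N → ℝ, (∑ i, (c i : ℂ) ^ 2 * w i).re =
      r * ∑ i, (r⁻¹ * (w i).re) * c i ^ 2 := fun c => by
    rw [Complex.re_sum, Finset.mul_sum]
    refine Finset.sum_congr rfl fun i _ => ?_
    rw [← Complex.ofReal_pow, Complex.re_ofReal_mul]
    field_simp
  have him : ∀ c : Fin N → ℝ, (∑ i, (c i : ℂ) ^ 2 * w i).im =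
      r * ∑ i, (r⁻¹ * (w i).im) * c i ^ 2 := fun c => by
    rw [Complex.im_sum, Finset.mul_sum]
    refine Finset.sum_congr rfl fun i _ => ?_
    rw [← Complex.ofReal_pow, Complex.im_ofReal_mul]
    field_simp
  rw [Complex.sub_re, Complex.sub_im, hre, hre, him, him, quadForm_conj, quadForm_conj,
    quadForm_conj, quadForm_conj, ← mul_sub, ← mul_sub, abs_mul, abs_mul, abs_of_pos hr, mul_add]

/-- The trace of the resolvent of a rank one perturbation depends on the perturbing vector only
through four quadratic forms of bounded norm. -/
theorem exists_quadForms_resolventTrace (hz : 0 < z.im) (hα : 0 ≤ α)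
    {W : Matrix (Fin N) (Fin N) ℝ} (hW : W.PosSemidef) :
    ∃ A : Fin 4 → Matrix (Fin N) (Fin N) ℝ, (∀ s, IsSymmContraction (A s)) ∧
      ∀ y y' : Fin N → ℝ,
      ‖resolventTrace z (W + α • vecMulVec y y) - resolventTrace z (W + α • vecMulVec y' y')‖ ≤
        ‖z‖ / z.im ^ 3 * α * ∑ s, |quadForm (A s) y - quadForm (A s) y'| := by
  obtain ⟨U, hU, -, hWU⟩ := exists_orthogonal_diagonalization hW.1
  set d := hW.1.eigenvalues with hd_def
  have hd : ∀ i, 0 ≤ d i := fun i => hW.eigenvalues_nonneg i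
  have hn := fun c => one_add_ne_zero (z := z) hz hd hα c
  set w1 : Fin N → ℂ := fun i => ((d i : ℂ) - z)⁻¹ with hw1
  set w2 : Fin N → ℂ := fun i => (((d i : ℂ) - z) ^ 2)⁻¹ with hw2
  have hv1 : ∀ i, ‖w1 i‖ ≤ z.im⁻¹ := fun i => norm_inv_ofReal_sub_le hz _
  have hv2 : ∀ i, ‖w2 i‖ ≤ (z.im ^ 2)⁻¹ := fun i => by
    rw [hw2]
    simp only
    rw [← inv_pow, norm_pow, ← inv_pow]
    exact pow_le_pow_left₀ (norm_nonneg _) (hv1 i) 2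
  have hsc : ∀ {r x : ℝ}, 0 < r → |x| ≤ r → |r⁻¹ * x| ≤ 1 := fun {r x} hr hx => by
    rw [abs_mul, abs_of_pos (inv_pos.2 hr), inv_mul_le_iff₀ hr, mul_one]
    exact hx
  have r1 : 0 < z.im⁻¹ := inv_pos.2 hz
  have r2 : 0 < (z.im ^ 2)⁻¹ := inv_pos.2 (pow_pos hz 2)
  -- Real and imaginary parts of `(W - z)⁻¹` and `(W - z)⁻²`, normalised by their norm bounds `1 /
  -- Im z` and `1 / (Im z)²`.
  refine ⟨![U * diagonal (fun i => z.im⁻¹⁻¹ * (w1 i).re) * Uᵀ,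
    U * diagonal (fun i => z.im⁻¹⁻¹ * (w1 i).im) * Uᵀ,
    U * diagonal (fun i => (z.im ^ 2)⁻¹⁻¹ * (w2 i).re) * Uᵀ,
    U * diagonal (fun i => (z.im ^ 2)⁻¹⁻¹ * (w2 i).im) * Uᵀ], ?_, ?_⟩
  · intro s
    fin_cases s
    · exact isSymmContraction_conj hU _ fun i =>
        hsc r1 ((Complex.abs_re_le_norm _).trans (hv1 i))
    · exact isSymmContraction_conj hU _ fun i =>
        hsc r1 ((Complex.abs_im_le_norm _).trans (hv1 i))
    · exact isSymmContraction_conj hU _ fun i =>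
        hsc r2 ((Complex.abs_re_le_norm _).trans (hv2 i))
    · exact isSymmContraction_conj hU _ fun i =>
        hsc r2 ((Complex.abs_im_le_norm _).trans (hv2 i))
  · intro y y'
    have k1 := norm_sum_le_quadForms (U := U) (α := α) w1 r1 hα y y'
    have k2 := norm_sum_le_quadForms (U := U) (α := α) w2 r2 hα y y'
    have k := norm_div_sub_div_le
      (b := (α : ℂ) * ∑ i, ((Uᵀ *ᵥ y) i : ℂ) ^ 2 / ((d i : ℂ) - z) ^ 2) hz
      (one_add_lower_bound hz hd hα (Uᵀ *ᵥ y)) (norm_second_le hz hα (Uᵀ *ᵥ y')) (hn _)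
    rw [hWU, vecMulVec_conj hU, vecMulVec_conj hU, resolventTrace_conj _ hU,
      resolventTrace_conj _ hU,
      resolventTrace_diagonal_add _ _ _ (fun i => ofReal_sub_ne_zero hz _) (hn _),
      resolventTrace_diagonal_add _ _ _ (fun i => ofReal_sub_ne_zero hz _) (hn _),
      sub_sub_sub_cancel_left, norm_sub_rev]
    refine k.trans ?_
    rw [add_sub_add_left_eq_sub]
    simp only [div_eq_mul_inv] at k1 k2 ⊢
    refine (mul_le_mul_of_nonneg_left (add_le_add k2
      (mul_le_mul_of_nonneg_left k1 r1.le)) (by positivity)).trans_eq ?_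
    rw [Fin.sum_univ_four]
    simp only [Matrix.cons_val]
    field_simp
    ring

end RankOne

/-! ### Gram matrices as functions of their columns -/

section Gram

variable {N : ℕ} {z : ℂ}

/-- The Gram matrix `(1/n) ∑ j < n, x j (x j)ᵀ` of a sequence of columns. -/
noncomputable def columnGram (n : ℕ) (x : ℕ → Fin N → ℝ) : Matrix (Fin N) (Fin N) ℝ :=
  (n : ℝ)⁻¹ • ∑ j ∈ Finset.range n, vecMulVec (x j) (x j)

/-- The Stieltjes transform of the empirical spectral measure of the Gram matrix of a sequence of
columns. -/
noncomputable def columnStieltjes (z : ℂ) (n : ℕ) (x : ℕ → Fin N → ℝ) : ℂ :=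
  (N : ℂ)⁻¹ * resolventTrace z (columnGram n x)

theorem posSemidef_smul_sum_vecMulVec (n : ℕ) (s : Finset ℕ) (x : ℕ → Fin N → ℝ) :
    ((n : ℝ)⁻¹ • ∑ j ∈ s, vecMulVec (x j) (x j)).PosSemidef := by
  refine Matrix.PosSemidef.smul (Matrix.posSemidef_sum s fun j _ => ?_) (by positivity)
  simpa using Matrix.posSemidef_vecMulVec_self_star (x j)

theorem columnGram_posSemidef (n : ℕ) (x : ℕ → Fin N → ℝ) : (columnGram n x).PosSemidef :=
  posSemidef_smul_sum_vecMulVec n _ x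

/-- One `W`, built from the other columns, serves for every value of column `j`; the rank-one
estimates thereby become estimates for a change of one column. -/
theorem exists_columnGram_update (n : ℕ) (x : ℕ → Fin N → ℝ) {j : ℕ} (hj : j < n) :
    ∃ W : Matrix (Fin N) (Fin N) ℝ, W.PosSemidef ∧ ∀ u,
      columnGram n (Function.update x j u) = W + (n : ℝ)⁻¹ • vecMulVec u u := by
  refine ⟨_, posSemidef_smul_sum_vecMulVec n ((Finset.range n).erase j) x, fun u => ?_⟩
  rw [columnGram, ← Finset.sum_erase_add _ _ (Finset.mem_range.2 hj), smul_add]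
  congr 2
  · refine Finset.sum_congr rfl fun i hi => ?_
    rw [Function.update_of_ne (Finset.ne_of_mem_erase hi)]
  · rw [Function.update_self]

theorem columnGram_congr {n : ℕ} {x y : ℕ → Fin N → ℝ} (h : ∀ j < n, x j = y j) :
    columnGram n x = columnGram n y := by
  unfold columnGram
  congr 1
  exact Finset.sum_congr rfl fun j hj => by rw [h j (Finset.mem_range.1 hj)]

theorem columnStieltjes_congr {n : ℕ} {x y : ℕ → Fin N → ℝ} (h : ∀ j < n, x j = y j) :
    columnStieltjes z n x = columnStieltjes z n y := by
  rw [columnStieltjes, columnStieltjes, columnGram_congr h]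

theorem gramMatrix_eq_columnGram {n : ℕ} (M : Matrix (Fin N) (Fin n) ℝ) (x : ℕ → Fin N → ℝ)
    (h : ∀ i j, M i j = x j i) : gramMatrix M = columnGram n x := by
  unfold gramMatrix columnGram
  congr 1
  ext i i'
  rw [Matrix.mul_apply, Matrix.sum_apply, Finset.sum_range]
  exact Finset.sum_congr rfl fun j _ => by rw [transpose_apply, vecMulVec_apply, h, h]

theorem resolventTrace_eq_sum {A : Matrix (Fin N) (Fin N) ℝ} (hz : 0 < z.im)
    (hA : A.IsHermitian) :
    resolventTrace z A = ∑ i, ((hA.eigenvalues i : ℂ) - z)⁻¹ := by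
  obtain ⟨U, hU, -, hAU⟩ := exists_orthogonal_diagonalization hA
  -- The rank-one formula with no perturbation is the diagonal case.
  have h := resolventTrace_diagonal_add (z := z) hA.eigenvalues 0 0
    (fun i => ofReal_sub_ne_zero hz _) (by simp)
  simp only [zero_smul, add_zero] at h
  conv_lhs => rw [hAU]
  rw [resolventTrace_conj _ hU, h]
  simp

theorem norm_resolventTrace_le {A : Matrix (Fin N) (Fin N) ℝ} (hz : 0 < z.im)
    (hA : A.IsHermitian) : ‖resolventTrace z A‖ ≤ N * z.im⁻¹ := by
  rw [resolventTrace_eq_sum hz hA]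
  refine (norm_sum_le _ _).trans ?_
  refine (Finset.sum_le_sum fun i _ => norm_inv_ofReal_sub_le hz _).trans_eq ?_
  simp

theorem spectralStieltjes_eq {A : Matrix (Fin N) (Fin N) ℝ} (hz : 0 < z.im)
    (hA : A.IsHermitian) : spectralStieltjes A z = (N : ℂ)⁻¹ * resolventTrace z A := by
  have hm : empiricalSpectralMeasure A =
      (N : ℝ≥0∞)⁻¹ • ∑ i, Measure.dirac (hA.eigenvalues i) := by
    unfold empiricalSpectralMeasure
    rw [hA.roots_charpoly_eq_eigenvalues, Multiset.map_map]
    rfl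
  rw [spectralStieltjes, stieltjes_eq, hm, integral_smul_measure,
    integral_finsetSum_measure fun i _ => by
      exact (integrable_dirac (by simp)), resolventTrace_eq_sum hz hA]
  simp [integral_dirac]

theorem columnStieltjes_eq_spectralStieltjes (hz : 0 < z.im) (n : ℕ) (x : ℕ → Fin N → ℝ) :
    spectralStieltjes (columnGram n x) z = columnStieltjes z n x :=
  spectralStieltjes_eq hz (columnGram_posSemidef n x).1

theorem norm_columnStieltjes_le (hz : 0 < z.im) (n : ℕ) (x : ℕ → Fin N → ℝ) :
    ‖columnStieltjes z n x‖ ≤ z.im⁻¹ := by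
  rw [columnStieltjes, norm_mul, norm_inv, Complex.norm_natCast]
  rcases Nat.eq_zero_or_pos N with h | h
  · subst h
    simpa using hz.le
  · have := norm_resolventTrace_le hz (columnGram_posSemidef n x).1
    rw [inv_mul_le_iff₀ (by positivity)]
    exact this

/-- The inverse is the adjugate divided by the determinant, so the trace is measurable without any
invertibility assumption. -/
theorem measurable_resolventTrace :
    Measurable fun A : Fin N → Fin N → ℝ => resolventTrace z (Matrix.of A) := by
  have hc : Continuous fun A : Fin N → Fin N → ℝ =>
      ((Matrix.of A).map ((↑) : ℝ → ℂ) - z • (1 : Matrix (Fin N) (Fin N) ℂ)) := by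
    refine Continuous.sub ?_ continuous_const
    exact Continuous.matrix_map continuous_id Complex.continuous_ofReal
  unfold resolventTrace
  simp only [Matrix.inv_def, trace_smul, Ring.inverse_eq_inv', smul_eq_mul]
  exact (hc.matrix_det.measurable.inv).mul (hc.matrix_adjugate.matrix_trace.measurable)

theorem measurable_columnStieltjes (n : ℕ) :
    Measurable fun x : ℕ → Fin N → ℝ => columnStieltjes z n x := by
  refine Measurable.const_mul ?_ _
  have : (fun x : ℕ → Fin N → ℝ => resolventTrace z (columnGram n x)) =
      (fun A : Fin N → Fin N → ℝ => resolventTrace z (Matrix.of A)) ∘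
        fun (x : ℕ → Fin N → ℝ) (i i' : Fin N) =>
          (n : ℝ)⁻¹ * ∑ j ∈ Finset.range n, x j i * x j i' := by
    funext x
    simp only [Function.comp]
    congr 1
    ext i i'
    simp [columnGram, Matrix.sum_apply, vecMulVec_apply]
  rw [this]
  refine measurable_resolventTrace.comp ?_
  fun_prop

/-- Changing one column moves the Stieltjes transform by a bounded multiple of `1 / N`. -/
theorem norm_columnStieltjes_update_sub_le (hz : 0 < z.im) (n : ℕ) (x : ℕ → Fin N → ℝ) {j : ℕ}
    (hj : j < n) (u u' : Fin N → ℝ) :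
    ‖columnStieltjes z n (Function.update x j u) -
      columnStieltjes z n (Function.update x j u')‖ ≤ (N : ℝ)⁻¹ * (2 * z.im⁻¹) := by
  obtain ⟨W, hW, h⟩ := exists_columnGram_update n x hj
  rw [columnStieltjes, columnStieltjes, ← mul_sub, norm_mul, norm_inv, Complex.norm_natCast, h, h]
  exact mul_le_mul_of_nonneg_left (norm_resolventTrace_sub_le hz (by positivity) hW u u')
    (by positivity)

theorem exists_quadForms_columnStieltjes (hz : 0 < z.im) (n : ℕ) (x : ℕ → Fin N → ℝ) {j : ℕ}
    (hj : j < n) :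
    ∃ A : Fin 4 → Matrix (Fin N) (Fin N) ℝ, (∀ s, IsSymmContraction (A s)) ∧
      ∀ u u' : Fin N → ℝ, ‖columnStieltjes z n (Function.update x j u) -
        columnStieltjes z n (Function.update x j u')‖ ≤
        (N : ℝ)⁻¹ * (‖z‖ / z.im ^ 3 * (n : ℝ)⁻¹ *
          ∑ s, |quadForm (A s) u - quadForm (A s) u'|) := by
  obtain ⟨W, hW, h⟩ := exists_columnGram_update n x hj
  obtain ⟨A, hA, hAu⟩ := exists_quadForms_resolventTrace hz (α := (n : ℝ)⁻¹) (by positivity) hW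
  refine ⟨A, hA, fun u u' => ?_⟩
  rw [columnStieltjes, columnStieltjes, ← mul_sub, norm_mul, norm_inv, Complex.norm_natCast, h, h]
  exact mul_le_mul_of_nonneg_left (hAu u u') (by positivity)

/-- Changing all the columns, one at a time. -/
theorem norm_columnStieltjes_sub_le (hz : 0 < z.im) (n : ℕ) {t : ℝ} (ht : 0 < t)
    (x y : ℕ → Fin N → ℝ) :
    ‖columnStieltjes z n x - columnStieltjes z n y‖ ≤
      (N : ℝ)⁻¹ * (‖z‖ / z.im ^ 3 * (n : ℝ)⁻¹ * (4 * ∑ j ∈ Finset.range n,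
        ((t⁻¹ + 1) * ((x j - y j) ⬝ᵥ (x j - y j)) + t * (x j ⬝ᵥ x j)))) := by
  -- Interpolation: `w k` has its first `k` columns from `y` and the others from `x`, so that
  -- consecutive terms differ in column `k` alone.
  set w : ℕ → ℕ → Fin N → ℝ := fun k j => if j < k then y j else x j with hw
  have hstep : ∀ k ∈ Finset.range n,
      ‖columnStieltjes z n (w k) - columnStieltjes z n (w (k + 1))‖ ≤
      (N : ℝ)⁻¹ * (‖z‖ / z.im ^ 3 * (n : ℝ)⁻¹ * (4 *
        ((t⁻¹ + 1) * ((x k - y k) ⬝ᵥ (x k - y k)) + t * (x k ⬝ᵥ x k)))) := by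
    intro k hk
    obtain ⟨A, hA, hAu⟩ := exists_quadForms_columnStieltjes hz n (w k) (Finset.mem_range.1 hk)
    have e1 : w k = Function.update (w k) k (x k) := by
      funext j
      by_cases h : j = k
      · subst h
        simp [hw]
      · rw [Function.update_of_ne h]
    have e2 : w (k + 1) = Function.update (w k) k (y k) := by
      funext j
      by_cases h : j = k
      · subst h
        simp [hw]
      · rw [Function.update_of_ne h]
        simp only [hw]
        have : j < k + 1 ↔ j < k := by omega
        simp [this]
    rw [e2]
    nth_rewrite 1 [e1]
    refine (hAu _ _).trans ?_
    refine mul_le_mul_of_nonneg_left (mul_le_mul_of_nonneg_left ?_ (by positivity)) (by positivity)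
    refine (Finset.sum_le_sum fun s _ => (hA s).abs_quadForm_sub_le ht _ _).trans_eq ?_
    rw [Finset.sum_const, Finset.card_univ, Fintype.card_fin, nsmul_eq_mul, Nat.cast_ofNat]
  have e0 : columnStieltjes z n x = columnStieltjes z n (w 0) := by simp [hw]
  have en : columnStieltjes z n y = columnStieltjes z n (w n) :=
    columnStieltjes_congr fun j hj => by simp [hw, hj]
  rw [e0, en, ← Finset.sum_range_sub' (fun k => columnStieltjes z n (w k)) n]
  refine (norm_sum_le _ _).trans ((Finset.sum_le_sum hstep).trans_eq ?_)
  simp only [Finset.mul_sum]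

/-- Adding the same vector to all the columns moves the Stieltjes transform by `O(1 / N)`. -/
theorem norm_columnStieltjes_add_const_sub_le (hz : 0 < z.im) (n : ℕ) (x : ℕ → Fin N → ℝ)
    (m : Fin N → ℝ) :
    ‖columnStieltjes z n (fun j => x j + m) - columnStieltjes z n x‖ ≤
      (N : ℝ)⁻¹ * (4 * z.im⁻¹) := by
  rcases Nat.eq_zero_or_pos n with h0 | hn
  · subst h0
    rw [columnStieltjes_congr (y := x) (fun j hj => absurd hj (Nat.not_lt_zero j)), sub_self,
      norm_zero]
    positivity
  set β : ℝ := (n : ℝ)⁻¹ with hβ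
  set s : Fin N → ℝ := β • ∑ j ∈ Finset.range n, x j with hs
  have hnn : (n : ℝ) ≠ 0 := by positivity
  -- With `s` the average column, the shifted Gram matrix equals the old one plus `(s + m)(s + m)ᵀ -
  -- s sᵀ`. Moving the negative term to the left turns the shift into two rank-one perturbations of
  -- positive semidefinite matrices.
  have e : columnGram n (fun j => x j + m) + (1 : ℝ) • vecMulVec s s =
      columnGram n x + (1 : ℝ) • vecMulVec (s + m) (s + m) := by
    ext i i'
    have h1 : ∑ j ∈ Finset.range n, (x j i + m i) * (x j i' + m i') =
        ∑ j ∈ Finset.range n, x j i * x j i' + (∑ j ∈ Finset.range n, x j i) * m i' +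
          m i * (∑ j ∈ Finset.range n, x j i') + n * (m i * m i') := by
      simp only [Finset.sum_mul, Finset.mul_sum, ← Finset.sum_add_distrib]
      rw [← nsmul_eq_mul, ← Finset.card_range n, ← Finset.sum_const, Finset.card_range,
        ← Finset.sum_add_distrib]
      exact Finset.sum_congr rfl fun j _ => by ring
    simp only [columnGram, Matrix.add_apply, Matrix.smul_apply, Matrix.sum_apply, vecMulVec_apply,
      smul_eq_mul, Pi.add_apply, h1, hs, Pi.smul_apply, Finset.sum_apply, ← hβ]
    have : β * n = 1 := inv_mul_cancel₀ hnn
    linear_combination (m i * m i') * this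
  have hz0 : ∀ W : Matrix (Fin N) (Fin N) ℝ, W = W + (1 : ℝ) • vecMulVec 0 0 := by simp
  have k1 := norm_resolventTrace_sub_le hz zero_le_one
    (columnGram_posSemidef n (fun j => x j + m)) 0 s
  have k2 := norm_resolventTrace_sub_le hz zero_le_one (columnGram_posSemidef n x) (s + m) 0
  rw [← hz0] at k1 k2
  rw [e] at k1
  rw [columnStieltjes, columnStieltjes, ← mul_sub, norm_mul, norm_inv, Complex.norm_natCast]
  refine mul_le_mul_of_nonneg_left ?_ (by positivity)
  refine (norm_sub_le_norm_sub_add_norm_sub _ _ _).trans ((add_le_add k1 k2).trans_eq ?_)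
  ring

end Gram

/-! ### From β-coefficients to decoupling of integrals -/

section Decoupling

theorem isMeasurablePartition_preimage {Ω E : Type*} [MeasurableSpace E] {m : MeasurableSpace Ω} {U : Ω → E}
    (hU : Measurable[m] U) {p : ℕ} {f : E → Fin p} (hf : Measurable f) :
    IsMeasurablePartition m fun i => U ⁻¹' (f ⁻¹' {i}) where
  measurableSet i := hU (hf (measurableSet_singleton i))
  disjoint i j hij := by
    refine Set.disjoint_left.2 fun ω h1 h2 => hij ?_
    simp only [Set.mem_preimage, Set.mem_singleton_iff] at h1 h2
    rw [← h1, ← h2]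
  iUnion_eq := by
    ext ω
    simp

theorem sum_partition_le {Ω : Type*} {𝒜 ℬ : MeasurableSpace Ω} [MeasurableSpace Ω] {P : Measure Ω}
    {b : ℝ} (hb : 0 ≤ b)
    (hβ : betaCoeff P 𝒜 ℬ ≤ ENNReal.ofReal b) {p q : ℕ} {A : Fin p → Set Ω} {B : Fin q → Set Ω}
    (hA : IsMeasurablePartition 𝒜 A) (hB : IsMeasurablePartition ℬ B) :
    ∑ i, ∑ j, |P.real (A i ∩ B j) - P.real (A i) * P.real (B j)| ≤ 2 * b := by
  have h1 : ENNReal.ofReal (∑ i, ∑ j, |P.real (A i ∩ B j) - P.real (A i) * P.real (B j)|) ≤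
      2 * betaCoeff P 𝒜 ℬ := by
    unfold betaCoeff
    rw [← mul_assoc, one_div, ENNReal.mul_inv_cancel (by simp) (by simp), one_mul]
    exact le_iSup_of_le p (le_iSup_of_le q (le_iSup_of_le A (le_iSup_of_le B
      (le_iSup_of_le hA (le_iSup_of_le hB le_rfl)))))
  have h2 : (2 : ℝ≥0∞) * betaCoeff P 𝒜 ℬ ≤ ENNReal.ofReal (2 * b) := by
    rw [ENNReal.ofReal_mul (by norm_num), ENNReal.ofReal_ofNat]
    gcongr
  exact (ENNReal.ofReal_le_ofReal_iff (by positivity)).1 (h1.trans h2)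

variable {Ω : Type*} {𝒜 ℬ : MeasurableSpace Ω} [mΩ : MeasurableSpace Ω] {P : Measure Ω} [IsProbabilityMeasure P]
  {E F : Type*} [MeasurableSpace E] [MeasurableSpace F]

/-- The sets that are unions of cells of a finite measurable grid. -/
def gridSets (E F : Type*) [MeasurableSpace E] [MeasurableSpace F] : Set (Set (E × F)) :=
  {S | ∃ (p q : ℕ) (f : E → Fin p) (h : F → Fin q) (T : Set (Fin p × Fin q)),
    Measurable f ∧ Measurable h ∧ S = (fun x : E × F => (f x.1, h x.2)) ⁻¹' T}

/-- Two grids have a common refinement, labelled by the pairs of their labels. The algebra structure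
is what permits approximation of general measurable sets in measure. -/
theorem isSetAlgebra_gridSets : IsSetAlgebra (gridSets E F) where
  empty_mem := ⟨1, 1, fun _ => 0, fun _ => 0, ∅, measurable_const, measurable_const, by simp⟩
  compl_mem := by
    rintro _ ⟨p, q, f, h, T, hf, hh, rfl⟩
    exact ⟨p, q, f, h, Tᶜ, hf, hh, rfl⟩
  union_mem := by
    rintro _ _ ⟨p, q, f, h, T, hf, hh, rfl⟩ ⟨p', q', f', h', T', hf', hh', rfl⟩
    refine ⟨p * p', q * q', fun x => finProdFinEquiv (f x, f' x),
      fun y => finProdFinEquiv (h y, h' y),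
      {c | ((finProdFinEquiv.symm c.1).1, (finProdFinEquiv.symm c.2).1) ∈ T ∨
        ((finProdFinEquiv.symm c.1).2, (finProdFinEquiv.symm c.2).2) ∈ T'},
      (Measurable.of_discrete (f := finProdFinEquiv)).comp (hf.prodMk hf'),
      (Measurable.of_discrete (f := finProdFinEquiv)).comp (hh.prodMk hh'), ?_⟩
    ext x
    simp only [Set.mem_union, Set.mem_preimage, Set.mem_ofPred_eq, Equiv.symm_apply_apply]

theorem measurableSet_of_mem_gridSets {S : Set (E × F)} (hS : S ∈ gridSets E F) :
    MeasurableSet S := by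
  obtain ⟨p, q, f, h, T, hf, hh, rfl⟩ := hS
  exact ((hf.comp measurable_fst).prodMk (hh.comp measurable_snd)) (Set.toFinite T).measurableSet

theorem generateFrom_gridSets :
    (inferInstance : MeasurableSpace (E × F)) = MeasurableSpace.generateFrom (gridSets E F) := by
  classical
  refine le_antisymm ?_ (MeasurableSpace.generateFrom_le fun S hS =>
    measurableSet_of_mem_gridSets hS)
  rw [← generateFrom_prod]
  refine MeasurableSpace.generateFrom_mono ?_
  rintro _ ⟨A, hA, B, hB, rfl⟩
  refine ⟨2, 2, fun x => if x ∈ A then 1 else 0, fun y => if y ∈ B then 1 else 0, {(1, 1)},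
    Measurable.ite hA measurable_const measurable_const,
    Measurable.ite hB measurable_const measurable_const, ?_⟩
  ext x
  by_cases h1 : x.1 ∈ A <;> by_cases h2 : x.2 ∈ B <;> simp [h1, h2]

/-- The joint law and the product of the marginal laws differ by at most `2 β` on each set. -/
theorem abs_map_prod_sub_le (h𝒜 : 𝒜 ≤ mΩ) (hℬ : ℬ ≤ mΩ) {b : ℝ}
    (hb : 0 ≤ b) (hβ : betaCoeff P 𝒜 ℬ ≤ ENNReal.ofReal b) {U : Ω → E} {V : Ω → F}
    (hU : Measurable[𝒜] U) (hV : Measurable[ℬ] V) {S : Set (E × F)} (hS : MeasurableSet S) :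
    |(P.map fun ω => (U ω, V ω)).real S - ((P.map U).prod (P.map V)).real S| ≤ 2 * b := by
  have hU' : Measurable U := hU.mono h𝒜 le_rfl
  have hV' : Measurable V := hV.mono hℬ le_rfl
  have := Measure.isProbabilityMeasure_map (μ := P) hU'.aemeasurable
  have := Measure.isProbabilityMeasure_map (μ := P) hV'.aemeasurable
  have := Measure.isProbabilityMeasure_map (μ := P) (hU'.prodMk hV').aemeasurable
  set μ := P.map fun ω => (U ω, V ω) with hμ
  set ν := (P.map U).prod (P.map V) with hν
  -- For a union of grid cells the discrepancy is a sum over some of the cells, hence at most the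
  -- partition sum that defines the β-coefficient.
  have hgrid : ∀ G ∈ gridSets E F, |μ.real G - ν.real G| ≤ 2 * b := by
    classical
    rintro _ ⟨p, q, f, h, T, hf, hh, rfl⟩
    have hmeas : Measurable fun x : E × F => (f x.1, h x.2) :=
      (hf.comp measurable_fst).prodMk (hh.comp measurable_snd)
    have hsum : ∀ (κ : Measure (E × F)) [IsFiniteMeasure κ],
        κ.real ((fun x : E × F => (f x.1, h x.2)) ⁻¹' T) =
        ∑ c ∈ T.toFinset, κ.real ((fun x : E × F => (f x.1, h x.2)) ⁻¹' {c}) := by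
      intro κ _
      rw [← measureReal_biUnion_finset]
      · congr 1
        ext x
        simp
      · intro c _ c' _ hcc
        exact Disjoint.preimage _ (Set.disjoint_singleton.2 hcc)
      · exact fun c _ => hmeas (measurableSet_singleton c)
    rw [hsum μ, hsum ν, ← Finset.sum_sub_distrib]
    refine (Finset.abs_sum_le_sum_abs _ _).trans ?_
    refine (Finset.sum_le_univ_sum_of_nonneg fun c => abs_nonneg _).trans ?_
    refine le_trans (le_of_eq ?_) (sum_partition_le hb hβ
      (isMeasurablePartition_preimage hU hf) (isMeasurablePartition_preimage hV hh))
    rw [Fintype.sum_prod_type]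
    refine Finset.sum_congr rfl fun i _ => Finset.sum_congr rfl fun j _ => ?_
    congr 2
    · rw [hμ, map_measureReal_apply (hU'.prodMk hV') (hmeas (measurableSet_singleton _))]
      congr 1
      ext ω
      simp
    · have e : (fun x : E × F => (f x.1, h x.2)) ⁻¹' {(i, j)} =
          (f ⁻¹' {i}) ×ˢ (h ⁻¹' {j}) := by
        ext x
        simp
      rw [e, hν, measureReal_prod_prod, map_measureReal_apply hU' (hf (measurableSet_singleton i)),
        map_measureReal_apply hV' (hh (measurableSet_singleton j))]
  refine le_of_forall_pos_le_add fun r hr => ?_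
  -- Approximation with respect to `μ + ν` yields a single grid set close to `S` for both laws.
  have hdense := Measure.MeasureDense.of_generateFrom_isSetAlgebra_finite (μ := μ + ν)
    (isSetAlgebra_gridSets (E := E) (F := F)) generateFrom_gridSets
  obtain ⟨G, hG, hSG⟩ := hdense.approx S hS (measure_ne_top _ _) r hr
  have hGm := measurableSet_of_mem_gridSets hG
  have hsd : (μ + ν).real (symmDiff S G) < r := by
    rw [measureReal_def]
    exact (ENNReal.toReal_lt_toReal hSG.ne_top ENNReal.ofReal_ne_top).2 hSG |>.trans_eq
      (ENNReal.toReal_ofReal hr.le)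
  rw [measureReal_add_apply] at hsd
  have k : ∀ (κ : Measure (E × F)) [IsFiniteMeasure κ],
      |κ.real S - κ.real G| ≤ κ.real (symmDiff S G) := fun κ _ =>
    abs_measureReal_sub_le_measureReal_symmDiff hS.nullMeasurableSet hGm.nullMeasurableSet
  have k1 := abs_le.1 (k μ)
  have k2 := abs_le.1 (k ν)
  have k3 := abs_le.1 (hgrid G hG)
  exact abs_le.2 ⟨by linarith, by linarith⟩

/-- Layer cake: `f + C` takes values in `[0, 2C]`, so each integral is the integral over levels in
`(0, 2C]` of the measures of superlevel sets, and these differ by at most `r` at each level. -/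
theorem abs_integral_sub_integral_le {κ κ' : Measure E} [IsProbabilityMeasure κ]
    [IsProbabilityMeasure κ'] {r : ℝ} (h : ∀ S, MeasurableSet S → |κ.real S - κ'.real S| ≤ r)
    {f : E → ℝ} (hf : Measurable f) {C : ℝ} (hC : ∀ x, |f x| ≤ C) :
    |∫ x, f x ∂κ - ∫ x, f x ∂κ'| ≤ 2 * C * r := by
  have hC0 : 0 ≤ C := by
    have := nonempty_of_isProbabilityMeasure κ
    exact (abs_nonneg _).trans (hC (Classical.arbitrary E))
  have hg : ∀ (θ : Measure E) [IsProbabilityMeasure θ], Integrable f θ := fun θ _ =>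
    Integrable.of_bound hf.aestronglyMeasurable C (Eventually.of_forall hC)
  have key : ∀ (θ : Measure E) [IsProbabilityMeasure θ], ∫ x, f x ∂θ + C =
      ∫ s in Set.Ioc 0 (2 * C), θ.real {a | s ≤ f a + C} := fun θ _ => by
    rw [← Integrable.integral_eq_integral_Ioc_meas_le (f := fun x => f x + C)
      ((hg θ).add (integrable_const C))
      (Eventually.of_forall fun x => by
        have := (abs_le.1 (hC x)).1
        simp only [Pi.zero_apply]
        linarith)
      (Eventually.of_forall fun x => by
        have := (abs_le.1 (hC x)).2
        simp only
        linarith)]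
    rw [integral_add (hg θ) (integrable_const C)]
    simp
  have hint : ∀ (θ : Measure E) [IsProbabilityMeasure θ],
      IntegrableOn (fun s => θ.real {a | s ≤ f a + C}) (Set.Ioc 0 (2 * C)) := fun θ _ => by
    have hanti : Antitone fun s => θ.real {a | s ≤ f a + C} := fun s s' hss =>
      measureReal_mono (fun a (ha : s' ≤ f a + C) => hss.trans ha)
    exact (hanti.antitoneOn _).integrableOn_isCompact (isCompact_Icc (a := 0) (b := 2 * C))
      |>.mono_set Set.Ioc_subset_Icc_self
  have e : ∫ x, f x ∂κ - ∫ x, f x ∂κ' =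
      ∫ s in Set.Ioc 0 (2 * C), (κ.real {a | s ≤ f a + C} - κ'.real {a | s ≤ f a + C}) := by
    rw [integral_sub (hint κ) (hint κ'), ← key κ, ← key κ']
    ring
  rw [e]
  have hb := norm_setIntegral_le_of_norm_le_const (μ := volume) (s := Set.Ioc 0 (2 * C))
    (f := fun s => κ.real {a | s ≤ f a + C} - κ'.real {a | s ≤ f a + C}) (C := r)
    (by simp only [Real.volume_Ioc]; exact ENNReal.ofReal_lt_top) (fun s _ => h _ (measurableSet_le measurable_const (hf.add_const C)))
  rw [Real.norm_eq_abs] at hb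
  refine hb.trans_eq ?_
  rw [measureReal_def, Real.volume_Ioc, sub_zero, ENNReal.toReal_ofReal (by positivity)]
  ring

/-- Decoupling: replacing the joint law of two variables by the product of the marginal laws. -/
theorem abs_integral_decouple_le (h𝒜 : 𝒜 ≤ mΩ) (hℬ : ℬ ≤ mΩ) {b : ℝ}
    (hb : 0 ≤ b) (hβ : betaCoeff P 𝒜 ℬ ≤ ENNReal.ofReal b) {U : Ω → E} {V : Ω → F}
    (hU : Measurable[𝒜] U) (hV : Measurable[ℬ] V) {f : E × F → ℝ} (hf : Measurable f)
    {C : ℝ} (hC : ∀ x, |f x| ≤ C) :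
    |∫ ω, f (U ω, V ω) ∂P - ∫ ω, ∫ ω', f (U ω, V ω') ∂P ∂P| ≤ 4 * C * b := by
  have hU' : Measurable U := hU.mono h𝒜 le_rfl
  have hV' : Measurable V := hV.mono hℬ le_rfl
  have := Measure.isProbabilityMeasure_map (μ := P) hU'.aemeasurable
  have := Measure.isProbabilityMeasure_map (μ := P) hV'.aemeasurable
  have := Measure.isProbabilityMeasure_map (μ := P) (hU'.prodMk hV').aemeasurable
  have h := abs_integral_sub_integral_le
    (fun S hS => abs_map_prod_sub_le h𝒜 hℬ hb hβ hU hV hS) hf hC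
  rw [integral_map (hU'.prodMk hV').aemeasurable hf.aestronglyMeasurable, integral_prod _
    (Integrable.of_bound hf.aestronglyMeasurable C (Eventually.of_forall hC)),
    integral_map hU'.aemeasurable hf.stronglyMeasurable.integral_prod_right'.aestronglyMeasurable]
    at h
  have e : ∀ ω, ∫ y, f (U ω, y) ∂P.map V = ∫ ω', f (U ω, V ω') ∂P := fun ω =>
    integral_map hV'.aemeasurable (hf.comp measurable_prodMk_left).aestronglyMeasurable
  simp only [e] at h
  refine h.trans_eq ?_
  ring

end Decoupling

/-! ### Lindeberg replacement under weak dependence -/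

section Hybrid

/-- The sequence equal to `p` before `j`, to `u` at `j` and to `v` after `j`. -/
def glue {E : Type*} (j : ℕ) (p v : ℕ → E) (u : E) (i : ℕ) : E :=
  if i < j then p i else if i = j then u else v i

theorem glue_eq_update {E : Type*} (j : ℕ) (p v : ℕ → E) (u u' : E) :
    glue j p v u = Function.update (glue j p v u') j u := by
  funext i
  by_cases h : i = j
  · subst h
    simp [glue]
  · rw [Function.update_of_ne h]
    simp [glue, h]

variable {Ω Ω' E : Type*} [mΩ : MeasurableSpace Ω] [MeasurableSpace Ω'] [MeasurableSpace E]

theorem measurable_glue (j : ℕ) {Θ : Type*} [MeasurableSpace Θ] {p v : Θ → ℕ → E} {u : Θ → E}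
    (hp : Measurable p) (hv : Measurable v) (hu : Measurable u) :
    Measurable fun θ => glue j (p θ) (v θ) (u θ) := by
  refine measurable_pi_lambda _ fun i => ?_
  unfold glue
  split_ifs <;> fun_prop

theorem integrable_comp_of_bounded {Θ : Type*} [MeasurableSpace Θ] (ν : Measure Θ)
    [IsFiniteMeasure ν] {f : E → ℝ} (hf : Measurable f) {M : ℝ} (hM : ∀ x, |f x| ≤ M)
    {T : Θ → E} (hT : Measurable T) : Integrable (fun θ => f (T θ)) ν :=
  Integrable.of_bound (hf.comp hT).aestronglyMeasurable M (Eventually.of_forall fun _ => hM _)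

theorem integral_indep_eq {F : Type*} [MeasurableSpace F] {P : Measure Ω} [IsProbabilityMeasure P]
    {U : Ω → E} {V : Ω → F} (hU : Measurable U) (hV : Measurable V) (h : IndepFun U V P)
    {f : E × F → ℝ} (hf : Measurable f) (hi : Integrable (fun ω => f (U ω, V ω)) P) :
    ∫ ω, f (U ω, V ω) ∂P = ∫ ω, ∫ ω', f (U ω, V ω') ∂P ∂P := by
  have := Measure.isProbabilityMeasure_map (μ := P) hU.aemeasurable
  have := Measure.isProbabilityMeasure_map (μ := P) hV.aemeasurable
  have hm := (indepFun_iff_map_prod_eq_prod_map_map hU.aemeasurable hV.aemeasurable).1 h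
  have hi' : Integrable f ((P.map U).prod (P.map V)) := by
    rw [← hm]
    exact (integrable_map_measure hf.aestronglyMeasurable (hU.prodMk hV).aemeasurable).2 hi
  rw [← integral_map (φ := fun ω => (U ω, V ω)) (hU.prodMk hV).aemeasurable
    hf.aestronglyMeasurable, hm, integral_prod _ hi',
    integral_map hU.aemeasurable hf.stronglyMeasurable.integral_prod_right'.aestronglyMeasurable]
  exact integral_congr_ae (Eventually.of_forall fun ω =>
    integral_map hV.aemeasurable (hf.comp measurable_prodMk_left).aestronglyMeasurable)

/-- Lindeberg's replacement of weakly dependent variables by independent ones. -/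
theorem abs_integral_sub_integral_le_of_replacement [Inhabited E]
    {P : Measure Ω} [IsProbabilityMeasure P] {P' : Measure Ω'} [IsProbabilityMeasure P']
    {F : (ℕ → E) → ℝ} (hF : Measurable F) {M : ℝ} (hM : ∀ x, |F x| ≤ M) {n : ℕ}
    (hloc : ∀ x y, (∀ j < n, x j = y j) → F x = F y)
    {c : ℝ} (hc : ∀ x, ∀ j < n, ∀ u u',
      |F (Function.update x j u) - F (Function.update x j u')| ≤ c)
    {U : ℕ → Ω → E} {𝒜 ℬ : ℕ → MeasurableSpace Ω} (h𝒜 : ∀ j, 𝒜 j ≤ mΩ) (hℬ : ∀ j, ℬ j ≤ mΩ)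
    (hU𝒜 : ∀ j, ∀ i < j, Measurable[𝒜 j] (U i)) (hUℬ : ∀ j, Measurable[ℬ j] (U j))
    {b : ℝ} (hb : 0 ≤ b) (hβ : ∀ j, betaCoeff P (𝒜 j) (ℬ j) ≤ ENNReal.ofReal b)
    {V : ℕ → Ω' → E} (hV : ∀ j, Measurable (V j)) (hVind : iIndepFun V P')
    {κ : ℝ} (hκ : ∀ j < n, ∀ x, |∫ ω, F (Function.update x j (U j ω)) ∂P -
      ∫ ω, F (Function.update x j (V j ω)) ∂P'| ≤ κ) :
    |∫ ω, F (fun j => U j ω) ∂P - ∫ ω, F (fun j => V j ω) ∂P'| ≤ n * (4 * c * b + κ) := by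
  have hU : ∀ j, Measurable (U j) := fun j => (hUℬ j).mono (hℬ j) le_rfl
  -- Hybrid expectation: coordinates before `j` are dependent, the others independent, on a product
  -- of the two spaces. The result telescopes over `j`.
  set H : ℕ → ℝ := fun j => ∫ ω', ∫ ω, F (fun i => if i < j then U i ω else V i ω') ∂P ∂P' with hH
  have hstep : ∀ j ∈ Finset.range n, |H (j + 1) - H j| ≤ 4 * c * b + κ := by
    intro j hj
    have hj := Finset.mem_range.1 hj
    -- Coordinates from `j` on get a constant, which `glue` never reads; this makes the whole
    -- sequence measurable for the past `𝒜 j`.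
    set past : Ω → ℕ → E := fun ω i => if i < j then U i ω else default with hpast
    have hpast_m : Measurable[𝒜 j] past := by
      refine @measurable_pi_lambda _ _ _ (𝒜 j) _ _ fun i => ?_
      by_cases h : i < j
      · simpa only [hpast, h, if_true] using hU𝒜 j i h
      · simp only [hpast, h, if_false]
        exact @measurable_const _ _ _ (𝒜 j) _
    have hpast_m' : Measurable past := hpast_m.mono (h𝒜 j) le_rfl
    set fut : Ω' → ℕ → E := fun ω' i => V i ω' with hfut
    have hfut_m : Measurable fut := measurable_pi_lambda _ fun i => hV i
    have e1 : ∀ ω ω', F (fun i => if i < j + 1 then U i ω else V i ω') =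
        F (glue j (past ω) (fut ω') (U j ω)) := fun ω ω' => by
      congr 1
      funext i
      rcases lt_trichotomy i j with h | h | h
      · simp [glue, hpast, h, Nat.lt_succ_of_lt h]
      · simp [glue, h]
      · have h1 : ¬ i < j + 1 := by omega
        have h2 : ¬ i < j := by omega
        simp [glue, h1, h2, h.ne', hfut]
    have e0 : ∀ ω ω', F (fun i => if i < j then U i ω else V i ω') =
        F (glue j (past ω) (fut ω') (V j ω')) := fun ω ω' => by
      congr 1
      funext i
      rcases lt_trichotomy i j with h | h | h
      · simp [glue, hpast, h]
      · simp [glue, h]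
      · have h2 : ¬ i < j := by omega
        simp [glue, h2, h.ne', hfut]
    -- Intermediate quantity: coordinate `j` is an independent copy of `V j`. Passing to it from `H
    -- (j + 1)` costs the decoupling and `κ`; passing from it to `H j` is free.
    set K : ℝ := ∫ ω', ∫ ω, ∫ ω₂, F (glue j (past ω) (fut ω') (V j ω₂)) ∂P' ∂P ∂P' with hK
    have hA : ∀ ω', |∫ ω, F (glue j (past ω) (fut ω') (U j ω)) ∂P -
        ∫ ω, ∫ ω₂, F (glue j (past ω) (fut ω') (V j ω₂)) ∂P' ∂P| ≤ 4 * c * b + κ := by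
      intro ω'
      -- Subtracting the value at `default` replaces the sup bound `M` by the oscillation `c` in one
      -- coordinate. The subtracted term depends on the past only, so it cancels again. Without this
      -- gain the sum over `j` would not be small.
      have d := abs_integral_decouple_le (h𝒜 j) (hℬ j) hb (hβ j) hpast_m (hUℬ j)
        (f := fun x : (ℕ → E) × E => F (glue j x.1 (fut ω') x.2) -
          F (glue j x.1 (fut ω') default))
        ((hF.comp (measurable_glue j measurable_fst measurable_const measurable_snd)).sub
          (hF.comp (measurable_glue j measurable_fst measurable_const measurable_const)))
        (C := c) (fun x => by
          rw [glue_eq_update j x.1 (fut ω') x.2 default]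
          nth_rewrite 2 [glue_eq_update j x.1 (fut ω') default default]
          exact hc _ j hj _ _)
      have i1 : Integrable (fun ω => F (glue j (past ω) (fut ω') (U j ω))) P :=
        integrable_comp_of_bounded P hF hM (measurable_glue j hpast_m' measurable_const (hU j))
      have i2 : Integrable (fun ω => F (glue j (past ω) (fut ω') default)) P :=
        integrable_comp_of_bounded P hF hM (measurable_glue j hpast_m' measurable_const measurable_const)
      have i3 : ∀ ω, Integrable (fun ω₂ => F (glue j (past ω) (fut ω') (U j ω₂))) P := fun ω =>
        integrable_comp_of_bounded P hF hM (measurable_glue j measurable_const measurable_const (hU j))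
      have i4 : Integrable (fun ω => ∫ ω₂, F (glue j (past ω) (fut ω') (U j ω₂)) ∂P) P :=
        (integrable_comp_of_bounded (P.prod P) hF hM (T := fun x : Ω × Ω =>
          glue j (past x.1) (fut ω') (U j x.2))
          (measurable_glue j (hpast_m'.comp measurable_fst) measurable_const
            ((hU j).comp measurable_snd))).integral_prod_left
      have i5 : Integrable (fun ω => ∫ ω₂, F (glue j (past ω) (fut ω') (V j ω₂)) ∂P') P :=
        (integrable_comp_of_bounded (P.prod P') hF hM (T := fun x : Ω × Ω' =>
          glue j (past x.1) (fut ω') (V j x.2))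
          (measurable_glue j (hpast_m'.comp measurable_fst) measurable_const
            ((hV j).comp measurable_snd))).integral_prod_left
      simp only at d
      rw [integral_sub i1 i2] at d
      have d' : ∀ ω, ∫ ω₂, (F (glue j (past ω) (fut ω') (U j ω₂)) -
          F (glue j (past ω) (fut ω') default)) ∂P =
          ∫ ω₂, F (glue j (past ω) (fut ω') (U j ω₂)) ∂P -
            F (glue j (past ω) (fut ω') default) := fun ω => by
        rw [integral_sub (i3 ω) (integrable_const _)]
        simp
      simp only [d'] at d
      rw [integral_sub i4 i2, sub_sub_sub_cancel_right] at d
      have k : |∫ ω, ∫ ω₂, F (glue j (past ω) (fut ω') (U j ω₂)) ∂P ∂P -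
          ∫ ω, ∫ ω₂, F (glue j (past ω) (fut ω') (V j ω₂)) ∂P' ∂P| ≤ κ := by
        rw [← integral_sub i4 i5]
        have := norm_integral_le_of_norm_le_const (μ := P) (C := κ)
          (f := fun ω => ∫ ω₂, F (glue j (past ω) (fut ω') (U j ω₂)) ∂P -
            ∫ ω₂, F (glue j (past ω) (fut ω') (V j ω₂)) ∂P') (Eventually.of_forall fun ω => by
            have := hκ j hj (glue j (past ω) (fut ω') default)
            simp only [← glue_eq_update] at this
            exact this)
        simpa using this
      exact (abs_sub_le _ _ _).trans (add_le_add d k)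
    have hjoint : Integrable (fun x : Ω' × Ω => ∫ ω₂, F (glue j (past x.2) (fut x.1) (V j ω₂)) ∂P')
        (P'.prod P) :=
      (integrable_comp_of_bounded ((P'.prod P).prod P') hF hM (T := fun x : (Ω' × Ω) × Ω' =>
          glue j (past x.1.2) (fut x.1.1) (V j x.2))
        (measurable_glue j (hpast_m'.comp measurable_fst.snd) (hfut_m.comp measurable_fst.fst)
          ((hV j).comp measurable_snd))).integral_prod_left
    have hjoint1 : Integrable (fun x : Ω' × Ω => F (glue j (past x.2) (fut x.1) (U j x.2)))
        (P'.prod P) :=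
      integrable_comp_of_bounded _ hF hM (measurable_glue j (hpast_m'.comp measurable_snd)
        (hfut_m.comp measurable_fst) ((hU j).comp measurable_snd))
    have hjoint0 : Integrable (fun x : Ω' × Ω => F (glue j (past x.2) (fut x.1) (V j x.1)))
        (P'.prod P) :=
      integrable_comp_of_bounded _ hF hM (measurable_glue j (hpast_m'.comp measurable_snd)
        (hfut_m.comp measurable_fst) ((hV j).comp measurable_fst))
    have hB : |H (j + 1) - K| ≤ 4 * c * b + κ := by
      simp only [hH, hK, e1]
      rw [← integral_sub hjoint1.integral_prod_left hjoint.integral_prod_left]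
      have := norm_integral_le_of_norm_le_const (μ := P') (C := 4 * c * b + κ)
        (f := fun ω' => ∫ ω, F (glue j (past ω) (fut ω') (U j ω)) ∂P -
          ∫ ω, ∫ ω₂, F (glue j (past ω) (fut ω') (V j ω₂)) ∂P' ∂P)
        (Eventually.of_forall hA)
      simpa using this
    have hC : K = H j := by
      simp only [hH, hK, e0]
      rw [integral_integral_swap (f := fun ω' ω =>
          ∫ ω₂, F (glue j (past ω) (fut ω') (V j ω₂)) ∂P') hjoint,
        integral_integral_swap (f := fun ω' ω => F (glue j (past ω) (fut ω') (V j ω'))) hjoint0]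
      refine integral_congr_ae (Eventually.of_forall fun ω => ?_)
      -- `F` reads only the first `n` coordinates, so independence of `V j` from the finitely many
      -- others is enough to integrate it out separately.
      set S := (Finset.range n).erase j with hS
      let ext : (S → E) → ℕ → E := fun y i => if h : i ∈ S then y ⟨i, h⟩ else default
      have hext : Measurable ext := by
        refine measurable_pi_lambda _ fun i => ?_
        by_cases h : i ∈ S
        · simp only [ext, h, dif_pos]
          exact measurable_pi_apply _
        · simp only [ext, h, dif_neg, not_false_eq_true]
          exact measurable_const
      have hi := (hVind.indepFun_finset S {j} (by simp [hS]) hV).comp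
        (φ := fun y => ext y) (ψ := fun y : (({j} : Finset ℕ) → E) => y ⟨j, by simp⟩)
        hext
        (@measurable_pi_apply (({j} : Finset ℕ) : Type) (fun _ => E) (fun _ => inferInstance) ⟨j, by simp⟩)
      have hS_m : Measurable fun (ω' : Ω') (i : S) => V i ω' :=
        measurable_pi_lambda _ fun i => hV i
      have e : ∀ ω₁ u, F (glue j (past ω) (fut ω₁) u) =
          F (glue j (past ω) (ext fun i : S => V i ω₁) u) := fun ω₁ u => by
        refine hloc _ _ fun i hi => ?_
        unfold glue
        by_cases h1 : i < j
        · simp [h1]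
        · by_cases h2 : i = j
          · simp [h2]
          · simp [h1, h2, ext, hS, hi, hfut]
      simp only [e]
      exact (integral_indep_eq (hext.comp hS_m) (hV j) hi
        (f := fun x : (ℕ → E) × E => F (glue j (past ω) x.1 x.2))
        (hF.comp (measurable_glue j measurable_const measurable_fst measurable_snd))
        (integrable_comp_of_bounded P' hF hM (measurable_glue j measurable_const (hext.comp hS_m) (hV j)))).symm
    rw [← hC]
    exact hB
  have hn : H n = ∫ ω, F (fun j => U j ω) ∂P := by
    have : ∀ ω ω', F (fun i => if i < n then U i ω else V i ω') = F (fun j => U j ω) :=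
      fun ω ω' => hloc _ _ fun j hj => by simp [hj]
    simp only [hH, this]
    simp
  have h0 : H 0 = ∫ ω, F (fun j => V j ω) ∂P' := by simp [hH]
  rw [← hn, ← h0, ← Finset.sum_range_sub]
  refine (Finset.abs_sum_le_sum_abs _ _).trans ((Finset.sum_le_sum hstep).trans_eq ?_)
  rw [Finset.sum_const, Finset.card_range, nsmul_eq_mul]

end Hybrid

/-! ### Approximation by bounded functions of finitely many coordinates -/

section Approximation

/-- Truncation at level `T`. -/
def clamp (T x : ℝ) : ℝ := max (-T) (min x T)

theorem abs_clamp_le {T : ℝ} (hT : 0 ≤ T) (x : ℝ) : |clamp T x| ≤ T := by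
  unfold clamp
  exact abs_le.2 ⟨le_max_left _ _, max_le (by linarith) (min_le_right _ _)⟩

theorem clamp_of_abs_le {T x : ℝ} (h : |x| ≤ T) : clamp T x = x := by
  obtain ⟨h1, h2⟩ := abs_le.1 h
  rw [clamp, min_eq_left h2, max_eq_right h1]

theorem abs_sub_clamp_le {T : ℝ} (x y : ℝ) : |clamp T x - clamp T y| ≤ |x - y| := by
  unfold clamp
  refine (abs_max_sub_max_le_max _ _ _ _).trans ?_
  refine max_le (by simp) ((abs_min_sub_min_le_max _ _ _ _).trans (by simp))

theorem abs_sub_clamp_self_le {T : ℝ} (hT : 0 ≤ T) (x : ℝ) : |x - clamp T x| ≤ |x| := by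
  unfold clamp
  rcases le_total x T with h1 | h1
  · rw [min_eq_left h1]
    rcases le_total (-T) x with h2 | h2
    · rw [max_eq_right h2]
      simp
    · rw [max_eq_left h2, abs_of_nonpos (by linarith), abs_of_nonpos (by linarith)]
      linarith
  · rw [min_eq_right h1, max_eq_right (by linarith), abs_of_nonneg (by linarith),
      abs_of_nonneg (by linarith)]
    linarith

theorem measurable_clamp (T : ℝ) : Measurable (clamp T) := by
  unfold clamp
  fun_prop

/-- The filtration of the windows `[-m, m]` on the space of sequences. -/
def windowFiltration : Filtration ℕ (inferInstance : MeasurableSpace (ℤ → ℝ)) where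
  seq m := sigmaOf (fun (i : ℤ) (x : ℤ → ℝ) => x i) (Set.Icc (-(m : ℤ)) m)
  mono' m m' h := by
    refine iSup₂_le fun i hi => le_iSup₂_of_le i ?_ le_rfl
    have : (m : ℤ) ≤ m' := by exact_mod_cast h
    exact ⟨by linarith [hi.1], hi.2.trans this⟩
  le' m := iSup₂_le fun i _ => (measurable_pi_apply i).comap_le

theorem iSup_windowFiltration :
    ⨆ m, windowFiltration m = (inferInstance : MeasurableSpace (ℤ → ℝ)) := by
  refine le_antisymm (iSup_le fun m => windowFiltration.le m) ?_
  refine iSup_le fun i => le_iSup_of_le i.natAbs (le_iSup₂_of_le i ?_ le_rfl)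
  exact ⟨by omega, by omega⟩

/-- Centered square integrable functions of a sequence are approximated by bounded centered
functions of finitely many coordinates. -/
theorem exists_window_approximation {κ : Measure (ℤ → ℝ)} [IsProbabilityMeasure κ]
    {g : (ℤ → ℝ) → ℝ} (hg : Measurable g) (hg2 : MemLp g 2 κ) (hg0 : ∫ x, g x ∂κ = 0)
    {δ : ℝ} (hδ : 0 < δ) :
    ∃ (m : ℕ) (T : ℝ) (h : (ℤ → ℝ) → ℝ), Measurable[windowFiltration m] h ∧ (∀ x, |h x| ≤ T) ∧
      ∫ x, h x ∂κ = 0 ∧ ∫ x, (g x - h x) ^ 2 ∂κ ≤ δ := by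
  -- Two errors of `δ / 4`, each doubled by `(a + b)² ≤ 2a² + 2b²`, add up to `δ`.
  obtain ⟨T, hT0, hT⟩ : ∃ T : ℝ, 0 ≤ T ∧ ∫ x, (g x - clamp T (g x)) ^ 2 ∂κ < δ / 4 := by
    have hlim : Tendsto (fun k : ℕ => ∫ x, (g x - clamp k (g x)) ^ 2 ∂κ) atTop
        (𝓝 (∫ _, (0 : ℝ) ∂κ)) := by
      refine tendsto_integral_of_dominated_convergence (fun x => g x ^ 2) (fun k => ?_)
        hg2.integrable_sq (fun k => Eventually.of_forall fun x => ?_)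
        (Eventually.of_forall fun x => ?_)
      · exact ((hg.sub ((measurable_clamp _).comp hg)).pow_const 2).aestronglyMeasurable
      · rw [Real.norm_of_nonneg (sq_nonneg _)]
        exact sq_le_sq.2 (abs_sub_clamp_self_le (Nat.cast_nonneg k) _)
      · obtain ⟨k0, hk0⟩ := exists_nat_ge |g x|
        refine tendsto_const_nhds.congr' ?_
        filter_upwards [eventually_ge_atTop k0] with k hk
        rw [clamp_of_abs_le (hk0.trans (Nat.cast_le.2 hk))]
        simp
    rw [integral_zero] at hlim
    obtain ⟨k, hk⟩ := (hlim.eventually (gt_mem_nhds (by positivity : (0 : ℝ) < δ / 4))).exists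
    exact ⟨k, Nat.cast_nonneg k, hk⟩
  set g1 : (ℤ → ℝ) → ℝ := fun x => clamp T (g x) with hg1
  have hg1m : Measurable g1 := (measurable_clamp T).comp hg
  have hg1b : ∀ x, |g1 x| ≤ T := fun x => abs_clamp_le hT0 _
  have hg1i : Integrable g1 κ := Integrable.of_bound hg1m.aestronglyMeasurable T
    (Eventually.of_forall hg1b)
  -- Lévy's upward theorem in `L¹`; the factor `2 * T` bounds the difference and thereby turns the
  -- `L¹` error into a mean square error.
  obtain ⟨m, hm⟩ : ∃ m : ℕ, 2 * T * ∫ x, |(κ[g1|windowFiltration m]) x - g1 x| ∂κ < δ / 4 := by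
    have h1 := tendsto_eLpNorm_condExp (μ := κ) (ℱ := windowFiltration) g1
    have h2 : κ[g1|⨆ m, windowFiltration m] = g1 := by
      rw [iSup_windowFiltration]
      exact condExp_of_stronglyMeasurable le_rfl hg1m.stronglyMeasurable hg1i
    rw [h2] at h1
    have h3 := (ENNReal.tendsto_toReal ENNReal.zero_ne_top).comp h1
    have h4 := h3.const_mul (2 * T)
    simp only [ENNReal.toReal_zero, mul_zero] at h4
    obtain ⟨m, hm⟩ := (h4.eventually (gt_mem_nhds (by positivity : (0 : ℝ) < δ / 4))).exists
    refine ⟨m, lt_of_eq_of_lt ?_ hm⟩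
    congr 1
    rw [Function.comp, eLpNorm_one_eq_lintegral_enorm, ← integral_norm_eq_lintegral_enorm
      ((integrable_condExp.sub hg1i).aestronglyMeasurable)]
    rfl
  -- Clamping gives a bound at every point rather than almost everywhere, and does not increase the
  -- distance to `g1`, itself bounded by `T`.
  set h0 : (ℤ → ℝ) → ℝ := fun x => clamp T ((κ[g1|windowFiltration m]) x) with hh0
  have hh0m : Measurable[windowFiltration m] h0 :=
    (measurable_clamp T).comp stronglyMeasurable_condExp.measurable
  have hh0m' : Measurable h0 := hh0m.mono (windowFiltration.le m) le_rfl
  have hh0b : ∀ x, |h0 x| ≤ T := fun x => abs_clamp_le hT0 _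
  have hb2 : ∀ {f : (ℤ → ℝ) → ℝ}, Measurable f → (∀ x, |f x| ≤ T) → MemLp f 2 κ := fun hf hb =>
    MemLp.of_bound hf.aestronglyMeasurable T (Eventually.of_forall hb)
  have hD1 : Integrable (fun x => (g x - g1 x) ^ 2) κ := (hg2.sub (hb2 hg1m hg1b)).integrable_sq
  have hD2 : Integrable (fun x => (g1 x - h0 x) ^ 2) κ :=
    ((hb2 hg1m hg1b).sub (hb2 hh0m' hh0b)).integrable_sq
  have hD : Integrable (fun x => (g x - h0 x) ^ 2) κ :=
    (hg2.sub (hb2 hh0m' hh0b)).integrable_sq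
  have b2 : ∫ x, (g1 x - h0 x) ^ 2 ∂κ ≤ δ / 4 := by
    refine le_trans ?_ hm.le
    rw [← integral_const_mul]
    refine integral_mono hD2 ((integrable_condExp.sub hg1i).abs.const_mul _)
      fun x => ?_
    have k1 : |g1 x - h0 x| ≤ |(κ[g1|windowFiltration m]) x - g1 x| := by
      rw [abs_sub_comm]
      calc |h0 x - g1 x| = |h0 x - clamp T (g1 x)| := by rw [clamp_of_abs_le (hg1b x)]
        _ ≤ _ := abs_sub_clamp_le _ _
    have k2 : |g1 x - h0 x| ≤ 2 * T := (abs_sub _ _).trans (by linarith [hg1b x, hh0b x])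
    simp only
    rw [← sq_abs, sq]
    exact mul_le_mul k2 k1 (abs_nonneg _) (by positivity)
  have b3 : ∫ x, (g x - h0 x) ^ 2 ∂κ ≤ δ := by
    have : ∫ x, (g x - h0 x) ^ 2 ∂κ ≤
        ∫ x, (2 * (g x - g1 x) ^ 2 + 2 * (g1 x - h0 x) ^ 2) ∂κ := by
      refine integral_mono hD
        ((hD1.const_mul 2).add (hD2.const_mul 2)) fun x => ?_
      simp only
      nlinarith [sq_nonneg ((g x - g1 x) - (g1 x - h0 x))]
    rw [integral_add (hD1.const_mul 2) (hD2.const_mul 2),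
      integral_const_mul, integral_const_mul] at this
    linarith
  have ig : Integrable g κ := hg2.integrable one_le_two
  have ih : Integrable h0 κ := (hb2 hh0m' hh0b).integrable one_le_two
  refine ⟨m, 2 * T, fun x => h0 x - ∫ y, h0 y ∂κ, hh0m.sub_const _, fun x => ?_, ?_, ?_⟩
  · have : |∫ y, h0 y ∂κ| ≤ T := by
      have := norm_integral_le_of_norm_le_const (μ := κ) (f := h0) (C := T)
        (Eventually.of_forall hh0b)
      simpa using this
    exact (abs_sub _ _).trans (by linarith [hh0b x])
  · rw [integral_sub ih (integrable_const _)]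
    simp
  -- As `g` is centered, recentering lowers the mean square error by exactly `e ^ 2`.
  · set e := ∫ y, h0 y ∂κ with he
    have hDi : Integrable (fun x => g x - h0 x) κ := ig.sub ih
    have hDe : ∫ x, (g x - h0 x) ∂κ = -e := by rw [integral_sub ig ih, hg0, zero_sub]
    have : ∀ x, (g x - (h0 x - e)) ^ 2 = (g x - h0 x) ^ 2 + (2 * e * (g x - h0 x) + e ^ 2) :=
      fun x => by ring
    simp only [this]
    have hL : Integrable (fun x => 2 * e * (g x - h0 x) + e ^ 2) κ :=
      (hDi.const_mul (2 * e)).add (integrable_const (e ^ 2))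
    rw [integral_add hD hL, integral_add (hDi.const_mul (2 * e)) (integrable_const (e ^ 2)),
      integral_const_mul, hDe]
    simp only [integral_const, probReal_univ, one_smul]
    nlinarith [sq_nonneg e]

end Approximation

/-! ### Concentration of quadratic forms over nearly independent blocks -/

section Concentration

theorem card_filter_near_le {N : ℕ} (i : Fin N) (h : ℕ) :
    (Finset.univ.filter fun j : Fin N => ((i : ℤ) - (j : ℤ)).natAbs < h).card ≤ 2 * h := by
  have : (Finset.univ.filter fun j : Fin N => ((i : ℤ) - (j : ℤ)).natAbs < h).card ≤
      (Finset.Ico ((i : ℤ) - h) ((i : ℤ) + h)).card := by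
    refine Finset.card_le_card_of_injOn (fun j => ((j : ℕ) : ℤ)) (fun j hj => ?_)
      fun a _ b _ hab => ?_
    · have hj' := (Finset.mem_filter.1 hj).2
      simp only [Finset.coe_Ico, Set.mem_Ico]
      omega
    · simp only at hab
      exact Fin.ext (by exact_mod_cast hab)
  refine this.trans_eq ?_
  rw [Int.card_Ico]
  omega

/-- Schur's bound for a matrix with bounded entries that are small away from the diagonal. -/
theorem sum_mul_mul_le_of_decay {N : ℕ} {r : Fin N → Fin N → ℝ} {M η : ℝ} (hM : 0 ≤ M)
    (hη : 0 ≤ η) {h : ℕ} (h1 : ∀ i j, |r i j| ≤ M)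
    (h2 : ∀ i j : Fin N, h ≤ ((i : ℤ) - (j : ℤ)).natAbs → |r i j| ≤ η) (v : Fin N → ℝ) :
    ∑ i, ∑ j, v i * v j * r i j ≤ (2 * h * M + η * N) * (v ⬝ᵥ v) := by
  have hcard : ∀ i : Fin N,
      ∑ j : Fin N, (if ((i : ℤ) - (j : ℤ)).natAbs < h then M else 0) ≤ 2 * h * M := fun i => by
    rw [← Finset.sum_filter, Finset.sum_const, nsmul_eq_mul]
    have := card_filter_near_le i h
    have h3 : (((Finset.univ.filter fun j : Fin N => ((i : ℤ) - (j : ℤ)).natAbs < h).card : ℕ) : ℝ)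
        ≤ 2 * h := by exact_mod_cast this
    exact mul_le_mul_of_nonneg_right h3 hM
  -- A symmetric majorant of `r`: a band of height `M` and width `h` plus a constant. Its row sums
  -- bound the form.
  set w : Fin N → Fin N → ℝ := fun i j =>
    (if ((i : ℤ) - (j : ℤ)).natAbs < h then M else 0) + η with hw
  have hwsymm : ∀ i j, w i j = w j i := fun i j => by
    simp only [hw]
    rw [← Int.natAbs_neg, neg_sub]
  have hrow : ∀ i, ∑ j, w i j ≤ 2 * h * M + η * N := fun i => by
    simp only [hw, Finset.sum_add_distrib, Finset.sum_const, Finset.card_univ, Fintype.card_fin,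
      nsmul_eq_mul]
    linarith [hcard i]
  have hrw : ∀ i j, |r i j| ≤ w i j := fun i j => by
    simp only [hw]
    split_ifs with hij
    · exact (h1 i j).trans (by linarith)
    · rw [zero_add]
      exact h2 i j (not_lt.1 hij)
  have hterm : ∀ i j, v i * v j * r i j ≤ v i ^ 2 / 2 * w i j + v j ^ 2 / 2 * w j i := by
    intro i j
    rw [hwsymm j i, ← add_mul]
    refine (le_abs_self _).trans ?_
    rw [abs_mul]
    refine mul_le_mul ?_ (hrw i j) (abs_nonneg _) (by positivity)
    rw [abs_mul, ← sq_abs (v i), ← sq_abs (v j)]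
    nlinarith [sq_nonneg (|v i| - |v j|)]
  calc ∑ i, ∑ j, v i * v j * r i j
      ≤ ∑ i, ∑ j, (v i ^ 2 / 2 * w i j + v j ^ 2 / 2 * w j i) :=
        Finset.sum_le_sum fun i _ => Finset.sum_le_sum fun j _ => hterm i j
    _ = ∑ i, v i ^ 2 / 2 * ∑ j, w i j + ∑ j, v j ^ 2 / 2 * ∑ i, w j i := by
        simp only [Finset.sum_add_distrib, Finset.mul_sum]
        congr 1
        exact Finset.sum_comm
    _ = ∑ i, v i ^ 2 * ∑ j, w i j := by
        rw [← Finset.sum_add_distrib]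
        exact Finset.sum_congr rfl fun i _ => by ring
    _ ≤ ∑ i, v i ^ 2 * (2 * h * M + η * N) :=
        Finset.sum_le_sum fun i _ => mul_le_mul_of_nonneg_left (hrow i) (sq_nonneg _)
    _ = (2 * h * M + η * N) * (v ⬝ᵥ v) := by
        rw [← Finset.sum_mul, mul_comm, dotProduct]
        congr 1
        exact Finset.sum_congr rfl fun i _ => sq (v i)

/-- The second moment of a linear form of a vector whose covariances are small away from the
diagonal. -/
theorem integral_dotProduct_sq_le {Ω : Type*} [MeasurableSpace Ω] {P : Measure Ω} {N : ℕ}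
    {b : Ω → Fin N → ℝ} (hb : ∀ i, MemLp (fun ω => b ω i) 2 P) {M η : ℝ} (hM : 0 ≤ M)
    (hη : 0 ≤ η) {h : ℕ} (h1 : ∀ i j, |∫ ω, b ω i * b ω j ∂P| ≤ M)
    (h2 : ∀ i j : Fin N, h ≤ ((i : ℤ) - (j : ℤ)).natAbs → |∫ ω, b ω i * b ω j ∂P| ≤ η)
    (v : Fin N → ℝ) : ∫ ω, (v ⬝ᵥ b ω) ^ 2 ∂P ≤ (2 * h * M + η * N) * (v ⬝ᵥ v) := by
  refine le_trans (le_of_eq ?_) (sum_mul_mul_le_of_decay hM hη h1 h2 v)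
  have hint : ∀ i j, Integrable (fun ω => v i * v j * (b ω i * b ω j)) P := fun i j =>
    ((hb i).integrable_mul (hb j)).const_mul _
  have e : ∀ ω, (v ⬝ᵥ b ω) ^ 2 = ∑ i, ∑ j, v i * v j * (b ω i * b ω j) := fun ω => by
    rw [sq, dotProduct, Finset.sum_mul_sum]
    exact Finset.sum_congr rfl fun i _ => Finset.sum_congr rfl fun j _ => by ring
  simp only [e]
  rw [integral_finsetSum _ fun i _ => integrable_finsetSum _ fun j _ => hint i j]
  refine Finset.sum_congr rfl fun i _ => ?_
  rw [integral_finsetSum _ fun j _ => hint i j]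
  exact Finset.sum_congr rfl fun j _ => integral_const_mul _ _

variable {Ω : Type*} {𝒜 ℬ : MeasurableSpace Ω} [mΩ : MeasurableSpace Ω] {P : Measure Ω}
  [IsProbabilityMeasure P]

/-- A form of `abs_integral_decouple_le` for functions that are bounded along the variables. -/
theorem abs_integral_decouple_le' {E F : Type*} [MeasurableSpace E] [MeasurableSpace F]
    (h𝒜 : 𝒜 ≤ mΩ) (hℬ : ℬ ≤ mΩ) {β : ℝ}
    (hb : 0 ≤ β) (hβ : betaCoeff P 𝒜 ℬ ≤ ENNReal.ofReal β) {U : Ω → E} {V : Ω → F}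
    (hU : Measurable[𝒜] U) (hV : Measurable[ℬ] V) {f : E × F → ℝ} (hf : Measurable f)
    {C : ℝ} (hC0 : 0 ≤ C) (hC : ∀ ω ω', |f (U ω, V ω')| ≤ C) :
    |∫ ω, f (U ω, V ω) ∂P - ∫ ω, ∫ ω', f (U ω, V ω') ∂P ∂P| ≤ 4 * C * β := by
  have h := abs_integral_decouple_le h𝒜 hℬ hb hβ hU hV ((measurable_clamp C).comp hf)
    (fun x => abs_clamp_le hC0 _)
  simpa only [Function.comp, clamp_of_abs_le (hC _ _)] using h

theorem measurable_quadForm {N : ℕ} (A : Matrix (Fin N) (Fin N) ℝ) : Measurable (quadForm A) := by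
  unfold quadForm
  simp only [dotProduct, mulVec]
  fun_prop

theorem measurable_dotProduct_mulVec {N : ℕ} (A : Matrix (Fin N) (Fin N) ℝ) :
    Measurable fun x : (Fin N → ℝ) × (Fin N → ℝ) => x.2 ⬝ᵥ (A *ᵥ x.1) := by
  simp only [dotProduct, mulVec]
  fun_prop

/-- Adding to a vector another one that is nearly independent of it increases the variance of a
quadratic form in a controlled way. -/
theorem integral_quadForm_add_sq_le {N : ℕ} (h𝒜 : 𝒜 ≤ mΩ) (hℬ : ℬ ≤ mΩ) {β : ℝ}
    (hβ0 : 0 ≤ β) (hβ : betaCoeff P 𝒜 ℬ ≤ ENNReal.ofReal β) {s b : Ω → Fin N → ℝ}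
    (hs : Measurable[𝒜] s) (hb : Measurable[ℬ] b) {L l ρ c : ℝ} (hlL : l ≤ L)
    (hsL : ∀ ω, s ω ⬝ᵥ s ω ≤ L) (hbl : ∀ ω, b ω ⬝ᵥ b ω ≤ l) (hb0 : ∀ i, ∫ ω, b ω i ∂P = 0)
    (hρ0 : 0 ≤ ρ) (hρ : ∀ v, ∫ ω, (v ⬝ᵥ b ω) ^ 2 ∂P ≤ ρ * (v ⬝ᵥ v)) (hc : |c| ≤ L)
    {A : Matrix (Fin N) (Fin N) ℝ} (hA : IsSymmContraction A) :
    ∫ ω, (quadForm A (s ω + b ω) - (c + ∫ ω', quadForm A (b ω') ∂P)) ^ 2 ∂P ≤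
      ∫ ω, (quadForm A (s ω) - c) ^ 2 ∂P + (8 * ρ * L + 8 * l ^ 2 + 128 * L ^ 2 * β) := by
  have hs' : Measurable s := hs.mono h𝒜 le_rfl
  have hb' : Measurable b := hb.mono hℬ le_rfl
  have hΩ := nonempty_of_isProbabilityMeasure P
  have hl0 : 0 ≤ l := (dotProduct_self_nonneg' _).trans (hbl (Classical.arbitrary Ω))
  have hL0 : 0 ≤ L := hl0.trans hlL
  have hqb : ∀ ω, |quadForm A (b ω)| ≤ l := fun ω => (hA.abs_quadForm_le _).trans (hbl ω)
  have hqs : ∀ ω, |quadForm A (s ω)| ≤ L := fun ω => (hA.abs_quadForm_le _).trans (hsL ω)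
  set e := ∫ ω', quadForm A (b ω') ∂P with he
  have he_abs : |e| ≤ l := by
    have := norm_integral_le_of_norm_le_const (μ := P) (f := fun ω => quadForm A (b ω)) (C := l)
      (Eventually.of_forall hqb)
    simpa using this
  -- `D` is the increment of the centered quadratic form when the block is added, and `G` below is
  -- the increment of its square.
  set D : (Fin N → ℝ) × (Fin N → ℝ) → ℝ := fun x =>
    2 * (x.2 ⬝ᵥ (A *ᵥ x.1)) + (quadForm A x.2 - e) with hD
  set Q : (Fin N → ℝ) → ℝ := fun x => quadForm A x - c with hQ
  set G : (Fin N → ℝ) × (Fin N → ℝ) → ℝ := fun x => 2 * Q x.1 * D x + D x ^ 2 with hG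
  have hDm : Measurable D := ((measurable_dotProduct_mulVec A).const_mul 2).add
    (((measurable_quadForm A).comp measurable_snd).sub_const e)
  have hQm : Measurable Q := (measurable_quadForm A).sub_const c
  have hGm : Measurable G :=
    (((hQm.comp measurable_fst).const_mul 2).mul hDm).add (hDm.pow_const 2)
  have hcross : ∀ ω ω', |2 * (b ω' ⬝ᵥ (A *ᵥ s ω))| ≤ 2 * L := fun ω ω' => by
    have h1 := dotProduct_le_half 1 one_pos (b ω') (A *ᵥ s ω)
    have h2 := hA.contract (s ω)
    linarith [hsL ω, hbl ω']
  have hDb : ∀ ω ω', |D (s ω, b ω')| ≤ 4 * L := fun ω ω' => by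
    refine (abs_add_le _ _).trans ?_
    have h1 := (abs_sub (quadForm A (b ω')) e)
    linarith [hcross ω ω', hqb ω']
  have hQb : ∀ ω, |Q (s ω)| ≤ 2 * L := fun ω => (abs_sub _ _).trans (by linarith [hqs ω])
  -- `2 · 2L · 4L + (4L)² = 32 L²`; the factor 4 of the decoupling then gives `128 L² β`.
  have hGb : ∀ ω ω', |G (s ω, b ω')| ≤ 32 * L ^ 2 := fun ω ω' => by
    refine (abs_add_le _ _).trans ?_
    rw [abs_mul, abs_mul, abs_two, abs_pow]
    have h1 := hDb ω ω'
    have h2 := hQb ω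
    have h3 : |Q (s ω)| * |D (s ω, b ω')| ≤ (2 * L) * (4 * L) :=
      mul_le_mul h2 h1 (abs_nonneg _) (by positivity)
    have h4 : |D (s ω, b ω')| ^ 2 ≤ (4 * L) ^ 2 := pow_le_pow_left₀ (abs_nonneg _) h1 2
    nlinarith
  have hdec := abs_integral_decouple_le' h𝒜 hℬ hβ0 hβ hs hb hGm (by positivity) hGb
  have hbd : ∀ {f : Ω → ℝ} {C : ℝ}, Measurable f → (∀ ω, |f ω| ≤ C) → Integrable f P :=
    fun hf hC => Integrable.of_bound hf.aestronglyMeasurable _ (Eventually.of_forall hC)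
  have hbi : ∀ i, Integrable (fun ω => b ω i) P := fun i => by
    refine hbd (C := l + 1) ((measurable_pi_apply i).comp hb') fun ω => ?_
    have h1 : b ω i * b ω i ≤ b ω ⬝ᵥ b ω := Finset.single_le_sum
      (f := fun i => b ω i * b ω i) (fun i _ => mul_self_nonneg _) (Finset.mem_univ i)
    have h2 := hbl ω
    rw [abs_le]
    constructor <;> nlinarith [sq_nonneg (b ω i - 1), sq_nonneg (b ω i + 1)]
  -- With the past frozen, `D` has mean zero in the block, so the cross term of `G` vanishes and
  -- only `D²` remains. The linear part is controlled by `ρ`, the quadratic part by `l`.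
  have hinner : ∀ ω, ∫ ω', G (s ω, b ω') ∂P ≤ 8 * ρ * L + 8 * l ^ 2 := by
    intro ω
    have hlin : ∫ ω', b ω' ⬝ᵥ (A *ᵥ s ω) ∂P = 0 := by
      simp only [dotProduct]
      rw [integral_finsetSum _ fun i _ => (hbi i).mul_const _]
      exact Finset.sum_eq_zero fun i _ => by rw [integral_mul_const, hb0, zero_mul]
    have hlm : Measurable fun ω' => b ω' ⬝ᵥ (A *ᵥ s ω) :=
      (measurable_dotProduct_mulVec A).comp (measurable_const.prodMk hb')
    have hDm' : Measurable fun ω' => D (s ω, b ω') := hDm.comp (measurable_const.prodMk hb')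
    have i1 : Integrable (fun ω' => 2 * (b ω' ⬝ᵥ (A *ᵥ s ω))) P :=
      hbd (hlm.const_mul 2) (hcross ω)
    have i2 : Integrable (fun ω' => quadForm A (b ω')) P :=
      hbd ((measurable_quadForm A).comp hb') hqb
    have hD0 : ∫ ω', D (s ω, b ω') ∂P = 0 := by
      have i3 : Integrable (fun ω' => quadForm A (b ω') - e) P := i2.sub (integrable_const e)
      simp only [hD]
      rw [integral_add i1 i3, integral_const_mul, hlin, integral_sub i2 (integrable_const e)]
      simp [he]
    have i4 : Integrable (fun ω' => D (s ω, b ω')) P := hbd hDm' (hDb ω)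
    have i5 : Integrable (fun ω' => D (s ω, b ω') ^ 2) P :=
      hbd (hDm'.pow_const 2) (C := (4 * L) ^ 2) fun ω' => by
        rw [abs_pow]
        exact pow_le_pow_left₀ (abs_nonneg _) (hDb ω ω') 2
    have i6 : Integrable (fun ω' => ((A *ᵥ s ω) ⬝ᵥ b ω') ^ 2) P := by
      have : Integrable (fun ω' => (2 * (b ω' ⬝ᵥ (A *ᵥ s ω))) ^ 2) P :=
        hbd ((hlm.const_mul 2).pow_const 2) (C := (2 * L) ^ 2) fun ω' => by
          rw [abs_pow]
          exact pow_le_pow_left₀ (abs_nonneg _) (hcross ω ω') 2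
      refine (this.const_mul (1 / 4)).congr (Eventually.of_forall fun ω' => ?_)
      simp only
      rw [dotProduct_comm]
      ring
    simp only [hG]
    rw [integral_add (i4.const_mul _) i5, integral_const_mul, hD0, mul_zero, zero_add]
    have hle : ∫ ω', D (s ω, b ω') ^ 2 ∂P ≤
        ∫ ω', (8 * ((A *ᵥ s ω) ⬝ᵥ b ω') ^ 2 + 8 * l ^ 2) ∂P := by
      refine integral_mono i5 ((i6.const_mul 8).add (integrable_const _)) fun ω' => ?_
      simp only [hD]
      rw [dotProduct_comm]
      have h1 : |quadForm A (b ω') - e| ≤ 2 * l := (abs_sub _ _).trans (by linarith [hqb ω'])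
      have h2 : (quadForm A (b ω') - e) ^ 2 ≤ (2 * l) ^ 2 := by
        rw [← sq_abs]
        exact pow_le_pow_left₀ (abs_nonneg _) h1 2
      nlinarith [sq_nonneg (2 * ((A *ᵥ s ω) ⬝ᵥ b ω') - (quadForm A (b ω') - e))]
    rw [integral_add (i6.const_mul 8) (integrable_const _), integral_const_mul] at hle
    simp only [integral_const, probReal_univ, one_smul] at hle
    have h3 := hρ (A *ᵥ s ω)
    have h4 := mul_le_mul_of_nonneg_left ((hA.contract (s ω)).trans (hsL ω)) hρ0
    linarith
  have hGint : Integrable (fun ω => ∫ ω', G (s ω, b ω') ∂P) P :=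
    (Integrable.of_bound (μ := P.prod P) (f := fun x : Ω × Ω => G (s x.1, b x.2))
      (hGm.comp ((hs'.comp measurable_fst).prodMk (hb'.comp measurable_snd))).aestronglyMeasurable
      (32 * L ^ 2) (Eventually.of_forall fun x => hGb _ _)).integral_prod_left
  have houter : ∫ ω, ∫ ω', G (s ω, b ω') ∂P ∂P ≤ 8 * ρ * L + 8 * l ^ 2 := by
    have := integral_mono hGint (integrable_const (8 * ρ * L + 8 * l ^ 2)) hinner
    simpa using this
  have hsplit : ∀ ω, (quadForm A (s ω + b ω) - (c + e)) ^ 2 =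
      (quadForm A (s ω) - c) ^ 2 + G (s ω, b ω) := fun ω => by
    simp only [hG, hD, hQ]
    rw [hA.quadForm_add]
    ring
  have j1 : Integrable (fun ω => (quadForm A (s ω) - c) ^ 2) P :=
    hbd ((hQm.comp hs').pow_const 2) (C := (2 * L) ^ 2) fun ω => by
      rw [abs_pow]
      exact pow_le_pow_left₀ (abs_nonneg _) (hQb ω) 2
  have j2 : Integrable (fun ω => G (s ω, b ω)) P :=
    hbd (hGm.comp (hs'.prodMk hb')) fun ω => hGb ω ω
  simp only [hsplit]
  rw [integral_add j1 j2]
  have := (abs_le.1 hdec).2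
  linarith

/-- Concentration of a quadratic form of a sum of nearly independent blocks. -/
theorem exists_integral_quadForm_sq_le {N : ℕ} {K : ℕ} {s b : ℕ → Ω → Fin N → ℝ}
    {𝒜 ℬ : ℕ → MeasurableSpace Ω} (h𝒜 : ∀ k, 𝒜 k ≤ mΩ) (hℬ : ∀ k, ℬ k ≤ mΩ) {β : ℝ}
    (hβ0 : 0 ≤ β) (hβ : ∀ k, betaCoeff P (𝒜 k) (ℬ k) ≤ ENNReal.ofReal β)
    (hs : ∀ k, Measurable[𝒜 k] (s k)) (hb : ∀ k, Measurable[ℬ k] (b k))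
    (hs0 : ∀ ω, s 0 ω = 0) (hsb : ∀ k ω, s (k + 1) ω = s k ω + b k ω)
    {L l ρ : ℝ} (hl0 : 0 ≤ l) (hlL : K * l ≤ L)
    (hsL : ∀ k ω, s k ω ⬝ᵥ s k ω ≤ L) (hbl : ∀ k ω, b k ω ⬝ᵥ b k ω ≤ l)
    (hb0 : ∀ k i, ∫ ω, b k ω i ∂P = 0)
    (hρ0 : 0 ≤ ρ) (hρ : ∀ k v, ∫ ω, (v ⬝ᵥ b k ω) ^ 2 ∂P ≤ ρ * (v ⬝ᵥ v))
    {A : Matrix (Fin N) (Fin N) ℝ} (hA : IsSymmContraction A) :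
    ∃ c : ℝ, ∫ ω, (quadForm A (s K ω) - c) ^ 2 ∂P ≤
      K * (8 * ρ * L + 8 * l ^ 2 + 128 * L ^ 2 * β) := by
  -- The induction also carries `|c| ≤ k * l`, which with `K * l ≤ L` keeps the centre within the
  -- bound that the one-block step requires.
  have key : ∀ k ≤ K, ∃ c : ℝ, |c| ≤ k * l ∧ ∫ ω, (quadForm A (s k ω) - c) ^ 2 ∂P ≤
      k * (8 * ρ * L + 8 * l ^ 2 + 128 * L ^ 2 * β) := by
    intro k
    induction k with
    | zero =>
      intro _
      exact ⟨0, by simp, by simp [hs0, quadForm]⟩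
    | succ k ih =>
      intro hk
      obtain ⟨c, hc, hck⟩ := ih (by omega)
      have hkK : ((k : ℝ) + 1) * l ≤ K * l := by
        refine mul_le_mul_of_nonneg_right ?_ hl0
        exact_mod_cast hk
      have hkl : 0 ≤ (k : ℝ) * l := by positivity
      refine ⟨c + ∫ ω', quadForm A (b k ω') ∂P, ?_, ?_⟩
      · have : |∫ ω', quadForm A (b k ω') ∂P| ≤ l := by
          have := norm_integral_le_of_norm_le_const (μ := P) (f := fun ω => quadForm A (b k ω))
            (C := l) (Eventually.of_forall fun ω => (hA.abs_quadForm_le _).trans (hbl k ω))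
          simpa using this
        refine (abs_add_le _ _).trans ?_
        push_cast
        linarith
      · have := integral_quadForm_add_sq_le (h𝒜 k) (hℬ k) hβ0 (hβ k) (hs k) (hb k) (L := L)
          (l := l) (ρ := ρ) (c := c) (by linarith) (hsL k) (hbl k) (hb0 k) hρ0 (hρ k)
          (by linarith) hA
        simp only [hsb]
        refine this.trans ?_
        push_cast
        linarith
  obtain ⟨c, -, hc⟩ := key K le_rfl
  exact ⟨c, hc⟩

end Concentration

/-! ### Gaps, window processes and masked columns -/

section Blocks

theorem sigmaOf_mono {Ω : Type*} (ε : ℤ → Ω → ℝ) {S S' : Set ℤ} (h : S ⊆ S') :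
    sigmaOf ε S ≤ sigmaOf ε S' :=
  iSup₂_le fun i hi => le_iSup₂_of_le i (h hi) le_rfl

/-- The indices `i < N` that are kept when each of `K` blocks of length `N / K` loses its last `q`
indices. -/
def Kept (K q N i : ℕ) : Prop := i < K * (N / K) ∧ i % (N / K) + q < N / K

instance (K q N i : ℕ) : Decidable (Kept K q N i) := by unfold Kept; infer_instance

/-- Within its block a kept index stays more than `q` below the block's end, and block ends are the
multiples of `N / K`. This is the gap that mixing acts across. -/
theorem Kept.add_lt {K q N i k : ℕ} (h : Kept K q N i) (hk : i < k * (N / K)) :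
    i + q < k * (N / K) := by
  obtain ⟨h1, h2⟩ := h
  set p := N / K with hp
  have hp0 : 0 < p := by omega
  have h3 : i / p < k := (Nat.div_lt_iff_lt_mul hp0).2 hk
  have h4 : p * (i / p) + i % p = i := Nat.div_add_mod i p
  have h5 : (i / p + 1) * p ≤ k * p := Nat.mul_le_mul_right p h3
  have h6 : (i / p + 1) * p = p * (i / p) + p := by ring
  omega

/-- At most `q` indices are lost in each of the `K` blocks, and fewer than `K` in the remainder of
the division. -/
theorem card_not_kept_le (K q N : ℕ) (hK : 0 < K) :
    (Finset.univ.filter fun i : Fin N => ¬ Kept K q N i).card ≤ K * q + K := by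
  set p := N / K with hp
  have hN : N < K * p + K := by
    have h1 := Nat.div_add_mod N K
    have h2 := Nat.mod_lt N hK
    rw [← hp] at h1
    omega
  have hsub : (Finset.univ.filter fun i : Fin N => ¬ Kept K q N i).card ≤
      ((Finset.range K ×ˢ Finset.range q).image (fun x : ℕ × ℕ => x.1 * p + (p - 1 - x.2)) ∪
        Finset.Ico (K * p) (K * p + K)).card := by
    refine Finset.card_le_card_of_injOn (fun i : Fin N => (i : ℕ)) (fun i hi => ?_)
      fun a _ b _ hab => Fin.ext hab
    have hi := (Finset.mem_filter.1 hi).2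
    simp only [Finset.coe_union, Set.mem_union, Finset.mem_coe, Finset.mem_Ico, Finset.mem_image,
      Finset.mem_product, Finset.mem_range]
    by_cases h1 : (i : ℕ) < K * p
    · left
      have hp0 : 0 < p := Nat.pos_of_ne_zero fun h => by
        rw [h] at h1
        omega
      have h2 : p ≤ (i : ℕ) % p + q := not_lt.1 fun h => hi ⟨h1, h⟩
      have h3 := Nat.mod_lt (i : ℕ) hp0
      have h4 := Nat.div_add_mod (i : ℕ) p
      refine ⟨((i : ℕ) / p, p - 1 - (i : ℕ) % p),
        ⟨(Nat.div_lt_iff_lt_mul hp0).2 h1, by simp only; omega⟩, ?_⟩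
      simp only
      rw [mul_comm]
      omega
    · right
      have := i.2
      omega
  refine hsub.trans ((Finset.card_union_le _ _).trans (add_le_add (Finset.card_image_le.trans ?_) ?_))
  · simp
  · simp

variable {Ω : Type*} [mΩ : MeasurableSpace Ω] {P : Measure Ω} {ε : ℤ → Ω → ℝ}

theorem sigmaOf_le (hε : ∀ k, Measurable (ε k)) (S : Set ℤ) : sigmaOf ε S ≤ mΩ :=
  iSup₂_le fun i _ => (hε i).comap_le

theorem betaCoeff_sigmaOf_le {n : ℕ} (hn : n ≠ 0) (k : ℤ) :
    betaCoeff P (sigmaOf ε (Set.Iic k)) (sigmaOf ε (Set.Ici (k + n))) ≤ betaMixing P ε n := by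
  unfold betaMixing
  rw [if_neg hn]
  exact le_iSup (fun k : ℤ => betaCoeff P (sigmaOf ε (Set.Iic k)) (sigmaOf ε (Set.Ici (k + n)))) k

/-- A bounded centered process each of whose variables depends on a finite window of `ε`. -/
structure IsWindowProcess (P : Measure Ω) (ε : ℤ → Ω → ℝ) (m : ℕ) (T : ℝ)
    (Y : ℤ → Ω → ℝ) : Prop where
  measurable : ∀ k, Measurable[sigmaOf ε (Set.Icc (k - m) (k + m))] (Y k)
  bound : ∀ k ω, |Y k ω| ≤ T
  integral : ∀ k, ∫ ω, Y k ω ∂P = 0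

/-- The column `(Y s, …, Y (s + N - 1))` with the entries that are not kept replaced by zero. -/
def maskedColumn (Y : ℤ → Ω → ℝ) (K q N : ℕ) (s : ℤ) (ω : Ω) (i : Fin N) : ℝ :=
  if Kept K q N i then Y (s + (i : ℕ)) ω else 0

variable {m : ℕ} {T : ℝ} {Y : ℤ → Ω → ℝ}

theorem IsWindowProcess.measurable_of_subset (hY : IsWindowProcess P ε m T Y) {k : ℤ} {S : Set ℤ}
    (h : ∀ l, k - m ≤ l → l ≤ k + m → l ∈ S) : Measurable[sigmaOf ε S] (Y k) :=
  (hY.measurable k).mono (sigmaOf_mono ε fun l hl => h l hl.1 hl.2) le_rfl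

theorem IsWindowProcess.measurable' (hY : IsWindowProcess P ε m T Y) (hε : ∀ k, Measurable (ε k))
    (k : ℤ) : Measurable (Y k) := (hY.measurable k).mono (sigmaOf_le hε _) le_rfl

variable [IsProbabilityMeasure P]

theorem IsWindowProcess.nonneg (hY : IsWindowProcess P ε m T Y) : 0 ≤ T := by
  have := nonempty_of_isProbabilityMeasure P
  exact (abs_nonneg _).trans (hY.bound 0 (Classical.arbitrary Ω))

theorem IsWindowProcess.abs_integral_mul_le_sq (hY : IsWindowProcess P ε m T Y) (k l : ℤ) :
    |∫ ω, Y k ω * Y l ω ∂P| ≤ T ^ 2 := by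
  have := norm_integral_le_of_norm_le_const (μ := P) (f := fun ω => Y k ω * Y l ω) (C := T ^ 2)
    (Eventually.of_forall fun ω => by
      rw [norm_mul, sq]
      exact mul_le_mul (hY.bound k ω) (hY.bound l ω) (norm_nonneg _) hY.nonneg)
  simpa using this

/-- Windows of radius `m` at distance `2m + n` are still `n` apart. Decoupling the product leaves
the product of the means, which is zero. -/
theorem IsWindowProcess.abs_integral_mul_le (hY : IsWindowProcess P ε m T Y)
    (hε : ∀ k, Measurable (ε k)) {n : ℕ} (hn : n ≠ 0) {β : ℝ} (hβ0 : 0 ≤ β)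
    (hβ : betaMixing P ε n ≤ ENNReal.ofReal β) (k l : ℤ) (hkl : 2 * m + n ≤ (k - l).natAbs) :
    |∫ ω, Y k ω * Y l ω ∂P| ≤ 4 * T ^ 2 * β := by
  have main : ∀ k l : ℤ, k + (2 * m + n) ≤ l → |∫ ω, Y k ω * Y l ω ∂P| ≤ 4 * T ^ 2 * β := by
    intro k l hkl
    have h1 : Measurable[sigmaOf ε (Set.Iic (k + m))] (Y k) :=
      hY.measurable_of_subset fun i _ hi => hi
    have h2 : Measurable[sigmaOf ε (Set.Ici (k + m + n))] (Y l) :=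
      hY.measurable_of_subset fun i hi _ => by
        simp only [Set.mem_Ici]
        linarith
    have := abs_integral_decouple_le' (sigmaOf_le hε _) (sigmaOf_le hε _) hβ0
      ((betaCoeff_sigmaOf_le hn _).trans hβ) h1 h2 (f := fun x : ℝ × ℝ => x.1 * x.2)
      (by fun_prop) (C := T ^ 2) (by positivity) (fun ω ω' => by
        rw [abs_mul, sq]
        exact mul_le_mul (hY.bound k ω) (hY.bound l ω') (abs_nonneg _) hY.nonneg)
    simpa only [integral_const_mul, hY.integral, mul_zero, integral_zero, sub_zero] using this
  rcases le_total k l with h | h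
  · exact main k l (by omega)
  · have := main l k (by omega)
    simpa only [mul_comm] using this

/-- Concentration of quadratic forms of masked columns. -/
theorem IsWindowProcess.exists_integral_quadForm_sq_le (hY : IsWindowProcess P ε m T Y)
    (hε : ∀ k, Measurable (ε k)) {r : ℕ} {β : ℝ} (hβ0 : 0 ≤ β)
    (hβ : betaMixing P ε (r + 1) ≤ ENNReal.ofReal β) {K : ℕ} (hK : 0 < K) (N : ℕ) (s : ℤ)
    {A : Matrix (Fin N) (Fin N) ℝ} (hA : IsSymmContraction A) :
    ∃ c : ℝ, ∫ ω, (quadForm A (maskedColumn Y K (2 * m + r) N s ω) - c) ^ 2 ∂P ≤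
      T ^ 4 * (16 * (K * (2 * m + r + 1)) * N + (160 * (K * β) + 8 / K) * N ^ 2) := by
  set q := 2 * m + r with hq
  set p := N / K with hp
  have hT := hY.nonneg
  have hKR : (0 : ℝ) < K := by exact_mod_cast hK
  have hpK : K * p ≤ N := Nat.mul_div_le N K
  set S : ℕ → Ω → Fin N → ℝ := fun k ω i =>
    if Kept K q N i ∧ (i : ℕ) < k * p then Y (s + (i : ℕ)) ω else 0 with hS
  set B : ℕ → Ω → Fin N → ℝ := fun k ω i =>
    if Kept K q N i ∧ k * p ≤ (i : ℕ) ∧ (i : ℕ) < (k + 1) * p then Y (s + (i : ℕ)) ω else 0 with hB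
  -- The last index of `ε` seen before block `k`: the last possible kept index `s + k p - q - 1`
  -- plus the radius `m`. Since `q = 2m + r`, the point `t k + r + 1` equals `s + k p - m`, the
  -- first index that block `k` can see.
  set t : ℕ → ℤ := fun k => s + (k * p : ℕ) - q - 1 + m with ht
  have hSm : ∀ k, Measurable[sigmaOf ε (Set.Iic (t k))] (S k) := fun k => by
    refine @measurable_pi_lambda _ _ _ (sigmaOf ε (Set.Iic (t k))) _ _ fun i => ?_
    by_cases h : Kept K q N i ∧ (i : ℕ) < k * p
    · simp only [hS, h, and_self, if_true]
      refine hY.measurable_of_subset fun l _ hl => ?_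
      have := h.1.add_lt h.2
      rw [← hp] at this
      simp only [Set.mem_Iic, ht]
      omega
    · simp only [hS, h, if_false]
      exact @measurable_const _ _ _ (sigmaOf ε (Set.Iic (t k))) _
  have hBm : ∀ k, Measurable[sigmaOf ε (Set.Ici (t k + (r + 1 : ℕ)))] (B k) := fun k => by
    refine @measurable_pi_lambda _ _ _ (sigmaOf ε (Set.Ici (t k + (r + 1 : ℕ)))) _ _ fun i => ?_
    by_cases h : Kept K q N i ∧ k * p ≤ (i : ℕ) ∧ (i : ℕ) < (k + 1) * p
    · simp only [hB, h, and_self, if_true]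
      refine hY.measurable_of_subset fun l hl _ => ?_
      have := h.2.1
      simp only [Set.mem_Ici, ht]
      omega
    · simp only [hB, h, if_false]
      exact @measurable_const _ _ _ (sigmaOf ε (Set.Ici (t k + (r + 1 : ℕ)))) _
  have hYsq : ∀ k ω, Y k ω * Y k ω ≤ T ^ 2 := fun k ω => by
    rw [← abs_mul_abs_self, sq]
    exact mul_le_mul (hY.bound k ω) (hY.bound k ω) (abs_nonneg _) hT
  have hSL : ∀ k ω, S k ω ⬝ᵥ S k ω ≤ N * T ^ 2 := fun k ω => by
    refine (Finset.sum_le_card_nsmul _ _ (T ^ 2) fun i _ => ?_).trans_eq (by simp)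
    simp only [hS]
    split_ifs
    · exact hYsq _ _
    · rw [mul_zero]
      positivity
  have hcard : ∀ k, (Finset.univ.filter fun i : Fin N =>
      k * p ≤ (i : ℕ) ∧ (i : ℕ) < (k + 1) * p).card ≤ p := fun k => by
    have : (Finset.univ.filter fun i : Fin N =>
      k * p ≤ (i : ℕ) ∧ (i : ℕ) < (k + 1) * p).card ≤ (Finset.Ico (k * p) ((k + 1) * p)).card :=
      Finset.card_le_card_of_injOn (fun i : Fin N => (i : ℕ)) (fun i hi => by
        simpa using (Finset.mem_filter.1 hi).2) fun a _ b _ hab => Fin.ext hab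
    refine this.trans_eq ?_
    rw [Nat.card_Ico, add_mul, one_mul, Nat.add_sub_cancel_left]
  have hBl : ∀ k ω, B k ω ⬝ᵥ B k ω ≤ p * T ^ 2 := fun k ω => by
    have h1 : B k ω ⬝ᵥ B k ω ≤ ∑ i : Fin N,
        if k * p ≤ (i : ℕ) ∧ (i : ℕ) < (k + 1) * p then T ^ 2 else 0 := by
      refine Finset.sum_le_sum fun i _ => ?_
      simp only [hB]
      by_cases h2 : k * p ≤ (i : ℕ) ∧ (i : ℕ) < (k + 1) * p
      · simp only [h2, and_true, and_self, if_true]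
        split_ifs
        · exact hYsq _ _
        · rw [mul_zero]
          positivity
      · simp [h2]
    refine h1.trans ?_
    rw [← Finset.sum_filter, Finset.sum_const, nsmul_eq_mul]
    exact mul_le_mul_of_nonneg_right (by exact_mod_cast hcard k) (by positivity)
  have hS0 : ∀ ω, S 0 ω = 0 := fun ω => by
    funext i
    simp [hS]
  have hSB : ∀ k ω, S (k + 1) ω = S k ω + B k ω := fun k ω => by
    funext i
    simp only [hS, hB, Pi.add_apply]
    have hkp : k * p ≤ (k + 1) * p := Nat.mul_le_mul_right p (by omega)
    by_cases h0 : Kept K q N i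
    · by_cases h1 : (i : ℕ) < k * p
      · have h2 : (i : ℕ) < (k + 1) * p := lt_of_lt_of_le h1 hkp
        have h3 : ¬ k * p ≤ (i : ℕ) := not_le.2 h1
        simp [h0, h1, h2]
      · have h3 : k * p ≤ (i : ℕ) := not_lt.1 h1
        simp [h0, h1, h3]
    · simp [h0]
  have hBY : ∀ k i, (∀ ω, B k ω i = Y (s + (i : ℕ)) ω) ∨ ∀ ω, B k ω i = 0 := fun k i => by
    by_cases h : Kept K q N i ∧ k * p ≤ (i : ℕ) ∧ (i : ℕ) < (k + 1) * p
    · exact Or.inl fun ω => by simp only [hB, h, and_self, if_true]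
    · exact Or.inr fun ω => by simp only [hB, h, if_false]
  have hB0 : ∀ k i, ∫ ω, B k ω i ∂P = 0 := fun k i => by
    rcases hBY k i with h | h
    · simp only [h, hY.integral]
    · simp only [h, integral_zero]
  have hBmem : ∀ k i, MemLp (fun ω => B k ω i) 2 P := fun k i => by
    refine MemLp.of_bound (C := T) (((measurable_pi_apply i).comp
      ((hBm k).mono (sigmaOf_le hε _) le_rfl)).aestronglyMeasurable)
      (Eventually.of_forall fun ω => ?_)
    rcases hBY k i with h | h
    · simp only [h]
      exact hY.bound _ _
    · simp only [h, norm_zero, hT]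
  have hcov1 : ∀ k (i j : Fin N), |∫ ω, B k ω i * B k ω j ∂P| ≤ T ^ 2 := fun k i j => by
    rcases hBY k i with h | h <;> rcases hBY k j with h' | h' <;>
      simp only [h, h', mul_zero, zero_mul, integral_zero, abs_zero]
    · exact hY.abs_integral_mul_le_sq _ _
    all_goals positivity
  have hcov2 : ∀ k (i j : Fin N), 2 * m + r + 1 ≤ ((i : ℤ) - (j : ℤ)).natAbs →
      |∫ ω, B k ω i * B k ω j ∂P| ≤ 4 * T ^ 2 * β := fun k i j hij => by
    rcases hBY k i with h | h <;> rcases hBY k j with h' | h' <;>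
      simp only [h, h', mul_zero, zero_mul, integral_zero, abs_zero]
    · exact hY.abs_integral_mul_le hε (Nat.succ_ne_zero r) hβ0 hβ _ _ (by omega)
    all_goals positivity
  -- Here `ρ = 2(2m + r + 1)T² + 4T²βN`. Its β-part contributes 32 to the final constant 160, the
  -- remaining 128 being the decoupling error.
  have hρ := fun k v => integral_dotProduct_sq_le (hBmem k) (by positivity : (0 : ℝ) ≤ T ^ 2)
    (by positivity) (hcov1 k) (hcov2 k) v
  have hpR : (K : ℝ) * p ≤ N := by exact_mod_cast hpK
  obtain ⟨c, hc⟩ := GramBetaMixing.exists_integral_quadForm_sq_le (K := K)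
    (fun k => sigmaOf_le hε _) (fun k => sigmaOf_le hε _) hβ0
    (fun k => (betaCoeff_sigmaOf_le (Nat.succ_ne_zero r) (t k)).trans hβ) hSm hBm hS0 hSB
    (L := N * T ^ 2) (l := p * T ^ 2) (by positivity)
    (by nlinarith [sq_nonneg T]) hSL hBl hB0 (by positivity) hρ hA
  have hSK : ∀ ω, S K ω = maskedColumn Y K q N s ω := fun ω => by
    funext i
    simp only [hS, maskedColumn]
    by_cases h : Kept K q N i
    · simp [h, h.1, hp]
    · simp [h]
  simp only [hSK] at hc
  refine ⟨c, hc.trans ?_⟩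
  have hpn : (p : ℝ) ≤ N / K := by
    rw [le_div_iff₀ hKR]
    linarith
  have hp2 : (K : ℝ) * (8 * (p * T ^ 2) ^ 2) ≤ T ^ 4 * (8 / K * N ^ 2) := by
    have h2 : T ^ 4 * (8 / K * N ^ 2) = K * (8 * (N / K) ^ 2 * T ^ 4) := by
      field_simp
    rw [h2]
    have h3 : (8 : ℝ) * (p * T ^ 2) ^ 2 = 8 * (p : ℝ) ^ 2 * T ^ 4 := by ring
    rw [h3]
    gcongr
  push_cast
  nlinarith [hp2]

end Blocks

/-! ### Concentration of Gaussian quadratic forms -/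

section Gaussian

variable {Ω : Type*} [MeasurableSpace Ω] {P : Measure Ω} {N : ℕ}

/-- `|W| ≤ a + W²/a` pointwise; the free `a` is later balanced against the second moment. -/
theorem integral_abs_le_add_div [IsProbabilityMeasure P] {W : Ω → ℝ} (hW : MemLp W 2 P) {a : ℝ}
    (ha : 0 < a) : ∫ ω, |W ω| ∂P ≤ a + (∫ ω, W ω ^ 2 ∂P) / a := by
  have h1 : Integrable (fun ω => W ω ^ 2 / a) P := hW.integrable_sq.div_const a
  have h2 : ∫ ω, |W ω| ∂P ≤ ∫ ω, (a + W ω ^ 2 / a) ∂P := by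
    refine integral_mono (hW.integrable one_le_two).abs ((integrable_const a).add h1) fun ω => ?_
    have : |W ω| * a ≤ (a + W ω ^ 2 / a) * a := by
      rw [add_mul, div_mul_cancel₀ _ ha.ne', ← sq_abs]
      nlinarith [sq_nonneg (|W ω| - a), mul_nonneg (abs_nonneg (W ω)) ha.le]
    exact le_of_mul_le_mul_right this ha
  rw [integral_add (integrable_const a) h1, integral_div] at h2
  simpa using h2

theorem integral_quadForm_eq {b : Ω → Fin N → ℝ} (hb : ∀ i, MemLp (fun ω => b ω i) 2 P)
    (A : Matrix (Fin N) (Fin N) ℝ) : Integrable (fun ω => quadForm A (b ω)) P ∧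
      ∫ ω, quadForm A (b ω) ∂P = ∑ i, ∑ j, A i j * ∫ ω, b ω i * b ω j ∂P := by
  have hint : ∀ i j, Integrable (fun ω => A i j * (b ω i * b ω j)) P := fun i j =>
    ((hb i).integrable_mul (hb j)).const_mul _
  have e : ∀ ω, quadForm A (b ω) = ∑ i, ∑ j, A i j * (b ω i * b ω j) := fun ω => by
    simp only [quadForm, dotProduct, mulVec, Finset.mul_sum]
    exact Finset.sum_congr rfl fun i _ => Finset.sum_congr rfl fun j _ => by ring
  simp only [e]
  refine ⟨integrable_finsetSum _ fun i _ => integrable_finsetSum _ fun j _ => hint i j, ?_⟩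
  rw [integral_finsetSum _ fun i _ => integrable_finsetSum _ fun j _ => hint i j]
  refine Finset.sum_congr rfl fun i _ => ?_
  rw [integral_finsetSum _ fun j _ => hint i j]
  exact Finset.sum_congr rfl fun j _ => integral_const_mul _ _

theorem integral_dotProduct_self_le {b : Ω → Fin N → ℝ} (hb : ∀ i, MemLp (fun ω => b ω i) 2 P)
    {M : ℝ} (hM : ∀ i, ∫ ω, b ω i * b ω i ∂P ≤ M) :
    Integrable (fun ω => b ω ⬝ᵥ b ω) P ∧ ∫ ω, b ω ⬝ᵥ b ω ∂P ≤ N * M := by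
  have hint : ∀ i, Integrable (fun ω => b ω i * b ω i) P := fun i => (hb i).integrable_mul (hb i)
  simp only [dotProduct]
  refine ⟨integrable_finsetSum _ fun i _ => hint i, ?_⟩
  rw [integral_finsetSum _ fun i _ => hint i]
  exact (Finset.sum_le_card_nsmul _ _ _ fun i _ => hM i).trans_eq (by simp)

/-- Concentration of quadratic forms of a centered Gaussian vector, by rotating two independent
copies. -/
theorem integral_abs_quadForm_gaussian_le [IsProbabilityMeasure P] {g g' : Ω → Fin N → ℝ}
    (hgm : Measurable g) (hgm' : Measurable g') (hg : HasGaussianLaw g P)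
    (hg' : HasGaussianLaw g' P) (hind : IndepFun g g' P) (h0 : ∀ i, ∫ ω, g ω i ∂P = 0)
    (h0' : ∀ i, ∫ ω, g' ω i ∂P = 0)
    (hcov : ∀ i j, ∫ ω, g' ω i * g' ω j ∂P = ∫ ω, g ω i * g ω j ∂P)
    {M η : ℝ} (hM : 0 ≤ M) (hη : 0 ≤ η) {h : ℕ} (h1 : ∀ i j, |∫ ω, g ω i * g ω j ∂P| ≤ M)
    (h2 : ∀ i j : Fin N, h ≤ ((i : ℤ) - (j : ℤ)).natAbs → |∫ ω, g ω i * g ω j ∂P| ≤ η)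
    {A : Matrix (Fin N) (Fin N) ℝ} (hA : IsSymmContraction A) {a : ℝ} (ha : 0 < a) :
    ∫ ω, |quadForm A (g ω) - ∫ ω', quadForm A (g ω') ∂P| ∂P ≤
      a + 4 * (N * M) * (2 * h * M + η * N) / a := by
  have hjoint : HasGaussianLaw (fun ω => (g ω, g' ω)) P := hind.hasGaussianLaw hg hg'
  have hL : ∀ i, MemLp (fun ω => g ω i) 2 P := fun i => (hg.eval i).memLp_two
  have hL' : ∀ i, MemLp (fun ω => g' ω i) 2 P := fun i => (hg'.eval i).memLp_two
  -- The rotation: `u` and `v` are jointly Gaussian and uncorrelated, hence independent, and the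
  -- difference of the two quadratic forms is the bilinear form `v · A u`.
  set u : Ω → Fin N → ℝ := fun ω => g ω + g' ω with hu
  set v : Ω → Fin N → ℝ := fun ω => g ω - g' ω with hv
  have hum : Measurable u := hgm.add hgm'
  have hvm : Measurable v := hgm.sub hgm'
  have huL : ∀ i, MemLp (fun ω => u ω i) 2 P := fun i => (hL i).add (hL' i)
  have hvL : ∀ i, MemLp (fun ω => v ω i) 2 P := fun i => (hL i).sub (hL' i)
  have hi : ∀ i j, Integrable (fun ω => g ω i * g ω j) P := fun i j =>
    (hL i).integrable_mul (hL j)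
  have hi' : ∀ i j, Integrable (fun ω => g' ω i * g' ω j) P := fun i j =>
    (hL' i).integrable_mul (hL' j)
  have hc : ∀ i j, Integrable (fun ω => g ω i * g' ω j) P := fun i j =>
    (hL i).integrable_mul (hL' j)
  have hc0 : ∀ i j, ∫ ω, g ω i * g' ω j ∂P = 0 := fun i j => by
    have hij : IndepFun (fun ω => g ω i) (fun ω => g' ω j) P :=
      hind.comp (measurable_pi_apply i) (measurable_pi_apply j)
    have := hij.integral_mul_eq_mul_integral (hL i).aestronglyMeasurable
      (hL' j).aestronglyMeasurable
    simp only [Pi.mul_apply] at this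
    rw [this, h0, zero_mul]
  have hu0 : ∀ i, ∫ ω, u ω i ∂P = 0 := fun i => by
    simp only [hu, Pi.add_apply]
    rw [integral_add ((hL i).integrable one_le_two) ((hL' i).integrable one_le_two), h0, h0',
      add_zero]
  have huu : ∀ i, ∫ ω, u ω i * u ω i ∂P ≤ 2 * M := fun i => by
    have e : ∀ ω, u ω i * u ω i = g ω i * g ω i + (2 * (g ω i * g' ω i) + g' ω i * g' ω i) :=
      fun ω => by
        simp only [hu, Pi.add_apply]
        ring
    have j1 : Integrable (fun ω => 2 * (g ω i * g' ω i) + g' ω i * g' ω i) P :=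
      ((hc i i).const_mul 2).add (hi' i i)
    simp only [e]
    rw [integral_add (hi i i) j1, integral_add ((hc i i).const_mul 2) (hi' i i),
      integral_const_mul, hc0, hcov]
    linarith [(abs_le.1 (h1 i i)).2]
  have hvv : ∀ i j, ∫ ω, v ω i * v ω j ∂P = 2 * ∫ ω, g ω i * g ω j ∂P := fun i j => by
    have e : ∀ ω, v ω i * v ω j = (g ω i * g ω j + g' ω i * g' ω j) -
        (g ω i * g' ω j + g ω j * g' ω i) := fun ω => by
      simp only [hv, Pi.sub_apply]
      ring
    have j1 : Integrable (fun ω => g ω i * g ω j + g' ω i * g' ω j) P := (hi i j).add (hi' i j)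
    have j2 : Integrable (fun ω => g ω i * g' ω j + g ω j * g' ω i) P := (hc i j).add (hc j i)
    simp only [e]
    rw [integral_sub j1 j2, integral_add (hi i j) (hi' i j), integral_add (hc i j) (hc j i), hc0,
      hc0, hcov]
    ring
  have huv : IndepFun u v P := by
    have hlin : HasGaussianLaw (fun ω => (fun i => u ω i, fun j => v ω j)) P := by
      have := hjoint.map_fun
        (((ContinuousLinearMap.fst ℝ (Fin N → ℝ) (Fin N → ℝ)) +
          (ContinuousLinearMap.snd ℝ (Fin N → ℝ) (Fin N → ℝ))).prod
        ((ContinuousLinearMap.fst ℝ (Fin N → ℝ) (Fin N → ℝ)) -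
          (ContinuousLinearMap.snd ℝ (Fin N → ℝ) (Fin N → ℝ))))
      exact this
    refine HasGaussianLaw.indepFun_of_covariance_eval (X := fun i ω => u ω i)
      (Y := fun j ω => v ω j) hlin fun i j => ?_
    rw [covariance_eq_sub (huL i) (hvL j)]
    simp only [Pi.mul_apply]
    rw [hu0, zero_mul, sub_zero]
    have e : ∀ ω, u ω i * v ω j = (g ω i * g ω j - g' ω i * g' ω j) +
        (g ω j * g' ω i - g ω i * g' ω j) := fun ω => by
      simp only [hu, hv, Pi.add_apply, Pi.sub_apply]
      ring
    have j1 : Integrable (fun ω => g ω i * g ω j - g' ω i * g' ω j) P := (hi i j).sub (hi' i j)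
    have j2 : Integrable (fun ω => g ω j * g' ω i - g ω i * g' ω j) P := (hc j i).sub (hc i j)
    simp only [e]
    rw [integral_add j1 j2, integral_sub (hi i j) (hi' i j), integral_sub (hc j i) (hc i j), hc0,
      hc0, hcov]
    ring
  have hq := integral_quadForm_eq hL A
  have hq' := integral_quadForm_eq hL' A
  have hmean : ∫ ω, quadForm A (g ω) ∂P = ∫ ω, quadForm A (g' ω) ∂P := by
    rw [hq.2, hq'.2]
    exact Finset.sum_congr rfl fun i _ => Finset.sum_congr rfl fun j _ => by rw [hcov]
  have hqm := measurable_quadForm A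
  have hdiff : ∀ ω, quadForm A (g ω) - quadForm A (g' ω) = v ω ⬝ᵥ (A *ᵥ u ω) := fun ω => by
    simp only [hu, hv, quadForm, mulVec_add, sub_dotProduct, dotProduct_add]
    rw [hA.dotProduct_mulVec_comm (g' ω) (g ω)]
    ring
  -- The mean is that of the independent copy `g'`, so Jensen's inequality moves the absolute value
  -- inside.
  have hstep1 : ∫ ω, |quadForm A (g ω) - ∫ ω', quadForm A (g ω') ∂P| ∂P ≤
      ∫ ω, |v ω ⬝ᵥ (A *ᵥ u ω)| ∂P := by
    have hI : Integrable (fun ω => |quadForm A (g ω) - quadForm A (g' ω)|) P :=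
      (hq.1.sub hq'.1).abs
    have e := integral_indep_eq hgm hgm' hind
      (f := fun x : (Fin N → ℝ) × (Fin N → ℝ) => |quadForm A x.1 - quadForm A x.2|)
      ((hqm.comp measurable_fst).sub (hqm.comp measurable_snd)).abs hI
    simp only [← hdiff]
    rw [e, hmean]
    have hIprod : Integrable (fun x : Ω × Ω => |quadForm A (g x.1) - quadForm A (g' x.2)|)
        (P.prod P) := by
      have k1 : Integrable (fun x : Ω × Ω => quadForm A (g x.1)) (P.prod P) := hq.1.comp_fst P
      have k2 : Integrable (fun x : Ω × Ω => quadForm A (g' x.2)) (P.prod P) := hq'.1.comp_snd P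
      exact (k1.sub k2).abs
    refine integral_mono (hq.1.sub (integrable_const _)).abs hIprod.integral_prod_left fun ω => ?_
    simp only
    have : quadForm A (g ω) - ∫ ω', quadForm A (g' ω') ∂P =
        ∫ ω', (quadForm A (g ω) - quadForm A (g' ω')) ∂P := by
      rw [integral_sub (integrable_const _) hq'.1]
      simp
    rw [this]
    exact abs_integral_le_integral_abs
  refine hstep1.trans ?_
  have hI : Integrable (fun ω => |v ω ⬝ᵥ (A *ᵥ u ω)|) P := by
    simp only [← hdiff]
    exact (hq.1.sub hq'.1).abs
  have hfm : Measurable fun x : (Fin N → ℝ) × (Fin N → ℝ) => |x.2 ⬝ᵥ (A *ᵥ x.1)| :=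
    (measurable_dotProduct_mulVec A).abs
  rw [integral_indep_eq hum hvm huv (f := fun x => |x.2 ⬝ᵥ (A *ᵥ x.1)|) hfm hI]
  have hρ := integral_dotProduct_sq_le hvL (h := h) (by positivity : (0 : ℝ) ≤ 2 * M)
    (by positivity : (0 : ℝ) ≤ 2 * η) (fun i j => by
      rw [hvv, abs_mul, abs_two]
      linarith [h1 i j]) (fun i j hij => by
      rw [hvv, abs_mul, abs_two]
      linarith [h2 i j hij])
  have hself := integral_dotProduct_self_le huL huu
  set ρ : ℝ := 2 * h * (2 * M) + 2 * η * N with hρdef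
  have hρ0 : 0 ≤ ρ := by positivity
  -- For frozen `u`, the expression is a linear form in `v`, whose second moment is at most `ρ
  -- |u|²`.
  have hin : ∀ ω, ∫ ω', |v ω' ⬝ᵥ (A *ᵥ u ω)| ∂P ≤ a + ρ / a * (u ω ⬝ᵥ u ω) := fun ω => by
    have hmem : MemLp (fun ω' => v ω' ⬝ᵥ (A *ᵥ u ω)) 2 P := by
      simp only [dotProduct]
      exact memLp_finsetSum _ fun i _ => (hvL i).mul_const _
    refine (integral_abs_le_add_div hmem ha).trans ?_
    have k1 := hρ (A *ᵥ u ω)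
    simp only [dotProduct_comm (A *ᵥ u ω)] at k1
    have k2 := k1.trans (mul_le_mul_of_nonneg_left (hA.contract (u ω)) hρ0)
    have k3 := div_le_div_of_nonneg_right k2 ha.le
    linarith [mul_div_right_comm ρ (u ω ⬝ᵥ u ω) a]
  have hb : Integrable (fun ω => a + ρ / a * (u ω ⬝ᵥ u ω)) P :=
    (integrable_const a).add (hself.1.const_mul _)
  refine (integral_mono_of_nonneg (Eventually.of_forall fun ω =>
    integral_nonneg fun ω' => abs_nonneg _) hb (Eventually.of_forall hin)).trans ?_
  rw [integral_add (integrable_const a) (hself.1.const_mul _), integral_const_mul]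
  simp only [integral_const, probReal_univ, one_smul]
  have k4 := mul_le_mul_of_nonneg_left hself.2 (div_nonneg hρ0 ha.le)
  have k5 : ρ / a * (N * (2 * M)) = 4 * (N * M) * (2 * h * M + η * N) / a := by
    rw [hρdef]
    field_simp
    ring
  linarith

end Gaussian

/-! ### Centered measurable versions of the Gaussian columns -/

section GaussianColumns

variable {Ω : Type*} [MeasurableSpace Ω] {P : Measure Ω}

theorem HasGaussianLaw.sub_const' {E : Type*} [NormedAddCommGroup E] [NormedSpace ℝ E]
    [MeasurableSpace E] [BorelSpace E] [SecondCountableTopology E] [CompleteSpace E] {W : Ω → E}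
    (hW : HasGaussianLaw W P) (c : E) : HasGaussianLaw (fun ω => W ω - c) P where
  isGaussian_map := by
    have h1 : IsGaussian (P.map W) := hW.isGaussian_map
    have h2 : P.map (fun ω => W ω - c) = (P.map W).map fun x => x - c :=
      (AEMeasurable.map_map_of_aemeasurable (g := fun x : E => x - c) (by fun_prop)
        hW.aemeasurable).symm
    rw [h2]
    infer_instance

/-- Finitely many variables of independent Gaussian processes with the same law, centered and made
measurable. -/
theorem exists_centered_gaussian_columns [IsProbabilityMeasure P] {Z : ℕ → ℤ → Ω → ℝ}
    (hZgauss : ∀ i, IsGaussianProcess (Z i) P)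
    (hZindep : iIndepFun (fun (i : ℕ) (ω : Ω) (k : ℤ) => Z i k ω) P)
    (hZident : ∀ i, IdentDistrib (fun ω (k : ℤ) => Z i k ω) (fun ω (k : ℤ) => Z 0 k ω) P P)
    (N : ℕ) :
    ∃ (V : ℕ → Ω → Fin N → ℝ) (a : Fin N → ℝ), (∀ j, Measurable (V j)) ∧ iIndepFun V P ∧
      (∀ j, HasGaussianLaw (V j) P) ∧ (∀ j i, ∫ ω, V j ω i ∂P = 0) ∧
      (∀ j (i i' : Fin N), ∫ ω, V j ω i * V j ω i' ∂P =
        cov[Z j ((i : ℕ) + 1), Z j ((i' : ℕ) + 1); P]) ∧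
      ∀ j, ∀ᵐ ω ∂P, (fun i : Fin N => Z j ((i : ℕ) + 1) ω) = V j ω + a := by
  -- The mean vector may be nonzero, but identity in law makes it the same for all columns.
  set a : Fin N → ℝ := fun i => ∫ ω, Z 0 ((i : ℕ) + 1) ω ∂P with ha
  have hmean : ∀ j (i : Fin N), ∫ ω, Z j ((i : ℕ) + 1) ω ∂P = a i := fun j i =>
    ((hZident j).comp (u := fun x : ℤ → ℝ => x ((i : ℕ) + 1)) (measurable_pi_apply _)).integral_eq
  set W : ℕ → Ω → Fin N → ℝ := fun j ω => (fun i : Fin N => Z j ((i : ℕ) + 1) ω) - a with hW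
  have hWg : ∀ j, HasGaussianLaw (W j) P := fun j => by
    refine HasGaussianLaw.sub_const' ?_ a
    set I : Finset ℤ := Finset.univ.image fun i : Fin N => ((i : ℕ) : ℤ) + 1 with hI
    let L : (I → ℝ) →L[ℝ] (Fin N → ℝ) := ContinuousLinearMap.pi fun i : Fin N =>
      ContinuousLinearMap.proj (R := ℝ) (φ := fun _ : I => ℝ)
        ⟨((i : ℕ) : ℤ) + 1, Finset.mem_image_of_mem _ (Finset.mem_univ i)⟩
    exact ((hZgauss j).hasGaussianLaw I).map L
  have hWm : ∀ j, AEMeasurable (W j) P := fun j => (hWg j).aemeasurable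
  have hWind : iIndepFun W P :=
    hZindep.comp (fun _ (x : ℤ → ℝ) => (fun i : Fin N => x ((i : ℕ) + 1)) - a) fun _ => by
      fun_prop
  have hae : ∀ j, W j =ᵐ[P] (hWm j).mk (W j) := fun j => (hWm j).ae_eq_mk
  have hL1 : ∀ j (i : Fin N), MemLp (Z j ((i : ℕ) + 1)) 2 P := fun j i =>
    ((hZgauss j).hasGaussianLaw_eval _).memLp_two
  refine ⟨fun j => (hWm j).mk (W j), a, fun j => (hWm j).measurable_mk, hWind.congr hae,
    fun j => (hWg j).congr (hae j), fun j i => ?_, fun j i i' => ?_, fun j => ?_⟩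
  · have : ∫ ω, (hWm j).mk (W j) ω i ∂P = ∫ ω, W j ω i ∂P := by
      refine integral_congr_ae ?_
      filter_upwards [hae j] with ω hω
      rw [hω]
    rw [this]
    simp only [hW, Pi.sub_apply]
    rw [integral_sub ((hL1 j i).integrable one_le_two) (integrable_const _), hmean]
    simp
  · have : ∫ ω, (hWm j).mk (W j) ω i * (hWm j).mk (W j) ω i' ∂P = ∫ ω, W j ω i * W j ω i' ∂P := by
      refine integral_congr_ae ?_
      filter_upwards [hae j] with ω hω
      rw [hω]
    rw [this, covariance]
    simp only [hW, Pi.sub_apply, hmean]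
  · filter_upwards [hae j] with ω hω
    rw [← hω]
    simp [hW]

end GaussianColumns

/-! ### Exchanging a masked data column for an independent one -/

section Replacement

theorem measurable_maskedColumn {Ω : Type*} {ℳ : MeasurableSpace Ω} {Y : ℤ → Ω → ℝ} {K q N : ℕ} {s : ℤ}
    (h : ∀ i : Fin N, Kept K q N i → Measurable[ℳ] (Y (s + (i : ℕ)))) :
    Measurable[ℳ] (maskedColumn Y K q N s) := by
  refine @measurable_pi_lambda _ _ _ ℳ _ _ fun i => ?_
  by_cases hi : Kept K q N i
  · simpa only [maskedColumn, hi, if_true] using h i hi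
  · simp only [maskedColumn, hi, if_false]
    exact @measurable_const _ _ _ ℳ _

variable {Ω Ω' : Type*} [mΩ : MeasurableSpace Ω] [MeasurableSpace Ω'] {P : Measure Ω}
  [IsProbabilityMeasure P] {P' : Measure Ω'} [IsProbabilityMeasure P']

/-- The two functions live on different spaces; the pointwise bound is integrated over each space in
turn. -/
theorem abs_integral_sub_integral_le_add {f : Ω → ℝ} {f' : Ω' → ℝ} {b : Ω → ℝ} {b' : Ω' → ℝ}
    (hf : Integrable f P) (hf' : Integrable f' P') (hb : Integrable b P) (hb' : Integrable b' P')
    (h : ∀ ω ω', |f ω - f' ω'| ≤ b ω + b' ω') :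
    |∫ ω, f ω ∂P - ∫ ω, f' ω ∂P'| ≤ ∫ ω, b ω ∂P + ∫ ω, b' ω ∂P' := by
  have h1 : ∀ ω, |f ω - ∫ ω', f' ω' ∂P'| ≤ b ω + ∫ ω', b' ω' ∂P' := fun ω => by
    have e1 : f ω - ∫ ω', f' ω' ∂P' = ∫ ω', (f ω - f' ω') ∂P' := by
      rw [integral_sub (integrable_const _) hf']
      simp
    have e2 : b ω + ∫ ω', b' ω' ∂P' = ∫ ω', (b ω + b' ω') ∂P' := by
      rw [integral_add (integrable_const _) hb']
      simp
    rw [e1, e2]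
    exact abs_integral_le_integral_abs.trans (integral_mono
      ((integrable_const _).sub hf').abs ((integrable_const _).add hb') fun ω' => h ω ω')
  have e1 : ∫ ω, f ω ∂P - ∫ ω', f' ω' ∂P' = ∫ ω, (f ω - ∫ ω', f' ω' ∂P') ∂P := by
    rw [integral_sub hf (integrable_const _)]
    simp
  have e2 : ∫ ω, b ω ∂P + ∫ ω', b' ω' ∂P' = ∫ ω, (b ω + ∫ ω', b' ω' ∂P') ∂P := by
    rw [integral_add hb (integrable_const _)]
    simp
  rw [e1, e2]
  exact abs_integral_le_integral_abs.trans (integral_mono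
    (hf.sub (integrable_const _)).abs (hb.add (integrable_const _)) h1)

variable {ε : ℤ → Ω → ℝ} {m : ℕ} {T : ℝ} {X Y : ℤ → Ω → ℝ}

theorem IsWindowProcess.memLp (hY : IsWindowProcess P ε m T Y) (hε : ∀ k, Measurable (ε k))
    (k : ℤ) : MemLp (Y k) 2 P :=
  MemLp.of_bound (hY.measurable' hε k).aestronglyMeasurable T (Eventually.of_forall (hY.bound k))

theorem IsWindowProcess.memLp_maskedColumn (hY : IsWindowProcess P ε m T Y)
    (hε : ∀ k, Measurable (ε k)) (K q N : ℕ) (s : ℤ) (i : Fin N) :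
    MemLp (fun ω => maskedColumn Y K q N s ω i) 2 P := by
  by_cases hi : Kept K q N i
  · simpa only [maskedColumn, hi, if_true] using hY.memLp hε _
  · simp only [maskedColumn, hi, if_false]
    exact memLp_const 0

/-- The masked columns approximate the columns of the original process. -/
theorem integral_column_sub_le (hε : ∀ k, Measurable (ε k)) (hY : IsWindowProcess P ε m T Y)
    (hX : ∀ k, MemLp (X k) 2 P) {v t : ℝ} (ht : 0 < t) (ht1 : t ≤ 1)
    (hXv : ∀ k, ∫ ω, X k ω ^ 2 ∂P = v) (hXY : ∀ k, ∫ ω, (X k ω - Y k ω) ^ 2 ∂P ≤ t ^ 2)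
    {K q N : ℕ}
    (hmask : ((Finset.univ.filter fun i : Fin N => ¬ Kept K q N i).card : ℝ) ≤ t ^ 2 * N)
    (s : ℤ) {x : Ω → Fin N → ℝ} (hx : ∀ ω i, x ω i = X (s + (i : ℕ)) ω) :
    Integrable (fun ω => (t⁻¹ + 1) *
      ((x ω - maskedColumn Y K q N s ω) ⬝ᵥ (x ω - maskedColumn Y K q N s ω)) +
        t * (x ω ⬝ᵥ x ω)) P ∧
    ∫ ω, ((t⁻¹ + 1) *
      ((x ω - maskedColumn Y K q N s ω) ⬝ᵥ (x ω - maskedColumn Y K q N s ω)) +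
        t * (x ω ⬝ᵥ x ω)) ∂P ≤ t * N * (2 + 3 * v) := by
  have hv : 0 ≤ v := by
    rw [← hXv 0]
    exact integral_nonneg fun ω => sq_nonneg _
  have hxL : ∀ i, MemLp (fun ω => x ω i) 2 P := fun i => by
    simp only [hx]
    exact hX _
  have hdL : ∀ i, MemLp (fun ω => (x ω - maskedColumn Y K q N s ω) i) 2 P := fun i =>
    (hxL i).sub (hY.memLp_maskedColumn hε K q N s i)
  have h1 := integral_dotProduct_self_le hxL (M := v) fun i => by
    simp only [hx, ← sq]
    exact (hXv _).le
  have hdi : ∀ i, Integrable (fun ω => (x ω - maskedColumn Y K q N s ω) i *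
      (x ω - maskedColumn Y K q N s ω) i) P := fun i => (hdL i).integrable_mul (hdL i)
  have h2 : Integrable (fun ω => (x ω - maskedColumn Y K q N s ω) ⬝ᵥ
      (x ω - maskedColumn Y K q N s ω)) P := by
    simp only [dotProduct]
    exact integrable_finsetSum _ fun i _ => hdi i
  have h3 : ∫ ω, (x ω - maskedColumn Y K q N s ω) ⬝ᵥ (x ω - maskedColumn Y K q N s ω) ∂P ≤
      t ^ 2 * N * (1 + v) := by
    simp only [dotProduct]
    rw [integral_finsetSum _ fun i _ => hdi i]
    -- A kept entry costs the approximation error `t ^ 2`, a masked one its full variance `v`; by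
    -- `hmask` the masked entries are at most a fraction `t ^ 2`.
    have hterm : ∀ i : Fin N, ∫ ω, (x ω - maskedColumn Y K q N s ω) i *
        (x ω - maskedColumn Y K q N s ω) i ∂P ≤ t ^ 2 + if ¬ Kept K q N i then v else 0 := by
      intro i
      simp only [Pi.sub_apply, hx, ← sq]
      by_cases hi : Kept K q N i
      · simpa [maskedColumn, hi] using hXY _
      · simp only [maskedColumn, hi, if_false, sub_zero, hXv, not_false_eq_true, if_true]
        linarith [sq_nonneg t]
    refine (Finset.sum_le_sum fun i _ => hterm i).trans ?_
    rw [Finset.sum_add_distrib, ← Finset.sum_filter, Finset.sum_const, Finset.sum_const,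
      Finset.card_univ, Fintype.card_fin, nsmul_eq_mul, nsmul_eq_mul]
    nlinarith [mul_le_mul_of_nonneg_right hmask hv]
  refine ⟨(h2.const_mul _).add (h1.1.const_mul _), ?_⟩
  rw [integral_add (h2.const_mul _) (h1.1.const_mul _), integral_const_mul, integral_const_mul]
  have h4 := mul_le_mul_of_nonneg_left h3 (by positivity : 0 ≤ t⁻¹ + 1)
  have h6 : (t⁻¹ + 1) * (t ^ 2 * N * (1 + v)) = (t + t ^ 2) * (N * (1 + v)) := by
    field_simp
  have h7 : t ^ 2 ≤ t := by nlinarith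
  have h8 : (0 : ℝ) ≤ N * (1 + v) := by positivity
  nlinarith

/-- Concentration of quadratic forms of masked columns about the mean for the original process. -/
theorem integral_abs_quadForm_maskedColumn_le (hε : ∀ k, Measurable (ε k))
    (hY : IsWindowProcess P ε m T Y)
    (hX : ∀ k, MemLp (X k) 2 P) {v t : ℝ} (ht : 0 < t) (ht1 : t ≤ 1)
    (hXv : ∀ k, ∫ ω, X k ω ^ 2 ∂P = v) (hXY : ∀ k, ∫ ω, (X k ω - Y k ω) ^ 2 ∂P ≤ t ^ 2)
    {K q N : ℕ} (hN : 0 < N)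
    (hmask : ((Finset.univ.filter fun i : Fin N => ¬ Kept K q N i).card : ℝ) ≤ t ^ 2 * N)
    (s : ℤ) {x : Ω → Fin N → ℝ} (hx : ∀ ω i, x ω i = X (s + (i : ℕ)) ω)
    {A : Matrix (Fin N) (Fin N) ℝ} (hA : IsSymmContraction A)
    (hc : ∃ c : ℝ, ∫ ω, (quadForm A (maskedColumn Y K q N s ω) - c) ^ 2 ∂P ≤ (t * N) ^ 2) :
    ∫ ω, |quadForm A (maskedColumn Y K q N s ω) - ∫ ω', quadForm A (x ω') ∂P| ∂P ≤
      t * N * (6 + 3 * v) := by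
  obtain ⟨c, hc⟩ := hc
  set y := maskedColumn Y K q N s with hy
  have htN : 0 < t * N := by positivity
  have hyb : ∀ ω i, |y ω i| ≤ T := fun ω i => by
    simp only [hy, maskedColumn]
    split_ifs
    · exact hY.bound _ _
    · simpa using hY.nonneg
  have hym : Measurable y := measurable_maskedColumn fun i _ => hY.measurable' hε _
  have hqm : Measurable fun ω => quadForm A (y ω) := (measurable_quadForm A).comp hym
  have hqL : MemLp (fun ω => quadForm A (y ω)) 2 P := by
    refine MemLp.of_bound hqm.aestronglyMeasurable (N * T ^ 2) (Eventually.of_forall fun ω => ?_)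
    refine (hA.abs_quadForm_le _).trans ?_
    refine (Finset.sum_le_card_nsmul _ _ (T ^ 2) fun i _ => ?_).trans_eq (by simp)
    rw [← sq, ← sq_abs]
    exact pow_le_pow_left₀ (abs_nonneg _) (hyb ω i) 2
  have hxL : ∀ i, MemLp (fun ω => x ω i) 2 P := fun i => by
    simp only [hx]
    exact hX _
  have hqx := (integral_quadForm_eq hxL A).1
  have hqy := hqL.integrable one_le_two
  have hcon : ∫ ω, |quadForm A (y ω) - c| ∂P ≤ 2 * (t * N) := by
    refine (integral_abs_le_add_div (hqL.sub (memLp_const c)) htN).trans ?_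
    have : (∫ ω, (quadForm A (y ω) - c) ^ 2 ∂P) / (t * N) ≤ t * N := by
      rw [div_le_iff₀ htN, ← sq]
      exact hc
    simp only [Pi.sub_apply]
    linarith
  have happ := integral_column_sub_le hε hY hX ht ht1 hXv hXY hmask s hx
  have hE : |∫ ω, quadForm A (x ω) ∂P - ∫ ω, quadForm A (y ω) ∂P| ≤ t * N * (2 + 3 * v) := by
    rw [← integral_sub hqx hqy]
    exact abs_integral_le_integral_abs.trans ((integral_mono (hqx.sub hqy).abs happ.1 fun ω =>
      hA.abs_quadForm_sub_le ht _ _).trans happ.2)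
  have hE2 : |∫ ω, quadForm A (y ω) ∂P - c| ≤ 2 * (t * N) := by
    have : ∫ ω, quadForm A (y ω) ∂P - c = ∫ ω, (quadForm A (y ω) - c) ∂P := by
      rw [integral_sub hqy (integrable_const c)]
      simp
    rw [this]
    exact abs_integral_le_integral_abs.trans hcon
  -- The unknown centre `c` is traded for the mean of the unmasked form: `2tN` for the fluctuation,
  -- `2tN` for the distance from `c` to the masked mean, `tN(2 + 3v)` from the masked to the
  -- original mean.
  have hfin : ∀ ω, |quadForm A (y ω) - ∫ ω', quadForm A (x ω') ∂P| ≤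
      |quadForm A (y ω) - c| + (2 * (t * N) + t * N * (2 + 3 * v)) := fun ω => by
    have e : quadForm A (y ω) - ∫ ω', quadForm A (x ω') ∂P = (quadForm A (y ω) - c) -
        (∫ ω, quadForm A (y ω) ∂P - c) -
        (∫ ω, quadForm A (x ω) ∂P - ∫ ω, quadForm A (y ω) ∂P) := by ring
    rw [e]
    refine (abs_sub _ _).trans ?_
    have := abs_sub (quadForm A (y ω) - c) (∫ ω, quadForm A (y ω) ∂P - c)
    linarith
  have hi : Integrable (fun ω => |quadForm A (y ω) - c|) P := (hqy.sub (integrable_const c)).abs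
  refine (integral_mono (hqy.sub (integrable_const _)).abs (hi.add (integrable_const _))
    hfin).trans ?_
  rw [integral_add' hi (integrable_const _)]
  simp only [integral_const, probReal_univ, one_smul]
  linarith

/-- Replacing one column by another one for which quadratic forms concentrate at the same value. -/
theorem abs_integral_update_sub_le {N n j : ℕ} (hj : j < n) {z : ℂ} (hz : 0 < z.im) {φ : ℂ → ℝ}
    (hφm : Measurable φ) (hφ : ∀ w w', |φ w - φ w'| ≤ ‖w - w'‖) (hφ0 : φ 0 = 0)
    {y : Ω → Fin N → ℝ} {g : Ω' → Fin N → ℝ} (hy : Measurable y) (hg : Measurable g)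
    (hyL : ∀ i, MemLp (fun ω => y ω i) 2 P) (hgL : ∀ i, MemLp (fun ω => g ω i) 2 P')
    {r : ℝ} (h : ∀ A : Matrix (Fin N) (Fin N) ℝ, IsSymmContraction A → ∃ e : ℝ,
      ∫ ω, |quadForm A (y ω) - e| ∂P + ∫ ω, |quadForm A (g ω) - e| ∂P' ≤ r)
    (x : ℕ → Fin N → ℝ) :
    |∫ ω, φ (columnStieltjes z n (Function.update x j (y ω))) ∂P -
      ∫ ω, φ (columnStieltjes z n (Function.update x j (g ω))) ∂P'| ≤
      (N : ℝ)⁻¹ * (‖z‖ / z.im ^ 3 * (n : ℝ)⁻¹ * (4 * r)) := by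
  obtain ⟨A, hA, hAu⟩ := exists_quadForms_columnStieltjes hz n x hj
  choose e he using fun s => h (A s) (hA s)
  set F : (Fin N → ℝ) → ℝ := fun u => φ (columnStieltjes z n (Function.update x j u)) with hF
  have hFm : Measurable F :=
    hφm.comp ((measurable_columnStieltjes n).comp (measurable_update x))
  have hFb : ∀ u, |F u| ≤ z.im⁻¹ := fun u => by
    have := hφ (columnStieltjes z n (Function.update x j u)) 0
    rw [hφ0, sub_zero, sub_zero] at this
    exact this.trans (norm_columnStieltjes_le hz n _)
  set C : ℝ := (N : ℝ)⁻¹ * (‖z‖ / z.im ^ 3 * (n : ℝ)⁻¹) with hC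
  have hC0 : 0 ≤ C := by positivity
  have iy : ∀ s, Integrable (fun ω => |quadForm (A s) (y ω) - e s|) P := fun s =>
    ((integral_quadForm_eq hyL (A s)).1.sub (integrable_const _)).abs
  have ig : ∀ s, Integrable (fun ω => |quadForm (A s) (g ω) - e s|) P' := fun s =>
    ((integral_quadForm_eq hgL (A s)).1.sub (integrable_const _)).abs
  have key := abs_integral_sub_integral_le_add (P := P) (P' := P') (f := fun ω => F (y ω))
    (f' := fun ω => F (g ω)) (b := fun ω => C * ∑ s, |quadForm (A s) (y ω) - e s|)
    (b' := fun ω => C * ∑ s, |quadForm (A s) (g ω) - e s|)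
    (integrable_comp_of_bounded P hFm hFb hy) (integrable_comp_of_bounded P' hFm hFb hg)
    ((integrable_finsetSum _ fun s _ => iy s).const_mul C)
    ((integrable_finsetSum _ fun s _ => ig s).const_mul C) fun ω ω' => by
      refine ((hφ _ _).trans (hAu _ _)).trans ?_
      rw [← mul_assoc, ← mul_add, ← Finset.sum_add_distrib]
      refine mul_le_mul_of_nonneg_left (Finset.sum_le_sum fun s _ => ?_) hC0
      rw [abs_sub_comm (quadForm (A s) (g ω'))]
      exact abs_sub_le _ _ _
  refine key.trans ?_
  rw [integral_const_mul, integral_const_mul, integral_finsetSum _ fun s _ => iy s,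
    integral_finsetSum _ fun s _ => ig s, ← mul_add, ← Finset.sum_add_distrib, ← mul_assoc]
  refine mul_le_mul_of_nonneg_left ((Finset.sum_le_sum fun s _ => he s).trans_eq ?_) hC0
  rw [Finset.sum_const, Finset.card_univ, Fintype.card_fin, nsmul_eq_mul, Nat.cast_ofNat]

end Replacement

/-! ### Consequences of stationarity and mixing for the functional -/

section Stationary

variable {Ω : Type*} [mΩ : MeasurableSpace Ω] {P : Measure Ω} {ε : ℤ → Ω → ℝ}

theorem measurable_shifted (hε : ∀ k, Measurable (ε k)) (k : ℤ) :
    Measurable fun ω (i : ℤ) => ε (k + i) ω := measurable_pi_lambda _ fun _ => hε _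

theorem IsStrictlyStationary.integral_comp (hstat : IsStrictlyStationary P ε)
    {f : (ℤ → ℝ) → ℝ} (hf : Measurable f) (k : ℤ) :
    ∫ ω, f (fun i => ε (k + i) ω) ∂P = ∫ x, f x ∂(P.map fun ω (i : ℤ) => ε i ω) := by
  rw [← (hstat k).map_eq,
    integral_map (hstat k).aemeasurable_fst hf.aestronglyMeasurable]

/-- The product of two values of the process is one functional of the whole sequence, whose law is
shift invariant. -/
theorem IsStrictlyStationary.integral_mul_shift (hstat : IsStrictlyStationary P ε)
    {g : (ℤ → ℝ) → ℝ} (hg : Measurable g) (s a b : ℤ) :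
    ∫ ω, functionalProcess g ε (s + a) ω * functionalProcess g ε (s + b) ω ∂P =
      ∫ ω, functionalProcess g ε a ω * functionalProcess g ε b ω ∂P := by
  have hf : Measurable fun x : ℤ → ℝ => g (fun i => x (a + i)) * g (fun i => x (b + i)) :=
    (hg.comp (measurable_pi_lambda _ fun i => measurable_pi_apply _)).mul
      (hg.comp (measurable_pi_lambda _ fun i => measurable_pi_apply _))
  have h1 := hstat.integral_comp hf s
  have h2 := hstat.integral_comp hf 0
  simp only [zero_add, ← add_assoc] at h1 h2
  unfold functionalProcess
  rw [h1, h2]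

theorem measurable_functionalProcess (hε : ∀ k, Measurable (ε k)) {g : (ℤ → ℝ) → ℝ}
    (hg : Measurable g) (k : ℤ) : Measurable (functionalProcess g ε k) :=
  hg.comp (measurable_shifted hε k)

/-- A functional of a stationary sequence is approximated by window processes. -/
theorem exists_window_process [IsProbabilityMeasure P] (hε : ∀ k, Measurable (ε k))
    (hstat : IsStrictlyStationary P ε) {g : (ℤ → ℝ) → ℝ} (hg : Measurable g)
    (hX2 : MemLp (functionalProcess g ε 0) 2 P) (hX0 : ∫ ω, functionalProcess g ε 0 ω ∂P = 0)
    {δ : ℝ} (hδ : 0 < δ) :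
    ∃ (m : ℕ) (T : ℝ) (Y : ℤ → Ω → ℝ), IsWindowProcess P ε m T Y ∧
      ∀ k, ∫ ω, (functionalProcess g ε k ω - Y k ω) ^ 2 ∂P ≤ δ := by
  have hm0 : Measurable fun ω (i : ℤ) => ε i ω := measurable_pi_lambda _ hε
  have := Measure.isProbabilityMeasure_map (μ := P) hm0.aemeasurable
  have e0 : functionalProcess g ε 0 = g ∘ fun ω (i : ℤ) => ε i ω := by
    funext ω
    simp [functionalProcess]
  have hg2 : MemLp g 2 (P.map fun ω (i : ℤ) => ε i ω) := by
    rw [memLp_map_measure_iff hg.aestronglyMeasurable hm0.aemeasurable, ← e0]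
    exact hX2
  have hg0 : ∫ x, g x ∂(P.map fun ω (i : ℤ) => ε i ω) = 0 := by
    rw [← hstat.integral_comp hg 0]
    exact hX0
  obtain ⟨m, T, h, hh, hT, hh0, happ⟩ := exists_window_approximation hg hg2 hg0 hδ
  have hh' : Measurable h := hh.mono (windowFiltration.le m) le_rfl
  refine ⟨m, T, functionalProcess h ε, ⟨fun k => ?_, fun k ω => hT _, fun k => ?_⟩, fun k => ?_⟩
  -- The shift by `k` carries the window `[-m, m]` to `[k - m, k + m]`.
  · have hξ : @Measurable Ω (ℤ → ℝ) (sigmaOf ε (Set.Icc (k - m) (k + m))) (windowFiltration m)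
        fun ω (i : ℤ) => ε (k + i) ω := by
      rw [measurable_iff_le_map]
      refine iSup₂_le fun i hi => ?_
      rintro _ ⟨S, hS, rfl⟩
      have hki : k + i ∈ Set.Icc (k - (m : ℤ)) (k + m) := ⟨by linarith [hi.1], by linarith [hi.2]⟩
      exact (le_iSup₂_of_le (k + i) hki le_rfl :
        MeasurableSpace.comap (ε (k + i)) inferInstance ≤ _) _ ⟨S, hS, rfl⟩
    exact hh.comp hξ
  · exact (hstat.integral_comp hh' k).trans hh0
  · exact (hstat.integral_comp (f := fun x => (g x - h x) ^ 2) ((hg.sub hh').pow_const 2) k).trans_le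
      happ

/-- The covariances of a functional of an absolutely regular sequence tend to zero. -/
theorem exists_covariance_decay [IsProbabilityMeasure P] (hε : ∀ k, Measurable (ε k))
    (hstat : IsStrictlyStationary P ε) (hβ : Tendsto (betaMixing P ε) atTop (𝓝 0))
    {g : (ℤ → ℝ) → ℝ} (hg : Measurable g)
    (hX2 : ∀ k, MemLp (functionalProcess g ε k) 2 P)
    (hX0 : ∫ ω, functionalProcess g ε 0 ω ∂P = 0)
    {η : ℝ} (hη : 0 < η) :
    ∃ h : ℕ, ∀ k l : ℤ, h ≤ (k - l).natAbs →
      |∫ ω, functionalProcess g ε k ω * functionalProcess g ε l ω ∂P| ≤ η := by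
  set X := functionalProcess g ε with hX
  set v := ∫ ω, X 0 ω * X 0 ω ∂P with hv
  have hv0 : 0 ≤ v := integral_nonneg fun ω => mul_self_nonneg _
  have hXv : ∀ k, ∫ ω, X k ω ^ 2 ∂P = v := fun k => by
    have := hstat.integral_mul_shift hg k 0 0
    simp only [add_zero] at this
    simp only [sq]
    exact this
  -- Half of `η` pays for the approximation, through `t (2 + v)`; the other half, through `β`, pays
  -- for the covariance of the window process.
  set t := min 1 (η / (2 * (2 + v))) with ht
  have ht0 : 0 < t := lt_min one_pos (by positivity)
  have ht1 : t ≤ 1 := min_le_left _ _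
  have htη : t * (2 + v) ≤ η / 2 := by
    have : t ≤ η / (2 * (2 + v)) := min_le_right _ _
    rw [le_div_iff₀ (by positivity)] at this
    linarith
  obtain ⟨m, T, Y, hY, hXY⟩ := exists_window_process hε hstat hg (hX2 0) hX0 (pow_pos ht0 2)
  set β := η / (8 * (T ^ 2 + 1)) with hβdef
  have hβ0 : 0 < β := by positivity
  obtain ⟨n, hn, hn0⟩ := ((hβ.eventually (ge_mem_nhds (ENNReal.ofReal_pos.2 hβ0))).and
    (eventually_ne_atTop 0)).exists
  refine ⟨2 * m + n, fun k l hkl => ?_⟩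
  have h1 := hY.abs_integral_mul_le hε hn0 hβ0.le hn k l hkl
  have h2 : 4 * T ^ 2 * β ≤ η / 2 := by
    rw [hβdef, mul_div_assoc', div_le_div_iff₀ (by positivity) (by norm_num)]
    nlinarith [sq_nonneg T]
  have hD : ∀ k, MemLp (fun ω => X k ω - Y k ω) 2 P := fun k => (hX2 k).sub (hY.memLp hε k)
  have iX : ∀ k, Integrable (fun ω => X k ω ^ 2) P := fun k => (hX2 k).integrable_sq
  have iD : ∀ k, Integrable (fun ω => (X k ω - Y k ω) ^ 2) P := fun k => (hD k).integrable_sq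
  have iXX : Integrable (fun ω => X k ω * X l ω) P := (hX2 k).integrable_mul (hX2 l)
  have iYY : Integrable (fun ω => Y k ω * Y l ω) P := (hY.memLp hε k).integrable_mul (hY.memLp hε l)
  have h3 : |∫ ω, X k ω * X l ω ∂P - ∫ ω, Y k ω * Y l ω ∂P| ≤ t * (2 + v) := by
    rw [← integral_sub iXX iYY]
    have iDD : Integrable (fun ω => (X k ω - Y k ω) ^ 2 + (X l ω - Y l ω) ^ 2) P :=
      (iD k).add (iD l)
    have iXX' : Integrable (fun ω => X k ω ^ 2 + X l ω ^ 2) P := (iX k).add (iX l)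
    have ib : Integrable (fun ω => (t⁻¹ + 1) / 2 * ((X k ω - Y k ω) ^ 2 + (X l ω - Y l ω) ^ 2) +
        t / 2 * (X k ω ^ 2 + X l ω ^ 2)) P :=
      (iDD.const_mul _).add (iXX'.const_mul _)
    refine abs_integral_le_integral_abs.trans ((integral_mono (iXX.sub iYY).abs ib fun ω => ?_).trans
      ?_)
    · set p := X k ω
      set p' := X l ω
      set d := X k ω - Y k ω with hd
      set d' := X l ω - Y l ω with hd'
      have e : p * p' - Y k ω * Y l ω = d * p' + p * d' - d * d' := by
        rw [hd, hd']
        ring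
      have a1 : ∀ x y : ℝ, |x * y| ≤ t⁻¹ / 2 * x ^ 2 + t / 2 * y ^ 2 := fun x y => by
        have i1 : 0 ≤ t⁻¹ / 2 * (x - t * y) ^ 2 := by positivity
        have i2 : 0 ≤ t⁻¹ / 2 * (x + t * y) ^ 2 := by positivity
        have e1 : t⁻¹ / 2 * (x - t * y) ^ 2 = t⁻¹ / 2 * x ^ 2 + t / 2 * y ^ 2 - x * y := by
          field_simp
          ring
        have e2 : t⁻¹ / 2 * (x + t * y) ^ 2 = t⁻¹ / 2 * x ^ 2 + t / 2 * y ^ 2 + x * y := by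
          field_simp
          ring
        exact abs_le.2 ⟨by linarith, by linarith⟩
      have a2 : |d * d'| ≤ 1 / 2 * d ^ 2 + 1 / 2 * d' ^ 2 :=
        abs_le.2 ⟨by nlinarith [sq_nonneg (d + d')], by nlinarith [sq_nonneg (d - d')]⟩
      have a3 := a1 d p'
      have a4 := a1 d' p
      rw [mul_comm d' p] at a4
      change |p * p' - Y k ω * Y l ω| ≤ _
      rw [e]
      refine (abs_sub _ _).trans ?_
      have := abs_add_le (d * p') (p * d')
      linarith
    · rw [integral_add (iDD.const_mul _) (iXX'.const_mul _),
        integral_const_mul, integral_const_mul, integral_add (iD k) (iD l),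
        integral_add (iX k) (iX l), hXv, hXv]
      have h4 : (t⁻¹ + 1) / 2 * (∫ ω, (X k ω - Y k ω) ^ 2 ∂P + ∫ ω, (X l ω - Y l ω) ^ 2 ∂P) ≤
          (t⁻¹ + 1) / 2 * (t ^ 2 + t ^ 2) :=
        mul_le_mul_of_nonneg_left (add_le_add (hXY k) (hXY l)) (by positivity)
      have h5 : (t⁻¹ + 1) / 2 * (t ^ 2 + t ^ 2) = t + t ^ 2 := by
        field_simp
        ring
      nlinarith
  have h6 := abs_sub_abs_le_abs_sub (∫ ω, X k ω * X l ω ∂P) (∫ ω, Y k ω * Y l ω ∂P)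
  linarith

end Stationary

/-! ### Comparison at fixed dimensions -/

section Comparison

variable {Ω Ω' : Type*} [mΩ : MeasurableSpace Ω] [MeasurableSpace Ω'] {P : Measure Ω}
  [IsProbabilityMeasure P] {P' : Measure Ω'} [IsProbabilityMeasure P']
  {ε : ℤ → Ω → ℝ} {m : ℕ} {T : ℝ} {X Y : ℤ → Ω → ℝ}

/-- Quantitative comparison with independent columns for fixed dimensions. -/
theorem abs_integral_columnStieltjes_sub_le (hε : ∀ k, Measurable (ε k))
    (hY : IsWindowProcess P ε m T Y) (hXm : ∀ k, Measurable (X k))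
    (hX : ∀ k, MemLp (X k) 2 P) {v t : ℝ} (ht : 0 < t) (ht1 : t ≤ 1)
    (hXv : ∀ k, ∫ ω, X k ω ^ 2 ∂P = v) (hXY : ∀ k, ∫ ω, (X k ω - Y k ω) ^ 2 ∂P ≤ t ^ 2)
    {K r N n : ℕ} (hN : 0 < N) (hn : 0 < n)
    (hmask : ((Finset.univ.filter fun i : Fin N => ¬ Kept K (2 * m + r) N i).card : ℝ) ≤ t ^ 2 * N)
    (hβ : betaMixing P ε (r + 1) ≤ ENNReal.ofReal t)
    (hc : ∀ (s : ℤ) (A : Matrix (Fin N) (Fin N) ℝ), IsSymmContraction A → ∃ c : ℝ,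
      ∫ ω, (quadForm A (maskedColumn Y K (2 * m + r) N s ω) - c) ^ 2 ∂P ≤ (t * N) ^ 2)
    {V : ℕ → Ω' → Fin N → ℝ} (hV : ∀ j, Measurable (V j)) (hVind : iIndepFun V P')
    (hVL : ∀ j i, MemLp (fun ω => V j ω i) 2 P')
    {x : ℕ → Ω → Fin N → ℝ} (hx : ∀ j ω i, x j ω i = X ((j * N + 1 : ℤ) + (i : ℕ)) ω)
    {G : ℝ} (hVc : ∀ j (A : Matrix (Fin N) (Fin N) ℝ), IsSymmContraction A →
      ∫ ω, |quadForm A (V j ω) - ∫ ω', quadForm A (x j ω') ∂P| ∂P' ≤ t * N * G)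
    {z : ℂ} (hz : 0 < z.im) {φ : ℂ → ℝ}
    (hφm : Measurable φ) (hφ : ∀ w w', |φ w - φ w'| ≤ ‖w - w'‖) (hφ0 : φ 0 = 0) :
    |∫ ω, φ (columnStieltjes z n fun j => x j ω) ∂P -
      ∫ ω, φ (columnStieltjes z n fun j => V j ω) ∂P'| ≤
      t * (8 * z.im⁻¹ * (n / N) + 4 * (‖z‖ / z.im ^ 3) * (8 + 6 * v + G)) := by
  set q := 2 * m + r with hq
  set D := ‖z‖ / z.im ^ 3 with hD
  set y : ℕ → Ω → Fin N → ℝ := fun j => maskedColumn Y K q N (j * N + 1 : ℤ) with hy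
  have hym : ∀ j, Measurable (y j) := fun j =>
    measurable_maskedColumn fun i _ => hY.measurable' hε _
  have hxm : ∀ j, Measurable (x j) := fun j => measurable_pi_lambda _ fun i => by
    simp only [hx]
    exact hXm _
  set F : (ℕ → Fin N → ℝ) → ℝ := fun w => φ (columnStieltjes z n w) with hF
  have hFm : Measurable F := hφm.comp (measurable_columnStieltjes n)
  have hFb : ∀ w, |F w| ≤ z.im⁻¹ := fun w => by
    have := hφ (columnStieltjes z n w) 0
    rw [hφ0, sub_zero, sub_zero] at this
    exact this.trans (norm_columnStieltjes_le hz n _)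
  have hstep1 : |∫ ω, F (fun j => x j ω) ∂P - ∫ ω, F (fun j => y j ω) ∂P| ≤
      4 * D * t * (2 + 3 * v) := by
    have i1 := integrable_comp_of_bounded P hFm hFb (measurable_pi_lambda _ hxm)
    have i2 := integrable_comp_of_bounded P hFm hFb (measurable_pi_lambda _ hym)
    have happ := fun j : ℕ => integral_column_sub_le hε hY hX ht ht1 hXv hXY hmask (j * N + 1 : ℤ)
      (x := x j) (hx j)
    have ib : Integrable (fun ω => (N : ℝ)⁻¹ * (D * (n : ℝ)⁻¹ * (4 * ∑ j ∈ Finset.range n,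
        ((t⁻¹ + 1) * ((x j ω - y j ω) ⬝ᵥ (x j ω - y j ω)) + t * (x j ω ⬝ᵥ x j ω))))) P :=
      (((integrable_finsetSum _ fun j _ => (happ j).1).const_mul _).const_mul _).const_mul _
    rw [← integral_sub i1 i2]
    refine abs_integral_le_integral_abs.trans ((integral_mono (i1.sub i2).abs ib fun ω =>
      (hφ _ _).trans (norm_columnStieltjes_sub_le hz n ht _ _)).trans ?_)
    rw [integral_const_mul, integral_const_mul, integral_const_mul,
      integral_finsetSum _ fun j _ => (happ j).1]
    have hsum := Finset.sum_le_sum fun j (_ : j ∈ Finset.range n) => (happ j).2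
    rw [Finset.sum_const, Finset.card_range, nsmul_eq_mul] at hsum
    refine (mul_le_mul_of_nonneg_left (mul_le_mul_of_nonneg_left (mul_le_mul_of_nonneg_left hsum
      (by norm_num : (0 : ℝ) ≤ 4)) (by positivity)) (by positivity)).trans_eq ?_
    field_simp
  have hstep2 := abs_integral_sub_integral_le_of_replacement (P := P) (P' := P') (n := n) hFm hFb
    (fun a b hab => by
      simp only [hF]
      rw [columnStieltjes_congr hab])
    (c := (N : ℝ)⁻¹ * (2 * z.im⁻¹))
    (fun a j hj u u' => (hφ _ _).trans (norm_columnStieltjes_update_sub_le hz n a hj u u'))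
    -- Earlier columns have kept entries up to index `j N - q` and see `ε` up to `j N - q + m`.
    -- Column `j` sees it from `j N + 1 - m`, which is `r + 1` later because `q = 2m + r`.
    (U := y) (𝒜 := fun j => sigmaOf ε (Set.Iic ((j * N : ℤ) - q + m)))
    (ℬ := fun j => sigmaOf ε (Set.Ici ((j * N : ℤ) - q + m + (r + 1 : ℕ))))
    (fun j => sigmaOf_le hε _) (fun j => sigmaOf_le hε _)
    (fun j i hij => measurable_maskedColumn fun i' hi' => hY.measurable_of_subset fun l _ hl => by
      have h1 := hi'.add_lt hi'.1
      have h2 : K * (N / K) ≤ N := Nat.mul_div_le N K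
      have h3 : ((i : ℤ) + 1) * N ≤ j * N :=
        mul_le_mul_of_nonneg_right (by exact_mod_cast hij) (by positivity)
      simp only [Set.mem_Iic]
      linarith)
    (fun j => measurable_maskedColumn fun i' _ => hY.measurable_of_subset fun l hl _ => by
      have : (0 : ℤ) ≤ (i' : ℕ) := by positivity
      simp only [Set.mem_Ici]
      push_cast
      linarith)
    ht.le (fun j => (betaCoeff_sigmaOf_le (Nat.succ_ne_zero r) _).trans hβ) hV hVind
    (κ := (N : ℝ)⁻¹ * (D * (n : ℝ)⁻¹ * (4 * (t * N * (6 + 3 * v + G)))))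
    (fun j hj w => abs_integral_update_sub_le hj hz hφm hφ hφ0 (hym j) (hV j)
      (hY.memLp_maskedColumn hε K q N _) (hVL j) (fun A hA => ⟨∫ ω', quadForm A (x j ω') ∂P, by
        have k1 := integral_abs_quadForm_maskedColumn_le hε hY hX ht ht1 hXv hXY hN hmask
          (j * N + 1 : ℤ) (x := x j) (hx j) hA (hc _ A hA)
        have k2 := hVc j A hA
        linarith⟩) w)
  refine (abs_sub_le _ _ _).trans ((add_le_add hstep1 hstep2).trans_eq ?_)
  field_simp
  ring

end Comparison

/-! ### Choice of parameters and passage to the limit -/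

section Final

theorem eventually_le_mul_natCast (a : ℝ) {b : ℝ} (hb : 0 < b) :
    ∀ᶠ N : ℕ in atTop, a ≤ b * N :=
  (tendsto_natCast_atTop_atTop.const_mul_atTop hb).eventually_ge_atTop a

variable {Ω Ω' : Type*} [mΩ : MeasurableSpace Ω] [MeasurableSpace Ω'] {P : Measure Ω}
  [IsProbabilityMeasure P] {P' : Measure Ω'} [IsProbabilityMeasure P'] {ε : ℤ → Ω → ℝ}

/-- The block structure can be chosen so that quadratic forms of masked columns concentrate. -/
theorem IsWindowProcess.exists_block_parameters {m : ℕ} {T : ℝ} {Y : ℤ → Ω → ℝ}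
    (hY : IsWindowProcess P ε m T Y) (hε : ∀ k, Measurable (ε k))
    (hβ : Tendsto (betaMixing P ε) atTop (𝓝 0)) {t : ℝ} (ht : 0 < t) :
    ∃ K r : ℕ, betaMixing P ε (r + 1) ≤ ENNReal.ofReal t ∧ ∀ᶠ N : ℕ in atTop,
      ((Finset.univ.filter fun i : Fin N => ¬ Kept K (2 * m + r) N i).card : ℝ) ≤ t ^ 2 * N ∧
      ∀ (s : ℤ) (A : Matrix (Fin N) (Fin N) ℝ), IsSymmContraction A → ∃ c : ℝ,
        ∫ ω, (quadForm A (maskedColumn Y K (2 * m + r) N s ω) - c) ^ 2 ∂P ≤ (t * N) ^ 2 := by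
  -- The order matters: `K` makes the block term at most `t² / 3`, then `β` (hence the gap `r`) is
  -- chosen depending on `K`, and finally `N` is taken large enough for the remaining term and for
  -- the masked fraction.
  obtain ⟨K, hKt⟩ := exists_nat_gt (24 * T ^ 4 / t ^ 2)
  have hKR : (0 : ℝ) < K := lt_of_le_of_lt (by positivity) hKt
  have hK : 0 < K := by exact_mod_cast hKR
  have hK1 : T ^ 4 * (8 / K) ≤ t ^ 2 / 3 := by
    rw [div_lt_iff₀ (by positivity)] at hKt
    rw [mul_div_assoc', div_le_div_iff₀ hKR (by norm_num)]
    linarith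
  set β := min t (t ^ 2 / (480 * (T ^ 4 + 1) * K)) with hβdef
  have hβ0 : 0 < β := lt_min ht (by positivity)
  have hβ1 : T ^ 4 * (160 * (K * β)) ≤ t ^ 2 / 3 := by
    have h1 : β ≤ t ^ 2 / (480 * (T ^ 4 + 1) * K) := min_le_right _ _
    rw [le_div_iff₀ (by positivity)] at h1
    have h2 : 0 ≤ K * β := by positivity
    nlinarith
  obtain ⟨r, hr⟩ := (((tendsto_add_atTop_iff_nat 1).2 hβ).eventually
    (ge_mem_nhds (ENNReal.ofReal_pos.2 hβ0))).exists
  refine ⟨K, r, hr.trans (ENNReal.ofReal_le_ofReal (min_le_left _ _)), ?_⟩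
  filter_upwards [eventually_le_mul_natCast ((K * (2 * m + r) + K : ℕ) : ℝ) (pow_pos ht 2),
    eventually_le_mul_natCast (T ^ 4 * (16 * (K * (2 * m + r + 1))))
      (by positivity : 0 < t ^ 2 / 3)] with N hN1 hN2
  refine ⟨le_trans (by exact_mod_cast card_not_kept_le K (2 * m + r) N hK) hN1, fun s A hA => ?_⟩
  obtain ⟨c, hc⟩ := hY.exists_integral_quadForm_sq_le hε hβ0.le hr hK N s hA
  refine ⟨c, hc.trans ?_⟩
  nlinarith

/-- Comparison of a bounded functional of the two Stieltjes transforms. -/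
theorem exists_eventually_abs_integral_sub_le (hε : ∀ k, Measurable (ε k))
    (hstat : IsStrictlyStationary P ε) (hβ : Tendsto (betaMixing P ε) atTop (𝓝 0))
    {g : (ℤ → ℝ) → ℝ} (hg : Measurable g) {X : ℤ → Ω → ℝ} (hXg : X = functionalProcess g ε)
    (hX2 : ∀ k, MemLp (X k) 2 P) (hX0 : ∀ k, ∫ ω, X k ω ∂P = 0)
    {Z : ℕ → ℤ → Ω' → ℝ} (hZgauss : ∀ i, IsGaussianProcess (Z i) P')
    (hZcov : ∀ i k l, cov[Z i k, Z i l; P'] = cov[X k, X l; P])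
    (hZindep : iIndepFun (fun (i : ℕ) (ω : Ω') (k : ℤ) => Z i k ω) P')
    (hZident : ∀ i, IdentDistrib (fun ω (k : ℤ) => Z i k ω) (fun ω (k : ℤ) => Z 0 k ω) P' P')
    {N : ℕ → ℕ} {c : ℝ} (hc : 0 < c)
    (hNc : Tendsto (fun n : ℕ => (N n : ℝ) / (n : ℝ)) atTop (𝓝 c))
    {z : ℂ} (hz : 0 < z.im) {φ : ℂ → ℝ}
    (hφm : Measurable φ) (hφ : ∀ w w', |φ w - φ w'| ≤ ‖w - w'‖) (hφ0 : φ 0 = 0) :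
    ∃ C : ℝ, ∀ t : ℝ, 0 < t → t ≤ 1 → ∀ᶠ n in atTop,
      |∫ ω, φ (columnStieltjes z n fun j (i : Fin (N n)) => X ((j * N n + 1 : ℤ) + (i : ℕ)) ω) ∂P -
        ∫ ω, φ (columnStieltjes z n fun j (i : Fin (N n)) => Z j ((i : ℕ) + 1) ω) ∂P'| ≤
        C * t := by
  subst hXg
  set X := functionalProcess g ε with hX
  have hXm : ∀ k, Measurable (X k) := measurable_functionalProcess hε hg
  set v := ∫ ω, X 0 ω * X 0 ω ∂P with hv
  have hv0 : 0 ≤ v := integral_nonneg fun ω => mul_self_nonneg _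
  have hXv : ∀ k, ∫ ω, X k ω ^ 2 ∂P = v := fun k => by
    have := hstat.integral_mul_shift hg k 0 0
    simp only [add_zero] at this
    simp only [sq]
    exact this
  have hcovX : ∀ k l, cov[X k, X l; P] = ∫ ω, X k ω * X l ω ∂P := fun k l => by
    rw [covariance_eq_sub (hX2 k) (hX2 l)]
    simp [hX0]
  have hXXv : ∀ k l, |∫ ω, X k ω * X l ω ∂P| ≤ v := fun k l => by
    have i1 : Integrable (fun ω => X k ω * X l ω) P := (hX2 k).integrable_mul (hX2 l)
    have ik := (hX2 k).integrable_sq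
    have il := (hX2 l).integrable_sq
    have h1 : ∫ ω, |X k ω * X l ω| ∂P ≤ ∫ ω, (1 / 2 * X k ω ^ 2 + 1 / 2 * X l ω ^ 2) ∂P := by
      refine integral_mono i1.abs ((ik.const_mul _).add (il.const_mul _)) fun ω => ?_
      exact abs_le.2 ⟨by nlinarith [sq_nonneg (X k ω + X l ω)],
        by nlinarith [sq_nonneg (X k ω - X l ω)]⟩
    rw [integral_add (ik.const_mul _) (il.const_mul _), integral_const_mul, integral_const_mul,
      hXv, hXv] at h1
    exact abs_integral_le_integral_abs.trans (by linarith)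
  set D := ‖z‖ / z.im ^ 3 with hD
  -- The constant is fixed before `t`, hence before `m`, `T`, `K`, `r` and `h`. Here `2 / c` bounds
  -- `n / N` eventually, `1 + 8 v` comes from Gaussian concentration, and the final `1` from the
  -- Gaussian mean.
  refine ⟨8 * z.im⁻¹ * (2 / c) + 4 * D * (8 + 6 * v + (1 + 8 * v)) + 1, fun t ht ht1 => ?_⟩
  obtain ⟨m, T, Y, hY, hXY⟩ := exists_window_process hε hstat hg (hX2 0) (hX0 0) (pow_pos ht 2)
  obtain ⟨K, r, hr, hKr⟩ := hY.exists_block_parameters hε hβ ht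
  obtain ⟨h, hh⟩ := exists_covariance_decay hε hstat hβ hg hX2 (hX0 0) (pow_pos ht 2)
  have hNc2 : ∀ᶠ n : ℕ in atTop, c / 2 < (N n : ℝ) / n :=
    hNc.eventually (lt_mem_nhds (by linarith))
  have hNtop : Tendsto N atTop atTop := by
    have : Tendsto (fun n : ℕ => (N n : ℝ)) atTop atTop := by
      refine tendsto_atTop_mono' _ ?_ (tendsto_natCast_atTop_atTop.const_mul_atTop
        (by positivity : 0 < c / 2))
      filter_upwards [hNc2, eventually_gt_atTop 0] with n hn hn0
      have hnR : (0 : ℝ) < n := by exact_mod_cast hn0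
      exact ((lt_div_iff₀ hnR).1 hn).le
    exact tendsto_natCast_atTop_iff.1 this
  filter_upwards [hNc2, eventually_gt_atTop 0, hNtop.eventually (eventually_gt_atTop 0),
    hNtop.eventually hKr, hNtop.eventually (eventually_le_mul_natCast (2 * h * v) (pow_pos ht 2)),
    hNtop.eventually (eventually_le_mul_natCast (4 * z.im⁻¹) ht)] with n hn hn0 hN0 hK hNh hNz
  have hnR : (0 : ℝ) < n := by exact_mod_cast hn0
  have hNR : (0 : ℝ) < N n := by exact_mod_cast hN0
  obtain ⟨V, a, hVm, hVind, hVg, hV0, hVcov, hVZ⟩ :=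
    exists_centered_gaussian_columns hZgauss hZindep hZident (N n)
  set x : ℕ → Ω → Fin (N n) → ℝ := fun j ω i => X ((j * N n + 1 : ℤ) + (i : ℕ)) ω with hx
  have hVX : ∀ j i i', ∫ ω, V j ω i * V j ω i' ∂P' =
      ∫ ω, X ((i : ℕ) + 1) ω * X ((i' : ℕ) + 1) ω ∂P := fun j i i' => by
    rw [hVcov, hZcov, hcovX]
  have hVL : ∀ j i, MemLp (fun ω => V j ω i) 2 P' := fun j i => ((hVg j).eval i).memLp_two
  have hxL : ∀ j i, MemLp (fun ω => x j ω i) 2 P := fun j i => hX2 _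
  have hmean : ∀ j A, ∫ ω, quadForm A (x j ω) ∂P = ∫ ω, quadForm A (V j ω) ∂P' := fun j A => by
    rw [(integral_quadForm_eq (hxL j) A).2, (integral_quadForm_eq (hVL j) A).2]
    refine Finset.sum_congr rfl fun i _ => Finset.sum_congr rfl fun i' _ => ?_
    rw [hVX]
    have := hstat.integral_mul_shift hg (j * N n) ((i : ℕ) + 1) ((i' : ℕ) + 1)
    simp only [hx]
    rw [← this]
    simp only [hX, add_assoc, add_comm (1 : ℤ)]
  have hVc : ∀ j (A : Matrix (Fin (N n)) (Fin (N n)) ℝ), IsSymmContraction A →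
      ∫ ω, |quadForm A (V j ω) - ∫ ω', quadForm A (x j ω') ∂P| ∂P' ≤
        t * N n * (1 + 8 * v) := fun j A hA => by
    rw [hmean]
    -- The next column serves as the independent copy needed for the rotation.
    refine (integral_abs_quadForm_gaussian_le (hVm j) (hVm (j + 1)) (hVg j) (hVg (j + 1))
      (hVind.indepFun (Nat.succ_ne_self j).symm) (hV0 j) (hV0 (j + 1))
      (fun i i' => by rw [hVX, hVX]) hv0 (sq_nonneg t) (h := h) (fun i i' => by
        rw [hVX]
        exact hXXv _ _) (fun i i' hii => by
        rw [hVX]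
        exact hh _ _ (by omega)) hA (by positivity : 0 < t * N n)).trans ?_
    have h1 : 4 * (N n * v) * (2 * h * v + t ^ 2 * N n) / (t * N n) ≤ t * N n * (8 * v) := by
      rw [div_le_iff₀ (by positivity)]
      have := mul_le_mul_of_nonneg_left hNh (by positivity : 0 ≤ 4 * (N n * v))
      nlinarith
    linarith
  have hmain := abs_integral_columnStieltjes_sub_le hε hY hXm hX2 ht ht1 hXv hXY hN0 hn0 hK.1 hr
    hK.2 hVm hVind hVL (x := x) (fun j ω i => rfl) hVc hz hφm hφ hφ0
  have hφb : ∀ w, ‖w‖ ≤ z.im⁻¹ → |φ w| ≤ z.im⁻¹ := fun w hw => by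
    have := hφ w 0
    rw [hφ0, sub_zero, sub_zero] at this
    exact this.trans hw
  set F : (ℕ → Fin (N n) → ℝ) → ℝ := fun w => φ (columnStieltjes z n w) with hF
  have hFm : Measurable F := hφm.comp (measurable_columnStieltjes n)
  have hFb : ∀ w, |F w| ≤ z.im⁻¹ := fun w => hφb _ (norm_columnStieltjes_le hz n _)
  -- Restoring the common mean costs `4 / (N Im z)`, at most `t` for large `N`.
  have hshift : |∫ ω, F (fun j => V j ω) ∂P' -
      ∫ ω, F (fun j (i : Fin (N n)) => Z j ((i : ℕ) + 1) ω) ∂P'| ≤ t := by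
    have e : ∫ ω, F (fun j (i : Fin (N n)) => Z j ((i : ℕ) + 1) ω) ∂P' =
        ∫ ω, F (fun j => V j ω + a) ∂P' := by
      refine integral_congr_ae ?_
      filter_upwards [ae_all_iff.2 hVZ] with ω hω
      exact congrArg F (funext hω)
    have i1 := integrable_comp_of_bounded P' hFm hFb (measurable_pi_lambda _ hVm)
    have i2 := integrable_comp_of_bounded P' hFm hFb
      (measurable_pi_lambda _ fun j => (hVm j).add_const a)
    rw [e, ← integral_sub i1 i2]
    have hb : ∀ ω, ‖F (fun j => V j ω) - F (fun j => V j ω + a)‖ ≤ t := fun ω => by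
      refine (hφ _ _).trans ?_
      rw [norm_sub_rev]
      refine (norm_columnStieltjes_add_const_sub_le hz n _ a).trans ?_
      rw [inv_mul_le_iff₀ hNR]
      linarith
    have := norm_integral_le_of_norm_le_const (μ := P') (Eventually.of_forall hb)
    simpa using this
  refine (abs_sub_le _ _ _).trans ((add_le_add hmain hshift).trans ?_)
  have hnN : (n : ℝ) / N n ≤ 2 / c := by
    rw [lt_div_iff₀ hnR] at hn
    rw [div_le_div_iff₀ hNR hc]
    linarith
  have h1 : t * (8 * z.im⁻¹ * (n / N n)) ≤ t * (8 * z.im⁻¹ * (2 / c)) := by gcongr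
  nlinarith

end Final

end GramBetaMixing

/-! ### The theorem -/

theorem mainTheorem2
    {Ω : Type*} [MeasurableSpace Ω] (P : Measure Ω) [IsProbabilityMeasure P]
    {Ω' : Type*} [MeasurableSpace Ω'] (P' : Measure Ω') [IsProbabilityMeasure P']
    -- the strictly stationary sequence `ε`, with `β n → 0`
    (ε : ℤ → Ω → ℝ) (hε : ∀ k, Measurable (ε k))
    (hstat : GramBetaMixing.IsStrictlyStationary P ε)
    (hβ : Tendsto (GramBetaMixing.betaMixing P ε) atTop (𝓝 0))
    -- the centered, square integrable process `X k = g (…, ε (k-1), ε k, ε (k+1), …)`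
    (g : (ℤ → ℝ) → ℝ) (hg : Measurable g)
    (X : ℤ → Ω → ℝ) (hX : X = GramBetaMixing.functionalProcess g ε)
    (hX2 : ∀ k, MemLp (X k) 2 P) (hX0 : ∀ k, ∫ ω, X k ω ∂P = 0)
    -- the i.i.d. copies `Z i` of a Gaussian process with the covariances of `X`
    (Z : ℕ → ℤ → Ω' → ℝ)
    (hZgauss : ∀ i, IsGaussianProcess (Z i) P')
    (hZcov : ∀ i k l, cov[Z i k, Z i l; P'] = cov[X k, X l; P])
    (hZindep : iIndepFun (fun (i : ℕ) (ω : Ω') (k : ℤ) => Z i k ω) P')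
    (hZident : ∀ i, IdentDistrib (fun ω (k : ℤ) => Z i k ω) (fun ω (k : ℤ) => Z 0 k ω) P' P')
    -- the dimensions
    (N : ℕ → ℕ) (hN : ∀ n, 0 < N n) (c : ℝ) (hc : 0 < c)
    (hNc : Tendsto (fun n : ℕ => (N n : ℝ) / (n : ℝ)) atTop (𝓝 c))
    -- the random matrices
    (B : (n : ℕ) → Ω → Matrix (Fin (N n)) (Fin (N n)) ℝ)
    (hB : ∀ n ω, B n ω =
      GramBetaMixing.gramMatrix (GramBetaMixing.dataMatrix (fun k => X k ω) (N n) n))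
    (G : (n : ℕ) → Ω' → Matrix (Fin (N n)) (Fin (N n)) ℝ)
    (hG : ∀ n ω, G n ω =
      GramBetaMixing.gramMatrix (GramBetaMixing.copiesMatrix (fun i k => Z i k ω) (N n) n))
    (z : ℂ) (hz : 0 < z.im) :
    (∀ n, Integrable (fun ω => GramBetaMixing.spectralStieltjes (B n ω) z) P) ∧
    (∀ n, Integrable (fun ω => GramBetaMixing.spectralStieltjes (G n ω) z) P') ∧
    Tendsto (fun n : ℕ =>
        ‖(∫ ω, GramBetaMixing.spectralStieltjes (B n ω) z ∂P)
          - ∫ ω, GramBetaMixing.spectralStieltjes (G n ω) z ∂P'‖) atTop (𝓝 0) := by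
  have hXm : ∀ k, Measurable (X k) := hX ▸ GramBetaMixing.measurable_functionalProcess hε hg
  have hBs : ∀ n ω, GramBetaMixing.spectralStieltjes (B n ω) z =
      GramBetaMixing.columnStieltjes z n
        fun j (i : Fin (N n)) => X ((j * N n + 1 : ℤ) + (i : ℕ)) ω := fun n ω => by
    rw [hB, ← GramBetaMixing.columnStieltjes_eq_spectralStieltjes hz]
    congr 1
    refine GramBetaMixing.gramMatrix_eq_columnGram _ _ fun i j => ?_
    exact congrArg (fun k => X k ω) (by ring)
  have hGs : ∀ n ω, GramBetaMixing.spectralStieltjes (G n ω) z =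
      GramBetaMixing.columnStieltjes z n
        fun j (i : Fin (N n)) => Z j ((i : ℕ) + 1) ω := fun n ω => by
    rw [hG, ← GramBetaMixing.columnStieltjes_eq_spectralStieltjes hz]
    congr 1
    exact GramBetaMixing.gramMatrix_eq_columnGram _ _ fun i j => rfl
  have hBint : ∀ n, Integrable (fun ω => GramBetaMixing.spectralStieltjes (B n ω) z) P := fun n => by
    simp only [hBs]
    refine Integrable.of_bound (Measurable.aestronglyMeasurable ?_) z.im⁻¹
      (Eventually.of_forall fun ω => GramBetaMixing.norm_columnStieltjes_le hz n _)
    exact (GramBetaMixing.measurable_columnStieltjes n).comp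
      (measurable_pi_lambda _ fun j => measurable_pi_lambda _ fun i => hXm _)
  have hGint : ∀ n, Integrable (fun ω => GramBetaMixing.spectralStieltjes (G n ω) z) P' :=
      fun n => by
    simp only [hGs]
    refine Integrable.of_bound (AEMeasurable.aestronglyMeasurable ?_) z.im⁻¹
      (Eventually.of_forall fun ω => GramBetaMixing.norm_columnStieltjes_le hz n _)
    exact (GramBetaMixing.measurable_columnStieltjes n).comp_aemeasurable
      (aemeasurable_pi_lambda _ fun j => aemeasurable_pi_lambda _ fun i =>
        (hZgauss j).aemeasurable _)
  refine ⟨hBint, hGint, ?_⟩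
  -- The comparison is made for real-valued functionals, so it is applied to the real and the
  -- imaginary part, both 1-Lipschitz and zero at zero.
  obtain ⟨C₁, h₁⟩ := GramBetaMixing.exists_eventually_abs_integral_sub_le hε hstat hβ hg hX hX2 hX0
    hZgauss hZcov hZindep hZident hc hNc hz (φ := Complex.re) Complex.measurable_re
    (fun w w' => by rw [← Complex.sub_re]; exact Complex.abs_re_le_norm _) Complex.zero_re
  obtain ⟨C₂, h₂⟩ := GramBetaMixing.exists_eventually_abs_integral_sub_le hε hstat hβ hg hX hX2 hX0
    hZgauss hZcov hZindep hZident hc hNc hz (φ := Complex.im) Complex.measurable_im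
    (fun w w' => by rw [← Complex.sub_im]; exact Complex.abs_im_le_norm _) Complex.zero_im
  rw [Metric.tendsto_atTop']
  intro η hη
  set t := min 1 (η / (2 * (|C₁| + |C₂| + 1))) with ht
  have ht0 : 0 < t := lt_min one_pos (by positivity)
  have htη : (C₁ + C₂) * t < η := by
    have h3 : t * (2 * (|C₁| + |C₂| + 1)) ≤ η :=
      (le_div_iff₀ (by positivity)).1 (min_le_right _ _)
    nlinarith [le_abs_self C₁, le_abs_self C₂, abs_nonneg C₁, abs_nonneg C₂]
  obtain ⟨n₀, hn₀⟩ := eventually_atTop.1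
    ((h₁ t ht0 (min_le_left _ _)).and (h₂ t ht0 (min_le_left _ _)))
  refine ⟨n₀, fun n hn => ?_⟩
  obtain ⟨hre, him⟩ := hn₀ n hn.le
  simp only [← hBs, ← hGs] at hre him
  have eBre := Complex.reCLM.integral_comp_comm (hBint n)
  have eGre := Complex.reCLM.integral_comp_comm (hGint n)
  have eBim := Complex.imCLM.integral_comp_comm (hBint n)
  have eGim := Complex.imCLM.integral_comp_comm (hGint n)
  simp only [Complex.reCLM_apply, Complex.imCLM_apply] at eBre eGre eBim eGim
  rw [eBre, eGre, ← Complex.sub_re] at hre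
  rw [eBim, eGim, ← Complex.sub_im] at him
  rw [dist_zero_right, norm_norm]
  refine (Complex.norm_le_abs_re_add_abs_im _).trans_lt ?_
  linarith
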